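/- **Setting.** Let $\mathcal M\subset\mathbb R^n$ be a compact embedded smooth submanifold with diameter $\mathcal D$ and the induced metric, $\mathcal P_{T_x\mathcal M}$ the orthogonal projection onto $T_x\mathcal M$, and $\mathrm{grad}\,h(x)=\mathcal P_{T_x\mathcal M}(\nabla h(x))$. Let $\mathcal R$ be a (smooth, globally defined) retraction on $\mathcal M$, and $\mathcal T$ a smooth isometric vector transport along it: for $\omega\in T_x\mathcal M$, $\mathcal T_\omega:T_x\mathcal M\to T_{\mathcal R_x(\omega)}\mathcal M$ is a linear isometry with $\mathcal T_0=\mathrm{id}$. For $y=\mathcal R_x(\omega)$ write $\mathcal T_x^y=\mathcal T_\omega$ and $\mathcal T_y^x=(\mathcal T_\omega)^{-1}$. Let $\xi$ be a random variable with law $P$, $f(\cdot,\xi):\mathbb R^n\to\mathbb R$ continuously differentiable, $F(x)=\mathbb E_\xi[f(x,\xi)]$ (finite), $g:\mathbb R^m\to\mathbb R$, $A\in\mathbb R^{m\times n}$ with spectral norm $\|A\|$, and $$\mathcal L_\rho(x,y,\lambda)=F(x)+g(y)-\langle\lambda,Ax-y\rangle+\tfrac\rho2\|Ax-y\|^2 .$$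 **Assumptions.** (1) $F$ is differentiable and $\nabla F$ is $L_{\nabla F}$-Lipschitz on $\mathrm{conv}(\mathcal M)$; $g$ is convex and $L_g$-Lipschitz; $F^*=\inf_{\mathcal M}F>-\infty$ and $g^*=\inf g>-\infty$. (2) For all $x\in\mathcal M$, $\mathbb E_\xi[\mathrm{grad} f(x,\xi)]=\mathrm{grad} F(x)$ and $\mathbb E_\xi\|\mathrm{grad} f(x,\xi)-\mathrm{grad} F(x)\|^2\le\sigma^2$. (3) For all $x\in\mathcal M$, $\omega\in T_x\mathcal M$ and $y=\mathcal R_x(\omega)$, $\mathbb E_\xi\|\mathrm{grad} f(x,\xi)-\mathcal T_y^x\,\mathrm{grad} f(y,\xi)\|^2\le\tilde L^2\|\omega\|^2$. **Algorithm (MARS-ADMM).** Let $c_\rho,c_\alpha,c_\beta,c_\eta,\beta_1$ be parameters, $x_1\in\mathcal M$, $y_1,\lambda_1\in\mathbb R^m$ be deterministic, and let $\mathcal S_1,\mathcal S_2,\dots$ be non-empty mini-batches of independent samples with law $P$; put $\mathrm{grad} f_{\mathcal S}(x)=\frac1{|\mathcal S|}\sum_{\xi\in\mathcal S}\mathrm{grad}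 f(x,\xi)$ and $v_1=\mathrm{grad} f_{\mathcal S_1}(x_1)$. For $k\ge1$, with $\rho_k=c_\rho k^{1/3}$, $\eta_k=c_\eta k^{-1/3}$, $\alpha_{k+1}=c_\alpha k^{-2/3}$: $$y_{k+1}=\arg\min_y\mathcal L_{\rho_k}(x_k,y,\lambda_k),\qquad \mathcal G_k=v_k+\mathcal P_{T_{x_k}\mathcal M}\bigl(\rho_kA^\top(Ax_k-y_{k+1}-\lambda_k/\rho_k)\bigr),\qquad x_{k+1}=\mathcal R_{x_k}(-\eta_k\mathcal G_k),$$ $$\beta_{k+1}=\min\Bigl(\tfrac{\beta_1\|Ax_1-y_1\|}{\|Ax_{k+1}-y_{k+1}\|(k+2)^2\ln(k+3)},\tfrac{c_\beta}{k^{1/3}\ln^2(k+2)}\Bigr),\qquad \lambda_{k+1}=\lambda_k-\beta_{k+1}(Ax_{k+1}-y_{k+1}),$$ $$v_{k+1}=\mathrm{grad} f_{\mathcal S_{k+1}}(x_{k+1})+(1-\alpha_{k+1})\mathcal T_{x_k}^{x_{k+1}}\bigl(v_k-\mathrm{grad} f_{\mathcal S_{k+1}}(x_k)\bigr)$$ (the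 first term of the minimum being $+\infty$ when $Ax_{k+1}=y_{k+1}$). Let $\varepsilon_k=v_k-\mathrm{grad} F(x_k)$. **Constants.** There are $p,q>0$ and $\mathcal B$ such that $\|\mathcal R_x(u)-x\|\le p\|u\|$, $\|\mathcal R_x(u)-x-u\|\le q\|u\|^2$ and $\|\nabla F(x)\|\le\mathcal B$ for all $x\in\mathcal M$, $u\in T_x\mathcal M$; fix any such $p,q,\mathcal B$. Let $\lambda_{\max}=\|\lambda_1\|+\frac{\pi^2}6\beta_1\|Ax_1-y_1\|$, $\Theta=\mathcal B+\|A\|^2\mathcal D+\|A\|(L_g+\lambda_{\max}+2\|A\|\mathcal D)+\|A\|\lambda_{\max}$, $M=(L_{\nabla F}+\|A\|^2)p^2+2q\Theta$, $\gamma_k=c_\gamma(k-1)^{1/3}$, $$\psi_k=\mathbb E[\mathcal L_{\rho_k}(x_k,y_k,\lambda_k)+\gamma_k\|\varepsilon_k\|^2],\qquad \psi^*=F^*+g^*-\lambda_{\max}(L_g+\lambda_{\max}+\|A\|\mathcal D).$$ **Theorem.** There are absolute constants $\mathcal C_1,\mathcal C_2,\mathcal C_3$ such that the following holds in every such setting.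 Let $\beta_1>0$, $c_\rho\ge2\sqrt2$, $0.8\le c_\alpha\le1$, $0<c_\beta\le\frac{c_\rho}3$, $0<c_\nu\le c_\rho$, $0<c_\gamma\le c_\rho$, $c_\nu c_\gamma\ge8$ and $$0<c_\eta\le\min\Bigl\{\frac1{8p^2\|A\|^2},\frac1{1+M},\frac1{8\tilde L^2}\Bigr\}\frac1{c_\rho}\qquad(1/0=+\infty).$$ Then $\mathbb E\|\varepsilon_k\|^2$ and $\mathbb E\|\mathcal G_k\|^2$ are finite for all $k\ge1$, and for every integer $K\ge1$ $$\sum_{k=1}^K\frac{c_\alpha c_\gamma}2k^{-1/3}\,\mathbb E\|\varepsilon_k\|^2+\sum_{k=1}^K\frac{c_\eta}8k^{-1/3}\,\mathbb E\|\mathcal G_k\|^2\le\mathcal C,$$ $$\mathcal C=\psi_1-\psi^*+2c_\gamma c_\alpha^2\sigma^2\ln K+\Bigl(\frac{\mathcal C_1}{3c_\rho}+\frac{2c_\beta\mathcal C_2}{c_\rho^2}\Bigr)(L_g+\lambda_{\max})^2+\mathcal C_3c_\gamma\sigma^2 .$$ -/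

import Mathlib

open MeasureTheory ProbabilityTheory

noncomputable section

namespace MARS

/-- `ℝⁿ` with its Euclidean inner product. -/
abbrev Euc (n : ℕ) : Type := EuclideanSpace ℝ (Fin n)

section Geometry

open scoped ContDiff

/-! ### Embedded submanifolds, tangent spaces, Riemannian gradients -/

/-- `M` is a `d`-dimensional embedded smooth submanifold of `ℝⁿ`: around each of its points there is
a smooth diffeomorphism between open subsets of `ℝⁿ` that straightens `M` to a `d`-dimensional
linear subspace. -/
def IsSubmanifold {n : ℕ} (d : ℕ) (M : Set (Euc n)) : Prop :=
  ∀ x ∈ M, ∃ (φ : OpenPartialHomeomorph (Euc n) (Euc n)) (V : Submodule ℝ (Euc n)),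
    x ∈ φ.source ∧ ContDiffOn ℝ ∞ φ φ.source ∧ ContDiffOn ℝ ∞ φ.symm φ.target ∧
    Module.finrank ℝ V = d ∧ φ '' (φ.source ∩ M) = φ.target ∩ (V : Set (Euc n))

/-- `T_x M`: velocities at `x` of the differentiable curves on `M` through `x`. For a submanifold
these velocities already form a linear subspace; the span makes this part of the type. -/
def tangentSpace {n : ℕ} (M : Set (Euc n)) (x : Euc n) : Submodule ℝ (Euc n) :=
  Submodule.span ℝ {u | ∃ (γ : ℝ → Euc n) (δ : ℝ), 0 < δ ∧ γ 0 = x ∧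
    (∀ t ∈ Set.Icc (-δ) δ, γ t ∈ M) ∧ DifferentiableOn ℝ γ (Set.Icc (-δ) δ) ∧ HasDerivAt γ u 0}

/-- Orthogonal projection of `ℝⁿ` onto `T_x M`. -/
def tangentProj {n : ℕ} (M : Set (Euc n)) (x : Euc n) : Euc n →L[ℝ] Euc n :=
  (tangentSpace M x).starProjection

/-- Riemannian gradient of `h` at `x ∈ M`, for the metric induced from `ℝⁿ`. -/
def rgrad {n : ℕ} (M : Set (Euc n)) (h : Euc n → ℝ) (x : Euc n) : Euc n :=
  tangentProj M x (gradient h x)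

/-- The tangent bundle as a subset of `ℝⁿ × ℝⁿ`. -/
def tangentBundle {n : ℕ} (M : Set (Euc n)) : Set (Euc n × Euc n) :=
  {z | z.1 ∈ M ∧ z.2 ∈ tangentSpace M z.1}

/-- The Whitney sum `TM ⊕ TM` as a subset of `ℝⁿ × ℝⁿ × ℝⁿ`. -/
def tangentBundleSum {n : ℕ} (M : Set (Euc n)) : Set (Euc n × Euc n × Euc n) :=
  {z | z.1 ∈ M ∧ z.2.1 ∈ tangentSpace M z.1 ∧ z.2.2 ∈ tangentSpace M z.1}

/-- `R x u = R_x(u)` is a retraction on `M` (only its values on `TM` matter). -/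
structure IsRetraction {n : ℕ} (M : Set (Euc n)) (R : Euc n → Euc n → Euc n) : Prop where
  smooth : ContDiffOn ℝ ∞ (fun z : Euc n × Euc n => R z.1 z.2) (tangentBundle M)
  mem : ∀ x ∈ M, ∀ u ∈ tangentSpace M x, R x u ∈ M
  zero : ∀ x ∈ M, R x 0 = x
  deriv_zero : ∀ x ∈ M,
    HasFDerivWithinAt (R x) (ContinuousLinearMap.id ℝ (Euc n)) (tangentSpace M x : Set (Euc n)) 0

/-- `T x w u = T_w(u)`, for `w, u ∈ T_x M`, is an isometric vector transport along the retraction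
`R`: it maps `T_x M` to the tangent space at `R_x(w)`. -/
structure IsIsometricTransport {n : ℕ} (M : Set (Euc n)) (R : Euc n → Euc n → Euc n)
    (T : Euc n → Euc n → Euc n → Euc n) : Prop where
  smooth : ContDiffOn ℝ ∞ (fun z : Euc n × Euc n × Euc n => T z.1 z.2.1 z.2.2) (tangentBundleSum M)
  mem : ∀ x ∈ M, ∀ w ∈ tangentSpace M x, ∀ u ∈ tangentSpace M x, T x w u ∈ tangentSpace M (R x w)
  zero : ∀ x ∈ M, ∀ u ∈ tangentSpace M x, T x 0 u = u
  linear : ∀ x ∈ M, ∀ w ∈ tangentSpace M x, ∀ u₁ ∈ tangentSpace M x, ∀ u₂ ∈ tangentSpace M x,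
    ∀ a b : ℝ, T x w (a • u₁ + b • u₂) = a • T x w u₁ + b • T x w u₂
  isometric : ∀ x ∈ M, ∀ w ∈ tangentSpace M x, ∀ u₁ ∈ tangentSpace M x, ∀ u₂ ∈ tangentSpace M x,
    inner ℝ (T x w u₁) (T x w u₂) = inner ℝ u₁ u₂

/-- Transport back from `y = R_x(w)` to `x` along the curve `t ↦ R_x(t w)`: the inverse of the
isometry `T_w : T_x M → T_y M`. -/
def transportBack {n : ℕ} (M : Set (Euc n)) (T : Euc n → Euc n → Euc n → Euc n)
    (x w : Euc n) : Euc n → Euc n :=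
  Function.invFunOn (T x w) (tangentSpace M x : Set (Euc n))

/-- `p`, `q` are constants in the Lipschitz-type inequalities for the retraction. -/
def RetractionBounds {n : ℕ} (M : Set (Euc n)) (R : Euc n → Euc n → Euc n) (p q : ℝ) : Prop :=
  0 < p ∧ 0 < q ∧ ∀ x ∈ M, ∀ u ∈ tangentSpace M x,
    ‖R x u - x‖ ≤ p * ‖u‖ ∧ ‖R x u - x - u‖ ≤ q * ‖u‖ ^ 2

end Geometry

/-! ### The problem and the assumptions -/

/-- `F(x) = E_ξ f(x, ξ)`. -/
def objective {n : ℕ} {Ξ : Type*} [MeasurableSpace Ξ] (P : Measure Ξ) (f : Euc n → Ξ → ℝ)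
    (x : Euc n) : ℝ :=
  ∫ ξ, f x ξ ∂P

/-- `f(·, ξ)` is continuously differentiable and the expectation defining `F` makes sense. -/
structure IsLoss {n : ℕ} {Ξ : Type*} [MeasurableSpace Ξ] (P : Measure Ξ)
    (f : Euc n → Ξ → ℝ) : Prop where
  contDiff : ∀ ξ, ContDiff ℝ 1 (fun x => f x ξ)
  measurable : ∀ x, Measurable (f x)
  integrable : ∀ x, Integrable (f x) P

/-- Compact submanifold, `∇F` Lipschitz with constant `LF`, `g` convex and `Lg`-Lipschitz,
`F` and `g` bounded below. -/
structure Assumption1 {n m : ℕ} (d : ℕ) (M : Set (Euc n)) (F : Euc n → ℝ) (g : Euc m → ℝ)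
    (LF Lg : ℝ) : Prop where
  submanifold : IsSubmanifold d M
  compact : IsCompact M
  differentiable : Differentiable ℝ F
  LF_nonneg : 0 ≤ LF
  gradient_lipschitz : ∀ x ∈ convexHull ℝ M, ∀ z ∈ convexHull ℝ M,
    ‖gradient F x - gradient F z‖ ≤ LF * ‖x - z‖
  convex : ConvexOn ℝ Set.univ g
  Lg_nonneg : 0 ≤ Lg
  g_lipschitz : ∀ y z, |g y - g z| ≤ Lg * ‖y - z‖
  F_bddBelow : BddBelow (F '' M)
  g_bddBelow : BddBelow (Set.range g)

/-- The stochastic Riemannian gradient is unbiased with variance at most `σ²`. -/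
structure Assumption2 {n : ℕ} {Ξ : Type*} [MeasurableSpace Ξ] (P : Measure Ξ)
    (f : Euc n → Ξ → ℝ) (M : Set (Euc n)) (σ : ℝ) : Prop where
  integrable : ∀ x ∈ M, Integrable (fun ξ => rgrad M (fun z => f z ξ) x) P
  unbiased : ∀ x ∈ M, ∫ ξ, rgrad M (fun z => f z ξ) x ∂P = rgrad M (objective P f) x
  sq_integrable : ∀ x ∈ M,
    Integrable (fun ξ => ‖rgrad M (fun z => f z ξ) x - rgrad M (objective P f) x‖ ^ 2) P
  variance : ∀ x ∈ M,
    ∫ ξ, ‖rgrad M (fun z => f z ξ) x - rgrad M (objective P f) x‖ ^ 2 ∂P ≤ σ ^ 2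

/-- `f` is mean-squared retraction Lipschitz with constant `Lt`. -/
structure Assumption3 {n : ℕ} {Ξ : Type*} [MeasurableSpace Ξ] (P : Measure Ξ)
    (f : Euc n → Ξ → ℝ) (M : Set (Euc n)) (R : Euc n → Euc n → Euc n)
    (T : Euc n → Euc n → Euc n → Euc n) (Lt : ℝ) : Prop where
  sq_integrable : ∀ x ∈ M, ∀ w ∈ tangentSpace M x,
    Integrable (fun ξ => ‖rgrad M (fun z => f z ξ) x
      - transportBack M T x w (rgrad M (fun z => f z ξ) (R x w))‖ ^ 2) P
  lipschitz : ∀ x ∈ M, ∀ w ∈ tangentSpace M x,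
    ∫ ξ, ‖rgrad M (fun z => f z ξ) x
      - transportBack M T x w (rgrad M (fun z => f z ξ) (R x w))‖ ^ 2 ∂P ≤ Lt ^ 2 * ‖w‖ ^ 2

/-- The augmented Lagrangian `L_ρ(x, y, l)`. -/
def augLagrangian {n m : ℕ} (F : Euc n → ℝ) (g : Euc m → ℝ) (A : Euc n →L[ℝ] Euc m) (ρ : ℝ)
    (x : Euc n) (y l : Euc m) : ℝ :=
  F x + g y - inner ℝ l (A x - y) + ρ / 2 * ‖A x - y‖ ^ 2

/-! ### The algorithm -/

/-- Parameters of the algorithm. -/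
structure Params where
  (cρ cα cβ cη β₁ : ℝ)

/-- Penalty `ρ_k = c_ρ k^{1/3}`. -/
def Params.ρ (c : Params) (k : ℕ) : ℝ := c.cρ * (k : ℝ) ^ (1 / 3 : ℝ)

/-- Primal step size `η_k = c_η k^{-1/3}`. -/
def Params.η (c : Params) (k : ℕ) : ℝ := c.cη * (k : ℝ) ^ (-(1 / 3) : ℝ)

/-- Momentum parameter: `alphaSucc k = α_{k+1} = c_α k^{-2/3}`. -/
def Params.alphaSucc (c : Params) (k : ℕ) : ℝ := c.cα * (k : ℝ) ^ (-(2 / 3) : ℝ)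

/-- Dual step size `β_{k+1}` for the initial residual norm `r₁` and the new residual norm `r`;
the first term of the minimum is `+∞` if `r = 0`. -/
def Params.betaSucc (c : Params) (k : ℕ) (r₁ r : ℝ) : ℝ :=
  if r = 0 then c.cβ / ((k : ℝ) ^ (1 / 3 : ℝ) * Real.log (k + 2) ^ 2)
  else min (c.β₁ * r₁ / (r * ((k : ℝ) + 2) ^ 2 * Real.log (k + 3)))
    (c.cβ / ((k : ℝ) ^ (1 / 3 : ℝ) * Real.log (k + 2) ^ 2))

/-- `grad f_S(x)` for the mini-batch `S = (s_i)`. -/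
def batchGrad {n : ℕ} {Ξ : Type*} (M : Set (Euc n)) (f : Euc n → Ξ → ℝ) {b : ℕ} (s : Fin b → Ξ)
    (x : Euc n) : Euc n :=
  (b : ℝ)⁻¹ • ∑ i, rgrad M (fun z => f z (s i)) x

/-- The mini-batches `S_k = (ξ_{k,i})_{i < b k}` consist of independent samples with law `P`. -/
structure IsSampling {Ω Ξ : Type*} [MeasurableSpace Ω] [MeasurableSpace Ξ] (μ : Measure Ω)
    (P : Measure Ξ) (b : ℕ → ℕ) (ξ : (k : ℕ) → Fin (b k) → Ω → Ξ) : Prop where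
  nonempty : ∀ k, 1 ≤ k → 1 ≤ b k
  measurable : ∀ k i, Measurable (ξ k i)
  law : ∀ k i, μ.map (ξ k i) = P
  indep : iIndepFun (fun j : (k : ℕ) × Fin (b k) => ξ j.1 j.2) μ

/-- The direction `G_k`, at sample point `ω`. -/
def direction {n m : ℕ} {Ω : Type*} (M : Set (Euc n)) (A : Euc n →L[ℝ] Euc m) (c : Params)
    (x v : ℕ → Ω → Euc n) (y l : ℕ → Ω → Euc m) (k : ℕ) (ω : Ω) : Euc n :=
  v k ω + tangentProj M (x k ω) (c.ρ k • ContinuousLinearMap.adjoint A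
    (A (x k ω) - y (k + 1) ω - (1 / c.ρ k) • l k ω))

/-- The estimation error `ε_k = v_k - grad F(x_k)`. -/
def estError {n : ℕ} {Ω : Type*} (M : Set (Euc n)) (F : Euc n → ℝ)
    (x v : ℕ → Ω → Euc n) (k : ℕ) (ω : Ω) : Euc n :=
  v k ω - rgrad M F (x k ω)

/-- `(x_k, y_k, l_k, v_k)`, `k ≥ 1`, are generated by MARS-ADMM from the deterministic initial point
`(x₁, y₁, l₁)` and the mini-batches `ξ`. -/
structure IsMARSADMM {n m : ℕ} {Ω Ξ : Type*} [MeasurableSpace Ξ] (P : Measure Ξ)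
    (f : Euc n → Ξ → ℝ) (M : Set (Euc n)) (R : Euc n → Euc n → Euc n)
    (T : Euc n → Euc n → Euc n → Euc n) (g : Euc m → ℝ) (A : Euc n →L[ℝ] Euc m) (c : Params)
    (x₁ : Euc n) (y₁ l₁ : Euc m) {b : ℕ → ℕ} (ξ : (k : ℕ) → Fin (b k) → Ω → Ξ)
    (x v : ℕ → Ω → Euc n) (y l : ℕ → Ω → Euc m) : Prop where
  x_init : ∀ ω, x 1 ω = x₁
  y_init : ∀ ω, y 1 ω = y₁
  l_init : ∀ ω, l 1 ω = l₁
  v_init : ∀ ω, v 1 ω = batchGrad M f (fun i => ξ 1 i ω) x₁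
  y_step : ∀ k, 1 ≤ k → ∀ ω,
    IsMinOn (fun z => augLagrangian (objective P f) g A (c.ρ k) (x k ω) z (l k ω))
      Set.univ (y (k + 1) ω)
  x_step : ∀ k, 1 ≤ k → ∀ ω,
    x (k + 1) ω = R (x k ω) (-(c.η k • direction M A c x v y l k ω))
  l_step : ∀ k, 1 ≤ k → ∀ ω,
    l (k + 1) ω = l k ω
      - c.betaSucc k ‖A x₁ - y₁‖ ‖A (x (k + 1) ω) - y (k + 1) ω‖
          • (A (x (k + 1) ω) - y (k + 1) ω)
  v_step : ∀ k, 1 ≤ k → ∀ ω,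
    v (k + 1) ω = batchGrad M f (fun i => ξ (k + 1) i ω) (x (k + 1) ω)
      + (1 - c.alphaSucc k) • T (x k ω) (-(c.η k • direction M A c x v y l k ω))
          (v k ω - batchGrad M f (fun i => ξ (k + 1) i ω) (x k ω))

/-! ### The constants of the bound -/

/-- `λ_max = ‖λ₁‖ + (π²/6) β₁ ‖A x₁ - y₁‖`. -/
def lambdaMax {n m : ℕ} (A : Euc n →L[ℝ] Euc m) (β₁ : ℝ) (x₁ : Euc n) (y₁ l₁ : Euc m) : ℝ :=
  ‖l₁‖ + Real.pi ^ 2 / 6 * β₁ * ‖A x₁ - y₁‖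

/-- `Θ`, with `a = ‖A‖`, `D` the diameter of `M`, `B` a bound of `‖∇F‖` on `M`, `lm = λ_max`. -/
def Theta (a D B Lg lm : ℝ) : ℝ :=
  B + a ^ 2 * D + a * (Lg + lm + 2 * a * D) + a * lm

/-- The smoothness constant `M = (L_{∇F} + ‖A‖²) p² + 2 q Θ`. -/
def smoothConst (a D B LF Lg lm p q : ℝ) : ℝ :=
  (LF + a ^ 2) * p ^ 2 + 2 * q * Theta a D B Lg lm

/-- The merit function `ψ_k = E[L_{ρ_k}(x_k, y_k, l_k) + γ_k ‖ε_k‖²]`, `γ_k = c_γ (k-1)^{1/3}`. -/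
def merit {n m : ℕ} {Ω : Type*} [MeasurableSpace Ω] (μ : Measure Ω) (M : Set (Euc n))
    (F : Euc n → ℝ) (g : Euc m → ℝ) (A : Euc n →L[ℝ] Euc m) (c : Params) (cγ : ℝ)
    (x v : ℕ → Ω → Euc n) (y l : ℕ → Ω → Euc m) (k : ℕ) : ℝ :=
  ∫ ω, (augLagrangian F g A (c.ρ k) (x k ω) (y k ω) (l k ω)
    + cγ * ((k : ℝ) - 1) ^ (1 / 3 : ℝ) * ‖estError M F x v k ω‖ ^ 2) ∂μ

/-- `ψ* = F* + g* - λ_max (L_g + λ_max + ‖A‖ D)`, with `F* = inf_M F` and `g* = inf g`. -/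
def meritLower {n m : ℕ} (M : Set (Euc n)) (F : Euc n → ℝ) (g : Euc m → ℝ)
    (A : Euc n →L[ℝ] Euc m) (Lg lm : ℝ) : ℝ :=
  sInf (F '' M) + sInf (Set.range g) - lm * (Lg + lm + ‖A‖ * Metric.diam M)

end MARS

end

/-! The bound adds a pathwise descent inequality for the augmented Lagrangian to a weighted
mean-square recursion for ε_k, with constants tuned so that the leftover terms cancel.

Descent. Optimality of the y-step makes ρ_k(Ax_k - y_{k+1}) - λ_k a subgradient of g, hence of norm
at most L_g (`norm_multiplier_le`). The first term in the minimum defining β_{k+1} makes the dual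
increments summable, so ‖λ_k‖ ≤ λ_max, and ‖Ax_k - y_{k+1}‖ ≤ (L_g + λ_max)/ρ_k. Up to the error
ε_k, the direction G_k is the Riemannian gradient of the Lagrangian in x (`direction_eq`), so the
Euclidean descent lemma and the retraction constants p, q control the x-step. In
`lagrangian_step_le` the Lagrangian falls by (3/8 - k^{-2/3}/8) η_k ‖G_k‖², up to 2η_k ‖ε_k‖² and
the cost of the dual and penalty updates, which sums like k^{-4/3} and 1/(k ln²(k+2)).

Error. Because the transport is a linear isometry, ε_{k+1} is (1 - α_{k+1}) times the transported
ε_k plus an average of centred noises of fresh samples (`estError_succ`). Independence removes the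
cross term, and `noise_moments` bounds the noise by 2α²σ² plus a multiple of η_k² ‖G_k‖². After
weighting by γ_{k+1} = c_γ k^{1/3} the variance term is of order 1/k, whence ln K, and the G_k-term
is at most (1/4 - k^{-2/3}/8) η_k E‖G_k‖². The decrease of γ_{k+1}(1 - α_{k+1})² - γ_k pays for 2η_k
E‖ε_k‖² and still leaves (c_α c_γ/2) k^{-1/3} E‖ε_k‖².

In the sum the k^{-2/3}/8 terms cancel and exactly η_k/8 of E‖G_k‖² survives. Since γ_1 = 0, ψ_1
does not contain ε_1, and E‖ε_1‖² ≤ σ² enters separately. Existence of p, q is a Taylor estimate on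
the tangent bundle plus compactness. Adaptedness rests on continuity of the tangent projection and
nonexpansiveness of the y-step. -/

namespace MARS

open scoped ContDiff Topology InnerProductSpace

/-! ### Second order Taylor estimates within a set. -/

section Taylor

variable {E F : Type*} [NormedAddCommGroup E] [NormedSpace ℝ E] [NormedAddCommGroup F]
  [NormedSpace ℝ F]

/-- A map whose derivative within `U` is Lipschitz along a segment in `U` satisfies the
second order Taylor estimate along that segment. -/
theorem norm_sub_sub_le_of_segment {f : E → F} {f' : E → E →L[ℝ] F} {U : Set E} {w h : E} {C : ℝ}
    (hf : ∀ z ∈ U, HasFDerivWithinAt f (f' z) U z)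
    (hseg : ∀ t ∈ Set.Icc (0 : ℝ) 1, w + t • h ∈ U)
    (hC : ∀ t ∈ Set.Icc (0 : ℝ) 1, ‖f' (w + t • h) - f' w‖ ≤ C * ‖h‖) :
    ‖f (w + h) - f w - f' w h‖ ≤ C * ‖h‖ ^ 2 := by
  have hline : ∀ t : ℝ, HasDerivWithinAt (fun t : ℝ => w + t • h) h (Set.Icc 0 1) t := fun t => by
    simpa using (((hasDerivAt_id t).smul_const h).const_add w).hasDerivWithinAt
  -- With the linear part removed, the mean value inequality only sees f'(w + th) - f'(w).
  have hd : ∀ t ∈ Set.Icc (0 : ℝ) 1, HasDerivWithinAt (fun t : ℝ => f (w + t • h) - t • f' w h)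
      (f' (w + t • h) h - f' w h) (Set.Icc 0 1) t := by
    intro t ht
    have h1 := (hf _ (hseg t ht)).comp_hasDerivWithinAt t (hline t) hseg
    have h2 : HasDerivWithinAt (fun t : ℝ => t • f' w h) (f' w h) (Set.Icc 0 1) t := by
      simpa using ((hasDerivAt_id t).smul_const (f' w h)).hasDerivWithinAt
    exact h1.sub h2
  have := norm_image_sub_le_of_norm_deriv_le_segment_01' (C := C * ‖h‖ ^ 2) hd (fun t ht => by
    rw [← sub_apply]
    refine (ContinuousLinearMap.le_opNorm _ _).trans ?_
    have := hC t ⟨ht.1, ht.2.le⟩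
    nlinarith [norm_nonneg h])
  simpa [sub_right_comm] using this

/-- Second order Taylor estimate, uniform near `z`, for a map that is `C²` within `s` at `z`. -/
theorem exists_taylor_bound {f : E → F} {s : Set E} {z : E} (hf : ContDiffWithinAt ℝ 2 f s z)
    (hz : z ∈ s) :
    ∃ (r C : ℝ) (f' : E → E →L[ℝ] F), 0 < r ∧ 0 ≤ C ∧
      (∀ w ∈ s ∩ Metric.ball z r, HasFDerivWithinAt f (f' w) (s ∩ Metric.ball z r) w) ∧
      ∀ w h : E, (∀ t ∈ Set.Icc (0 : ℝ) 1, w + t • h ∈ s ∩ Metric.ball z r) →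
        ‖f (w + h) - f w - f' w h‖ ≤ C * ‖h‖ ^ 2 := by
  have hf2 : ContDiffWithinAt ℝ (1 + 1) f s z := by simpa [one_add_one_eq_two] using hf
  obtain ⟨u, hu, -, f', hf', hf1⟩ :=
    (contDiffWithinAt_succ_iff_hasFDerivWithinAt (by simp)).1 hf2
  have hf1' : ContDiffWithinAt ℝ (0 + 1) f' u z := by simpa using hf1
  obtain ⟨u', hu', -, f'', hf'', hf0⟩ :=
    (contDiffWithinAt_succ_iff_hasFDerivWithinAt (by simp)).1 hf1'
  have hzs : insert z s = s := Set.insert_eq_of_mem hz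
  rw [hzs] at hu
  have hzu : z ∈ u := mem_of_mem_nhdsWithin hz hu
  rw [Set.insert_eq_of_mem hzu] at hu'
  have hzu' : z ∈ u' := mem_of_mem_nhdsWithin hzu hu'
  have hbd : ∀ᶠ w in 𝓝[u'] z, ‖f'' w‖ < ‖f'' z‖ + 1 :=
    (hf0.continuousWithinAt.norm).eventually (gt_mem_nhds (lt_add_one _))
  have hs : 𝓝[s] z ≤ 𝓝[u] z := nhdsWithin_le_iff.2 hu
  have hs' : 𝓝[s] z ≤ 𝓝[u'] z := hs.trans (nhdsWithin_le_iff.2 hu')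
  have hall : ∀ᶠ w in 𝓝[s] z, w ∈ u ∧ w ∈ u' ∧ ‖f'' w‖ < ‖f'' z‖ + 1 :=
    Filter.Eventually.and hu
      (Filter.Eventually.and (hs hu') (hbd.filter_mono hs'))
  obtain ⟨r, hr, hball⟩ := Metric.mem_nhdsWithin_iff.1 hall
  have hsub : ∀ w ∈ s ∩ Metric.ball z r, w ∈ u ∧ w ∈ u' ∧ ‖f'' w‖ < ‖f'' z‖ + 1 :=
    fun w hw => hball ⟨hw.2, hw.1⟩
  have hd1 : ∀ w ∈ s ∩ Metric.ball z r, HasFDerivWithinAt f (f' w) (s ∩ Metric.ball z r) w :=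
    fun w hw => (hf' w (hsub w hw).1).mono fun y hy => (hsub y hy).1
  have hd2 : ∀ w ∈ s ∩ Metric.ball z r, HasFDerivWithinAt f' (f'' w) (s ∩ Metric.ball z r) w :=
    fun w hw => (hf'' w (hsub w hw).2.1).mono fun y hy => (hsub y hy).2.1
  refine ⟨r, ‖f'' z‖ + 1, f', hr, by positivity, hd1, fun w h hseg => ?_⟩
  refine norm_sub_sub_le_of_segment hd1 hseg fun t ht => ?_
  have hline : ∀ t : ℝ, HasDerivWithinAt (fun t : ℝ => w + t • h) h (Set.Icc 0 1) t := fun t => by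
    simpa using (((hasDerivAt_id t).smul_const h).const_add w).hasDerivWithinAt
  have hder : ∀ τ ∈ Set.Icc (0 : ℝ) 1, HasDerivWithinAt (fun t : ℝ => f' (w + t • h))
      (f'' (w + τ • h) h) (Set.Icc 0 1) τ := fun τ hτ =>
    (hd2 _ (hseg τ hτ)).comp_hasDerivWithinAt τ (hline τ) hseg
  have := norm_image_sub_le_of_norm_deriv_le_segment' (C := (‖f'' z‖ + 1) * ‖h‖) hder
    (fun τ hτ => by
      refine (ContinuousLinearMap.le_opNorm _ _).trans ?_
      have := (hsub _ (hseg τ ⟨hτ.1, hτ.2.le⟩)).2.2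
      gcongr) t ht
  simp only [zero_smul, add_zero, sub_zero] at this
  refine this.trans (mul_le_of_le_one_right (by positivity) ht.2)

end Taylor

/-! ### Existence of the retraction constants p and q. -/

section RetractionBounds

variable {n : ℕ} {M : Set (Euc n)} {R : Euc n → Euc n → Euc n}

/-- Taylor's estimate on the tangent bundle, applied along the fibre segment from (x, 0) to (x, u).
This segment stays in the bundle, and the constant is uniform for x near x₀. -/
theorem IsRetraction.exists_local_bound (hR : IsRetraction M R) {x₀ : Euc n} (hx₀ : x₀ ∈ M) :
    ∃ r C : ℝ, 0 < r ∧ 0 ≤ C ∧ ∀ x ∈ M, dist x x₀ < r → ∀ u ∈ tangentSpace M x, ‖u‖ < r →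
      ‖R x u - x - u‖ ≤ C * ‖u‖ ^ 2 := by
  have hz : (x₀, (0 : Euc n)) ∈ tangentBundle M := ⟨hx₀, Submodule.zero_mem _⟩
  obtain ⟨r, C, f', hr, hC, hd, hT⟩ :=
    exists_taylor_bound (contDiffWithinAt_infty.1 (hR.smooth _ hz) 2) hz
  refine ⟨r, C, hr, hC, fun x hx hxr u hu hur => ?_⟩
  have hmem : ∀ t ∈ Set.Icc (0 : ℝ) 1, ((x, 0) : Euc n × Euc n) + t • ((0 : Euc n), u) ∈
      tangentBundle M ∩ Metric.ball (x₀, 0) r := by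
    intro t ht
    have htu : ‖t • u‖ < r := by
      rw [norm_smul, Real.norm_of_nonneg ht.1]
      exact (mul_le_of_le_one_left (norm_nonneg _) ht.2).trans_lt hur
    refine ⟨?_, ?_⟩
    · simpa [tangentBundle] using ⟨hx, Submodule.smul_mem _ t hu⟩
    · simpa [Prod.dist_eq] using ⟨hxr, htu⟩
  have key := hT _ _ hmem
  have hnorm : ‖((0 : Euc n), u)‖ = ‖u‖ := by simp [Prod.norm_def]
  -- A derivative within the bundle need not be unique, but its value on the vertical vector (0, u)
  -- is forced: t ↦ R x (t u) has one-sided derivative u at 0.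
  have hder : f' (x, 0) (0, u) = u := by
    have hw := hmem 0 (by simp)
    simp only [zero_smul, add_zero] at hw
    have hline : HasDerivWithinAt (fun t : ℝ => ((x, 0) : Euc n × Euc n) + t • ((0 : Euc n), u))
        (0, u) (Set.Icc 0 1) 0 := by
      simpa using (((hasDerivAt_id (0 : ℝ)).smul_const ((0 : Euc n), u)).const_add
        ((x, 0) : Euc n × Euc n)).hasDerivWithinAt
    have h1 : HasDerivWithinAt (fun t : ℝ => R x (t • u)) (f' (x, 0) (0, u)) (Set.Icc 0 1) 0 := by
      have hd0 : HasFDerivWithinAt (fun z : Euc n × Euc n => R z.1 z.2) (f' (x, 0))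
          (tangentBundle M ∩ Metric.ball (x₀, 0) r)
          (((x, 0) : Euc n × Euc n) + (0 : ℝ) • ((0 : Euc n), u)) := by
        simpa using hd _ hw
      simpa [Function.comp_def] using hd0.comp_hasDerivWithinAt (0 : ℝ) hline hmem
    have hline' : HasDerivWithinAt (fun t : ℝ => t • u) u (Set.Icc 0 1) 0 := by
      simpa using ((hasDerivAt_id (0 : ℝ)).smul_const u).hasDerivWithinAt
    have h2 : HasDerivWithinAt (fun t : ℝ => R x (t • u)) u (Set.Icc 0 1) 0 := by
      have hd0 : HasFDerivWithinAt (R x) (ContinuousLinearMap.id ℝ (Euc n))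
          (tangentSpace M x : Set (Euc n)) ((0 : ℝ) • u) := by
        simpa using hR.deriv_zero x hx
      simpa [Function.comp_def] using hd0.comp_hasDerivWithinAt (0 : ℝ) hline'
        (fun t _ => Submodule.smul_mem _ t hu)
    exact ((uniqueDiffOn_Icc zero_lt_one) 0 (by simp)).eq_deriv _ h1 h2
  rw [hder, hnorm] at key
  simpa [hR.zero x hx] using key

theorem IsRetraction.exists_bounds (hR : IsRetraction M R) (hM : IsCompact M) :
    ∃ p q : ℝ, RetractionBounds M R p q := by
  have hloc : ∃ r C : ℝ, 0 < r ∧ 0 ≤ C ∧ ∀ x ∈ M, x ∈ M → ∀ u ∈ tangentSpace M x, ‖u‖ < r →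
      ‖R x u - x - u‖ ≤ C * ‖u‖ ^ 2 := by
    -- Having some r and C that work on s passes to subsets and to finite unions and holds near each
    -- point, so it holds on the compact M.
    refine hM.induction_on (p := fun s => ∃ r C : ℝ, 0 < r ∧ 0 ≤ C ∧ ∀ x ∈ s, x ∈ M →
      ∀ u ∈ tangentSpace M x, ‖u‖ < r → ‖R x u - x - u‖ ≤ C * ‖u‖ ^ 2) ⟨1, 0, by simp⟩ ?_ ?_ ?_
    · rintro s t hst ⟨r, C, hr, hC, h⟩
      exact ⟨r, C, hr, hC, fun x hx => h x (hst hx)⟩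
    · rintro s t ⟨r, C, hr, hC, h⟩ ⟨r', C', hr', hC', h'⟩
      refine ⟨min r r', max C C', lt_min hr hr', le_max_of_le_left hC, fun x hx hxM u hu hur => ?_⟩
      rcases hx with hx | hx
      · refine (h x hx hxM u hu (hur.trans_le (min_le_left _ _))).trans ?_
        gcongr; exact le_max_left _ _
      · refine (h' x hx hxM u hu (hur.trans_le (min_le_right _ _))).trans ?_
        gcongr; exact le_max_right _ _
    · intro x hx
      obtain ⟨r, C, hr, hC, h⟩ := hR.exists_local_bound hx
      exact ⟨Metric.ball x r, mem_nhdsWithin_of_mem_nhds (Metric.ball_mem_nhds x hr), r, C, hr, hC,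
        fun y hy hyM => h y hyM hy⟩
  obtain ⟨r, C, hr, hC, h⟩ := hloc
  set D := Metric.diam M with hD
  have hD0 : 0 ≤ D := Metric.diam_nonneg
  have hdist : ∀ x ∈ M, ∀ u ∈ tangentSpace M x, ‖R x u - x‖ ≤ D := fun x hx u hu => by
    rw [← dist_eq_norm]
    exact Metric.dist_le_diam_of_mem hM.isBounded (hR.mem x hx u hu) hx
  have hq : ∀ x ∈ M, ∀ u ∈ tangentSpace M x,
      ‖R x u - x - u‖ ≤ (C + D / r ^ 2 + 1 / r) * ‖u‖ ^ 2 := by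
    intro x hx u hu
    rcases lt_or_ge ‖u‖ r with hur | hur
    · refine (h x hx hx u hu hur).trans ?_
      gcongr
      have : 0 ≤ D / r ^ 2 + 1 / r := by positivity
      linarith
    -- For long vectors the diameter suffices, because 1 ≤ ‖u‖/r turns both D and ‖u‖ into multiples
    -- of ‖u‖².
    · have h1 : ‖R x u - x - u‖ ≤ D + ‖u‖ :=
        (norm_sub_le _ _).trans (by gcongr; exact hdist x hx u hu)
      have h2 : D ≤ D / r ^ 2 * ‖u‖ ^ 2 := by
        rw [div_mul_eq_mul_div, le_div_iff₀ (by positivity)]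
        gcongr
      have h3 : ‖u‖ ≤ 1 / r * ‖u‖ ^ 2 := by
        rw [div_mul_eq_mul_div, le_div_iff₀ hr]
        nlinarith [norm_nonneg u]
      nlinarith [sq_nonneg ‖u‖, mul_nonneg hC (sq_nonneg ‖u‖)]
  set q := C + D / r ^ 2 + 1 / r with hqdef
  have hq0 : 0 < q := by positivity
  -- For ‖u‖ ≤ 1 the quadratic bound gives the factor 1 + q; for ‖u‖ ≥ 1 the diameter gives D.
  refine ⟨1 + q + D, q, by positivity, hq0, fun x hx u hu => ⟨?_, hq x hx u hu⟩⟩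
  rcases le_total ‖u‖ 1 with h1 | h1
  · have h2 : ‖R x u - x‖ ≤ ‖R x u - x - u‖ + ‖u‖ := by
      simpa using norm_add_le (R x u - x - u) u
    have h3 := hq x hx u hu
    nlinarith [norm_nonneg u, mul_nonneg hD0 (norm_nonneg u), mul_nonneg hq0.le (norm_nonneg u),
      mul_le_mul_of_nonneg_left h1 (mul_nonneg hq0.le (norm_nonneg u))]
  · have := hdist x hx u hu
    nlinarith [mul_le_mul_of_nonneg_left h1 hD0, mul_nonneg hq0.le (norm_nonneg u)]

end RetractionBounds

/-! ### Tangent spaces in charts, and continuity of the tangent projection. -/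

section TangentSpaces

variable {n d : ℕ} {M : Set (Euc n)}

theorem fderiv_symm_comp_fderiv {φ : OpenPartialHomeomorph (Euc n) (Euc n)}
    (hφ : ContDiffOn ℝ ∞ φ φ.source) (hψ : ContDiffOn ℝ ∞ φ.symm φ.target) {x : Euc n}
    (hx : x ∈ φ.source) :
    HasFDerivAt φ (fderiv ℝ φ x) x ∧ HasFDerivAt φ.symm (fderiv ℝ φ.symm (φ x)) (φ x) ∧
    (∀ u, fderiv ℝ φ.symm (φ x) (fderiv ℝ φ x u) = u) ∧
    (∀ u, fderiv ℝ φ x (fderiv ℝ φ.symm (φ x) u) = u) := by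
  have h1 : HasFDerivAt φ (fderiv ℝ φ x) x :=
    ((hφ.contDiffAt (φ.open_source.mem_nhds hx)).differentiableAt (by simp)).hasFDerivAt
  have h2 : HasFDerivAt φ.symm (fderiv ℝ φ.symm (φ x)) (φ x) :=
    ((hψ.contDiffAt (φ.open_target.mem_nhds (φ.map_source hx))).differentiableAt
      (by simp)).hasFDerivAt
  refine ⟨h1, h2, fun u => ?_, fun u => ?_⟩
  · have h3 : HasFDerivAt (fun z => φ.symm (φ z)) (ContinuousLinearMap.id ℝ (Euc n)) x :=
      (hasFDerivAt_id x).congr_of_eventuallyEq (φ.eventually_left_inverse hx)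
    exact congrArg (fun L : Euc n →L[ℝ] Euc n => L u) ((h2.comp x h1).unique h3)
  · have h3 : HasFDerivAt (fun z => φ (φ.symm z)) (ContinuousLinearMap.id ℝ (Euc n)) (φ x) :=
      (hasFDerivAt_id (φ x)).congr_of_eventuallyEq
        (φ.eventually_right_inverse (φ.map_source hx))
    have h1' : HasFDerivAt φ (fderiv ℝ φ x) (φ.symm (φ x)) := by rwa [φ.left_inv hx]
    exact congrArg (fun L : Euc n →L[ℝ] Euc n => L u) ((h1'.comp (φ x) h2).unique h3)

/-- In a straightening chart the tangent space is the preimage of the model subspace. -/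
theorem mem_tangentSpace_iff_of_chart {φ : OpenPartialHomeomorph (Euc n) (Euc n)}
    {V : Submodule ℝ (Euc n)}
    (hφ : ContDiffOn ℝ ∞ φ φ.source) (hψ : ContDiffOn ℝ ∞ φ.symm φ.target)
    (himg : φ '' (φ.source ∩ M) = φ.target ∩ (V : Set (Euc n))) {x : Euc n}
    (hx : x ∈ φ.source) (hxM : x ∈ M) (u : Euc n) :
    u ∈ tangentSpace M x ↔ fderiv ℝ φ x u ∈ V := by
  obtain ⟨h1, h2, hl, hr⟩ := fderiv_symm_comp_fderiv hφ hψ hx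
  have hV : ∀ z ∈ φ.source, z ∈ M → φ z ∈ V := fun z hz hzM =>
    (himg.subset ⟨z, ⟨hz, hzM⟩, rfl⟩).2
  constructor
  · suffices h : tangentSpace M x ≤ V.comap (fderiv ℝ φ x : Euc n →ₗ[ℝ] Euc n) from fun hu => h hu
    refine Submodule.span_le.2 ?_
    rintro u ⟨γ, δ, hδ, hγ0, hγM, -, hγ⟩
    have h1' : HasFDerivAt φ (fderiv ℝ φ x) (γ 0) := by rwa [hγ0]
    have hc := h1'.comp_hasDerivAt (0 : ℝ) hγ
    have hev : ∀ᶠ t in 𝓝 (0 : ℝ), φ (γ t) ∈ V := by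
      have hs : ∀ᶠ t in 𝓝 (0 : ℝ), γ t ∈ φ.source :=
        hγ.continuousAt.eventually (φ.open_source.mem_nhds (by rwa [hγ0]))
      filter_upwards [hs, Icc_mem_nhds (neg_lt_zero.2 hδ) hδ] with t ht ht'
      exact hV _ ht (hγM t ht')
    have hlim := hc.tendsto_slope
    -- The velocity read in the chart is a limit of difference quotients of points of V, and V is
    -- closed.
    refine V.closed_of_finiteDimensional.mem_of_tendsto hlim ?_
    filter_upwards [nhdsWithin_le_nhds hev] with t ht
    rw [slope_def_module]
    refine V.smul_mem _ (V.sub_mem ht ?_)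
    simpa [hγ0] using hV x hx hxM
  · intro hu
    refine Submodule.subset_span ?_
    have hcont : ContinuousAt (fun t : ℝ => φ x + t • fderiv ℝ φ x u) 0 := by fun_prop
    have hev : ∀ᶠ t in 𝓝 (0 : ℝ), φ x + t • fderiv ℝ φ x u ∈ φ.target :=
      hcont.eventually (φ.open_target.mem_nhds (by simpa using φ.map_source hx))
    obtain ⟨δ, hδ, hball⟩ := Metric.eventually_nhds_iff.1 hev
    have htar : ∀ t ∈ Set.Icc (-(δ / 2)) (δ / 2), φ x + t • fderiv ℝ φ x u ∈ φ.target :=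
      fun t ht => hball (by
        rw [Real.dist_eq, sub_zero]
        exact (abs_le.2 ht).trans_lt (by linarith))
    have hline : ∀ t : ℝ, HasDerivAt (fun t : ℝ => φ x + t • fderiv ℝ φ x u) (fderiv ℝ φ x u) t :=
      fun t => by simpa using ((hasDerivAt_id t).smul_const (fderiv ℝ φ x u)).const_add (φ x)
    -- The curve is the preimage of a straight line in V; halving δ keeps the closed interval inside
    -- the open ball.
    refine ⟨fun t => φ.symm (φ x + t • fderiv ℝ φ x u), δ / 2, by linarith, ?_, ?_, ?_, ?_⟩
    · simpa using φ.left_inv hx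
    · intro t ht
      have : φ x + t • fderiv ℝ φ x u ∈ φ '' (φ.source ∩ M) := by
        rw [himg]
        exact ⟨htar t ht, V.add_mem (hV x hx hxM) (V.smul_mem _ hu)⟩
      obtain ⟨z, ⟨hz, hzM⟩, hze⟩ := this
      simp only [← hze, φ.left_inv hz]
      exact hzM
    · intro t ht
      have := ((hψ.contDiffAt (φ.open_target.mem_nhds (htar t ht))).differentiableAt (by simp))
      exact (this.comp t (hline t).differentiableAt).differentiableWithinAt
    · have h2' : HasFDerivAt φ.symm (fderiv ℝ φ.symm (φ x)) (φ x + (0 : ℝ) • fderiv ℝ φ x u) := by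
        simpa using h2
      have := h2'.comp_hasDerivAt (0 : ℝ) (hline 0)
      rwa [hl] at this

/-- The tangent space as the range of the differential of the inverse chart. -/
theorem tangentSpace_eq_range_of_chart {φ : OpenPartialHomeomorph (Euc n) (Euc n)}
    {V : Submodule ℝ (Euc n)}
    (hφ : ContDiffOn ℝ ∞ φ φ.source) (hψ : ContDiffOn ℝ ∞ φ.symm φ.target)
    (himg : φ '' (φ.source ∩ M) = φ.target ∩ (V : Set (Euc n))) {x : Euc n}
    (hx : x ∈ φ.source) (hxM : x ∈ M) :
    Function.Injective ((fderiv ℝ φ.symm (φ x)).comp V.subtypeL) ∧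
    tangentSpace M x =
      LinearMap.range ((fderiv ℝ φ.symm (φ x)).comp V.subtypeL : V →ₗ[ℝ] Euc n) := by
  obtain ⟨-, -, hl, hr⟩ := fderiv_symm_comp_fderiv hφ hψ hx
  refine ⟨fun a b hab => ?_, ?_⟩
  · have := congrArg (fderiv ℝ φ x) hab
    simpa [hr] using this
  · ext u
    rw [mem_tangentSpace_iff_of_chart hφ hψ himg hx hxM]
    constructor
    · exact fun h => ⟨⟨_, h⟩, by simp [hl]⟩
    · rintro ⟨w, rfl⟩
      simp [hr]

/-- Equality of dimensions at different points is what makes an isometric transport surjective. -/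
theorem IsSubmanifold.finrank_tangentSpace (hM : IsSubmanifold d M) {x : Euc n} (hx : x ∈ M) :
    Module.finrank ℝ (tangentSpace M x) = d := by
  obtain ⟨φ, V, hxφ, hφ, hψ, hd, himg⟩ := hM x hx
  obtain ⟨hinj, hr⟩ := tangentSpace_eq_range_of_chart hφ hψ himg hxφ hx
  rw [hr, LinearMap.finrank_range_of_inj hinj, hd]

/-- Orthogonal projection onto the range of an injective map, by the normal equations. -/
theorem starProjection_range_eq {V E : Type*} [NormedAddCommGroup V] [InnerProductSpace ℝ V]
    [FiniteDimensional ℝ V] [NormedAddCommGroup E] [InnerProductSpace ℝ E]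
    [FiniteDimensional ℝ E] (B : V →L[ℝ] E) (hB : Function.Injective B) :
    IsUnit (B.adjoint.comp B) ∧
      (LinearMap.range (B : V →ₗ[ℝ] E)).starProjection =
        B.comp ((Ring.inverse (B.adjoint.comp B)).comp B.adjoint) := by
  have hinj : Function.Injective (B.adjoint.comp B) := by
    refine (injective_iff_map_eq_zero _).2 fun v hv => ?_
    have : ⟪B v, B v⟫_ℝ = 0 := by
      rw [← ContinuousLinearMap.adjoint_inner_right]
      simpa using congrArg (inner ℝ v) hv
    exact (injective_iff_map_eq_zero B).1 hB v (inner_self_eq_zero.1 this)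
  have hu : IsUnit (B.adjoint.comp B) := by
    let e := (LinearEquiv.ofInjectiveEndo (B.adjoint.comp B : V →ₗ[ℝ] V) hinj)
    exact ⟨ContinuousLinearEquiv.toUnit e.toContinuousLinearEquiv, by ext v; rfl⟩
  refine ⟨hu, ?_⟩
  ext u
  refine congrArg (fun z : E => z) (Submodule.eq_starProjection_of_mem_orthogonal ?_ ?_)
  · exact ⟨_, rfl⟩
  · rw [Submodule.mem_orthogonal]
    rintro _ ⟨w, rfl⟩
    have h1 : (B.adjoint.comp B) * Ring.inverse (B.adjoint.comp B) = 1 :=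
      Ring.mul_inverse_cancel _ hu
    have h2 := congrArg (fun L : V →L[ℝ] V => L (B.adjoint u)) h1
    simp only [mul_apply_eq_comp, ContinuousLinearMap.comp_apply,
      one_apply_eq_self] at h2
    change ⟪B w, _⟫_ℝ = 0
    rw [← ContinuousLinearMap.adjoint_inner_right, map_sub]
    simp [h2]

/-- Near x the tangent space is the range of an injective map B(z) depending continuously on z, and
the projection is B(B*B)⁻¹B*. Inversion is continuous at units, so the formula is continuous. -/
theorem IsSubmanifold.continuousOn_tangentProj (hM : IsSubmanifold d M) :
    ContinuousOn (tangentProj M) M := by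
  intro x hx
  obtain ⟨φ, V, hxφ, hφ, hψ, hd, himg⟩ := hM x hx
  let B : Euc n → V →L[ℝ] Euc n := fun z => (fderiv ℝ φ.symm (φ z)).comp V.subtypeL
  have hB : ContinuousAt B x := by
    have h1 : ContinuousAt (fderiv ℝ φ.symm) (φ x) :=
      ((hψ.contDiffAt (φ.open_target.mem_nhds (φ.map_source hxφ))).fderiv_right
        (m := 0) (by simp)).continuousAt
    have h2 : ContinuousAt φ x := φ.continuousAt hxφ
    exact (ContinuousAt.comp (f := φ) h1 h2).clm_comp continuousAt_const
  have hBa : ContinuousAt (fun z => (B z).adjoint) x :=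
    (LinearIsometryEquiv.continuous _).continuousAt.comp hB
  have hu := (starProjection_range_eq (B x)
    (tangentSpace_eq_range_of_chart hφ hψ himg hxφ hx).1).1
  have hinv : ContinuousAt (fun z => Ring.inverse ((B z).adjoint.comp (B z))) x := by
    have := NormedRing.inverse_continuousAt (R := V →L[ℝ] V) hu.unit
    rw [IsUnit.unit_spec] at this
    exact ContinuousAt.comp (f := fun z => (B z).adjoint.comp (B z)) this (hBa.clm_comp hB)
  have hQ := (hB.clm_comp (hinv.clm_comp hBa)).continuousWithinAt (s := M)
  have heq : ∀ z ∈ φ.source, z ∈ M → tangentProj M z =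
      (B z).comp ((Ring.inverse ((B z).adjoint.comp (B z))).comp (B z).adjoint) := by
    intro z hz hzM
    obtain ⟨hinj, hr⟩ := tangentSpace_eq_range_of_chart hφ hψ himg hz hzM
    rw [← (starProjection_range_eq (B z) hinj).2]
    unfold tangentProj
    congr 1
  refine hQ.congr_of_eventuallyEq ?_ (heq x hxφ hx)
  filter_upwards [self_mem_nhdsWithin,
    mem_nhdsWithin_of_mem_nhds (φ.open_source.mem_nhds hxφ)] with z hz hz'
  exact heq z hz' hz

theorem tangentProj_mem (x u : Euc n) : tangentProj M x u ∈ tangentSpace M x :=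
  Submodule.starProjection_apply_mem _ _

theorem tangentProj_eq_self {x u : Euc n} (hu : u ∈ tangentSpace M x) : tangentProj M x u = u :=
  Submodule.starProjection_eq_self_iff.2 hu

theorem norm_tangentProj_le (x u : Euc n) : ‖tangentProj M x u‖ ≤ ‖u‖ :=
  Submodule.norm_starProjection_apply_le _ _

theorem inner_tangentProj {x u w : Euc n} (hw : w ∈ tangentSpace M x) :
    ⟪tangentProj M x u, w⟫_ℝ = ⟪u, w⟫_ℝ := by
  unfold tangentProj
  rw [Submodule.inner_starProjection_left_eq_right, Submodule.starProjection_eq_self_iff.2 hw]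

theorem rgrad_mem (h : Euc n → ℝ) (x : Euc n) : rgrad M h x ∈ tangentSpace M x :=
  tangentProj_mem _ _

theorem batchGrad_mem {Ξ : Type*} {f : Euc n → Ξ → ℝ} {b : ℕ} (s : Fin b → Ξ) (x : Euc n) :
    batchGrad M f s x ∈ tangentSpace M x :=
  Submodule.smul_mem _ _ (Submodule.sum_mem _ fun _ _ => rgrad_mem _ _)

end TangentSpaces

/-! ### The transport as a linear isometry between tangent spaces. -/

section Transport

variable {n d : ℕ} {M : Set (Euc n)} {R : Euc n → Euc n → Euc n}
  {T : Euc n → Euc n → Euc n → Euc n}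

/-- `T_w`, extended to `ℝⁿ` by the orthogonal projection. -/
noncomputable def IsIsometricTransport.clm (hT : IsIsometricTransport M R T) {x w : Euc n}
    (hx : x ∈ M) (hw : w ∈ tangentSpace M x) : Euc n →L[ℝ] Euc n :=
  LinearMap.toContinuousLinearMap
    { toFun := fun u => T x w (tangentProj M x u)
      map_add' := fun u v => by
        simpa using hT.linear x hx w hw _ (tangentProj_mem x u) _ (tangentProj_mem x v) 1 1
      map_smul' := fun a u => by
        simpa using hT.linear x hx w hw _ (tangentProj_mem x u) _ (tangentProj_mem x u) a 0 }

theorem IsIsometricTransport.clm_apply (hT : IsIsometricTransport M R T) {x w u : Euc n}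
    (hx : x ∈ M) (hw : w ∈ tangentSpace M x) (hu : u ∈ tangentSpace M x) :
    hT.clm hx hw u = T x w u := by
  change T x w (tangentProj M x u) = T x w u
  rw [tangentProj_eq_self hu]

theorem IsIsometricTransport.norm_eq (hT : IsIsometricTransport M R T) {x w u : Euc n}
    (hx : x ∈ M) (hw : w ∈ tangentSpace M x) (hu : u ∈ tangentSpace M x) :
    ‖T x w u‖ = ‖u‖ := by
  have := hT.isometric x hx w hw u hu u hu
  rw [real_inner_self_eq_norm_sq, real_inner_self_eq_norm_sq] at this
  exact (sq_eq_sq₀ (norm_nonneg _) (norm_nonneg _)).1 this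

theorem IsIsometricTransport.map_sub (hT : IsIsometricTransport M R T) {x w u v : Euc n}
    (hx : x ∈ M) (hw : w ∈ tangentSpace M x) (hu : u ∈ tangentSpace M x)
    (hv : v ∈ tangentSpace M x) : T x w (u - v) = T x w u - T x w v := by
  rw [← hT.clm_apply hx hw hu, ← hT.clm_apply hx hw hv,
    ← hT.clm_apply hx hw (Submodule.sub_mem _ hu hv), _root_.map_sub]

/-- An isometry is injective, and source and target both have dimension d. -/
theorem IsIsometricTransport.surjOn (hT : IsIsometricTransport M R T) (hR : IsRetraction M R)
    (hM : IsSubmanifold d M) {x w : Euc n} (hx : x ∈ M) (hw : w ∈ tangentSpace M x) :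
    Set.SurjOn (T x w) (tangentSpace M x) (tangentSpace M (R x w)) := by
  let L : tangentSpace M x →ₗ[ℝ] tangentSpace M (R x w) :=
    ((hT.clm hx hw : Euc n →ₗ[ℝ] Euc n).comp (tangentSpace M x).subtype).codRestrict _
      fun u => by
        simpa [hT.clm_apply hx hw u.2] using hT.mem x hx w hw u u.2
  have hLv : ∀ u, (L u : Euc n) = T x w u := fun u => hT.clm_apply hx hw u.2
  have hinj : Function.Injective L := (injective_iff_map_eq_zero L).2 fun u hu => by
    have h1 : ‖T x w u‖ = 0 := by rw [← hLv, hu]; simp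
    rw [hT.norm_eq hx hw u.2] at h1
    exact Subtype.ext (norm_eq_zero.1 h1)
  have hsurj : Function.Surjective L :=
    (LinearMap.injective_iff_surjective_of_finrank_eq_finrank (by
      rw [hM.finrank_tangentSpace hx, hM.finrank_tangentSpace (hR.mem x hx w hw)])).1 hinj
  intro z hz
  obtain ⟨u, hu⟩ := hsurj ⟨z, hz⟩
  exact ⟨u, u.2, by rw [← hLv, hu]⟩

/-- Moves the comparison from T_x M to T_y M, so that the mean-square Lipschitz assumption, stated
with the inverse transport, applies to the forward transport used in the algorithm. -/
theorem norm_sub_transportBack (hT : IsIsometricTransport M R T) (hR : IsRetraction M R)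
    (hM : IsSubmanifold d M) {x w u z : Euc n} (hx : x ∈ M) (hw : w ∈ tangentSpace M x)
    (hu : u ∈ tangentSpace M x) (hz : z ∈ tangentSpace M (R x w)) :
    ‖u - transportBack M T x w z‖ = ‖z - T x w u‖ := by
  have h := hT.surjOn hR hM hx hw hz
  have h1 : transportBack M T x w z ∈ tangentSpace M x := Function.invFunOn_mem h
  have h2 : T x w (transportBack M T x w z) = z := Function.invFunOn_eq h
  rw [← hT.norm_eq hx hw (Submodule.sub_mem _ hu h1), hT.map_sub hx hw hu h1, h2, norm_sub_rev]

end Transport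

end MARS

namespace MARS

open scoped Topology InnerProductSpace

/-! ### Optimality, multiplier bound and stability of the y-step. -/

section DualVariable

variable {n m : ℕ} {F : Euc n → ℝ} {g : Euc m → ℝ} {A : Euc n →L[ℝ] Euc m} {ρ : ℝ} {x : Euc n}
  {y l : Euc m}

/-- Optimality condition of the `y`-step. -/
theorem inner_le_sub_of_isMinOn (hg : ConvexOn ℝ Set.univ g) (hρ : 0 ≤ ρ)
    (h : IsMinOn (fun z => augLagrangian F g A ρ x z l) Set.univ y) (z : Euc m) :
    ⟪ρ • (A x - y) - l, z - y⟫_ℝ ≤ g z - g y := by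
  have key : ∀ t : ℝ, 0 < t → t ≤ 1 →
      ⟪ρ • (A x - y) - l, z - y⟫_ℝ ≤ g z - g y + t * (ρ / 2 * ‖z - y‖ ^ 2) := by
    intro t ht0 ht1
    have h1 := h (Set.mem_univ (y + t • (z - y)))
    change augLagrangian F g A ρ x y l ≤ augLagrangian F g A ρ x (y + t • (z - y)) l at h1
    simp only [augLagrangian] at h1
    have h2 : g (y + t • (z - y)) ≤ (1 - t) * g y + t * g z := by
      have := hg.2 (Set.mem_univ y) (Set.mem_univ z) (sub_nonneg.2 ht1) ht0.le (by ring)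
      have he : (1 - t) • y + t • z = y + t • (z - y) := by module
      rw [he] at this
      simpa using this
    have e1 : A x - (y + t • (z - y)) = (A x - y) - t • (z - y) := by abel
    rw [e1, norm_sub_sq_real (A x - y), inner_sub_right l (A x - y), inner_smul_right,
      inner_smul_right, norm_smul,
      Real.norm_of_nonneg ht0.le] at h1
    rw [inner_sub_left, real_inner_smul_left]
    have h3 : 0 ≤ t * (g z - g y + t * (ρ / 2 * ‖z - y‖ ^ 2) + ⟪l, z - y⟫_ℝ
        - ρ * ⟪A x - y, z - y⟫_ℝ) := by nlinarith
    have := nonneg_of_mul_nonneg_right h3 ht0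
    linarith
  by_contra hcon
  push Not at hcon
  set δ := ⟪ρ • (A x - y) - l, z - y⟫_ℝ - (g z - g y) with hδ
  have hδ0 : 0 < δ := by linarith
  set c := ρ / 2 * ‖z - y‖ ^ 2 with hc
  have hc0 : 0 ≤ c := by positivity
  -- This t makes the quadratic remainder t c smaller than the supposed violation δ.
  have hk := key (min 1 (δ / (c + 1))) (by positivity) (min_le_left _ _)
  have h4 : min 1 (δ / (c + 1)) * c ≤ δ / (c + 1) * c := by gcongr; exact min_le_right _ _
  have h5 : δ / (c + 1) * c < δ := by
    rw [div_mul_eq_mul_div, div_lt_iff₀ (by positivity)]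
    nlinarith
  linarith

/-- The vector is a subgradient of g at y, and subgradients of an `Lg`-Lipschitz function have norm
at most `Lg`: test the subgradient inequality at y + s. -/
theorem norm_multiplier_le (hg : ConvexOn ℝ Set.univ g) {Lg : ℝ}
    (hLg : ∀ y z, |g y - g z| ≤ Lg * ‖y - z‖) (hρ : 0 ≤ ρ) (hLg0 : 0 ≤ Lg)
    (h : IsMinOn (fun z => augLagrangian F g A ρ x z l) Set.univ y) :
    ‖ρ • (A x - y) - l‖ ≤ Lg := by
  set s := ρ • (A x - y) - l with hs
  have h1 := inner_le_sub_of_isMinOn hg hρ h (y + s)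
  rw [add_sub_cancel_left, ← hs, real_inner_self_eq_norm_sq] at h1
  have h2 := (le_abs_self _).trans (hLg (y + s) y)
  rw [add_sub_cancel_left] at h2
  rcases (norm_nonneg s).eq_or_lt with h0 | h0
  · rw [← h0]; exact hLg0
  · nlinarith

/-- The `y`-step is nonexpansive. -/
theorem dist_argmin_le (hg : ConvexOn ℝ Set.univ g) (hρ : 0 < ρ) {x' : Euc n} {y' l' : Euc m}
    (h : IsMinOn (fun z => augLagrangian F g A ρ x z l) Set.univ y)
    (h' : IsMinOn (fun z => augLagrangian F g A ρ x' z l') Set.univ y') :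
    dist y y' ≤ dist (A x - (1 / ρ) • l) (A x' - (1 / ρ) • l') := by
  have h1 := inner_le_sub_of_isMinOn hg hρ.le h y'
  have h2 := inner_le_sub_of_isMinOn hg hρ.le h' y
  set w := A x - (1 / ρ) • l with hw
  set w' := A x' - (1 / ρ) • l' with hw'
  -- The minimiser depends on (x, l) only through w = Ax - l/ρ: it is a proximal point of w.
  have e1 : ρ • (A x - y) - l = ρ • (w - y) := by
    rw [hw, sub_right_comm, smul_sub ρ (A x - y), smul_smul, mul_one_div_cancel hρ.ne', one_smul]
  have e2 : ρ • (A x' - y') - l' = ρ • (w' - y') := by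
    rw [hw', sub_right_comm, smul_sub ρ (A x' - y'), smul_smul, mul_one_div_cancel hρ.ne',
      one_smul]
  rw [e1, real_inner_smul_left] at h1
  rw [e2, real_inner_smul_left] at h2
  -- Adding the two variational inequalities cancels g and gives firm nonexpansiveness.
  have h3 : ‖y - y'‖ ^ 2 ≤ ⟪w - w', y - y'⟫_ℝ := by
    have : ⟪w - y, y' - y⟫_ℝ + ⟪w' - y', y - y'⟫_ℝ = ‖y - y'‖ ^ 2 - ⟪w - w', y - y'⟫_ℝ := by
      rw [← real_inner_self_eq_norm_sq, ← neg_sub y y', inner_neg_right]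
      simp only [inner_sub_left]
      ring
    nlinarith
  have h4 := real_inner_le_norm (w - w') (y - y')
  rw [dist_eq_norm, dist_eq_norm]
  rcases (norm_nonneg (y - y')).eq_or_lt with h0 | h0
  · rw [← h0]; positivity
  · nlinarith

end DualVariable

/-! ### Measurability of the building blocks. -/

section Measurability

variable {Ω : Type*} [mΩ : MeasurableSpace Ω]

/-- Retraction and transport are continuous only on bundles. Factoring through the subtype avoids
having to show that these sets are measurable. -/
theorem measurable_comp_of_continuousOn {X Y : Type*} [TopologicalSpace X] [MeasurableSpace X]
    [BorelSpace X] [TopologicalSpace Y] [MeasurableSpace Y] [BorelSpace Y] {s : Set X} {h : X → Y}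
    (hh : ContinuousOn h s) {X' : Ω → X} (hX : Measurable X') (hs : ∀ ω, X' ω ∈ s) :
    Measurable fun ω => h (X' ω) :=
  (continuousOn_iff_continuous_domRestrict.1 hh).measurable.comp (hX.subtype_mk (h := hs))

/-- For the argmin, known only through pointwise optimality: the hypothesis makes y a 1-Lipschitz
function of w on the range of w. -/
theorem measurable_of_dist_le {X Y : Type*} [PseudoMetricSpace X] [MeasurableSpace X]
    [BorelSpace X] [MetricSpace Y] [MeasurableSpace Y] [BorelSpace Y]
    {w : Ω → X} {y : Ω → Y} (hw : Measurable w)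
    (h : ∀ ω ω', dist (y ω) (y ω') ≤ dist (w ω) (w ω')) : Measurable y := by
  let φ : Set.range w → Y := fun z => y z.2.choose
  have hφ : Continuous φ := by
    refine (LipschitzWith.of_dist_le_mul (K := 1) fun a b => ?_).continuous
    have := h a.2.choose b.2.choose
    rw [a.2.choose_spec, b.2.choose_spec] at this
    rw [NNReal.coe_one, one_mul]
    exact this
  have hc : Measurable fun ω => φ ⟨w ω, ω, rfl⟩ :=
    hφ.measurable.comp (hw.subtype_mk (h := fun ω => ⟨ω, rfl⟩))
  convert hc using 2 with ω
  have hr : w ω ∈ Set.range w := ⟨ω, rfl⟩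
  have := h ω hr.choose
  rw [hr.choose_spec, dist_self] at this
  exact dist_le_zero.1 this

variable {n m d : ℕ} {M : Set (Euc n)} {R : Euc n → Euc n → Euc n}
  {T : Euc n → Euc n → Euc n → Euc n} {Ξ : Type*} [MeasurableSpace Ξ] {P : Measure Ξ}
  {f : Euc n → Ξ → ℝ}

/-- A function continuous in x and measurable in ξ (Carathéodory) is jointly measurable. For fixed x
the partial derivatives are limits of difference quotients with step 1/k. -/
theorem IsLoss.measurable_gradient (hf : IsLoss P f) :
    Measurable fun p : Euc n × Ξ => gradient (fun z => f z p.2) p.1 := by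
  refine measurable_uncurry_of_continuous_of_measurable
    (u := fun (x : Euc n) (ξ : Ξ) => gradient (fun z => f z ξ) x) (fun ξ => ?_) (fun x => ?_)
  · exact (LinearIsometryEquiv.continuous _).comp ((hf.contDiff ξ).continuous_fderiv (by simp))
  · let e := EuclideanSpace.basisFun (Fin n) ℝ
    have hexp : (fun ξ => gradient (fun z => f z ξ) x) =
        fun ξ => ∑ i, fderiv ℝ (fun z => f z ξ) x (e i) • e i := by
      funext ξ
      rw [← e.sum_repr' (gradient (fun z => f z ξ) x)]
      refine Finset.sum_congr rfl fun i _ => ?_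
      rw [real_inner_comm, inner_gradient_left]
    rw [hexp]
    refine Finset.measurable_sum _ fun i _ => Measurable.smul_const ?_ _
    refine measurable_of_tendsto_metrizable (f := fun (k : ℕ) ξ =>
      (k : ℝ) • (f (x + (k : ℝ)⁻¹ • e i) ξ - f x ξ)) (fun k => ?_) ?_
    · exact ((hf.measurable _).sub (hf.measurable _)).const_smul (k : ℝ)
    · refine tendsto_pi_nhds.2 fun ξ => ?_
      have := ((hf.contDiff ξ).differentiable (by simp) x).hasFDerivAt.lim_real (e i)
      exact this.comp tendsto_natCast_atTop_atTop

theorem IsSubmanifold.continuousOn_tangentProj_apply (hM : IsSubmanifold d M) :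
    ContinuousOn (fun z : Euc n × Euc n => tangentProj M z.1 z.2) (M ×ˢ Set.univ) := by
  have h : ContinuousOn (fun z : Euc n × Euc n => tangentProj M z.1) (M ×ˢ Set.univ) :=
    hM.continuousOn_tangentProj.comp continuousOn_fst fun z hz => hz.1
  exact h.clm_apply continuousOn_snd

theorem measurable_tangentProj_apply (hM : IsSubmanifold d M) {X U : Ω → Euc n}
    (hX : Measurable X) (hXM : ∀ ω, X ω ∈ M) (hU : Measurable U) :
    Measurable fun ω => tangentProj M (X ω) (U ω) := by
  have h : ∀ ω, (X ω, U ω) ∈ M ×ˢ (Set.univ : Set (Euc n)) :=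
    fun ω => Set.mk_mem_prod (hXM ω) (Set.mem_univ _)
  have hXU : Measurable fun ω => (X ω, U ω) := hX.prodMk hU
  have := measurable_comp_of_continuousOn hM.continuousOn_tangentProj_apply hXU h
  exact this

theorem measurable_rgrad_sample (hf : IsLoss P f) (hM : IsSubmanifold d M) {X : Ω → Euc n}
    {S : Ω → Ξ} (hX : Measurable X) (hXM : ∀ ω, X ω ∈ M) (hS : Measurable S) :
    Measurable fun ω => rgrad M (fun z => f z (S ω)) (X ω) :=
  measurable_tangentProj_apply hM hX hXM (hf.measurable_gradient.comp (hX.prodMk hS))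

theorem measurable_batchGrad (hf : IsLoss P f) (hM : IsSubmanifold d M) {X : Ω → Euc n} {b : ℕ}
    {S : Fin b → Ω → Ξ} (hX : Measurable X) (hXM : ∀ ω, X ω ∈ M) (hS : ∀ i, Measurable (S i)) :
    Measurable fun ω => batchGrad M f (fun i => S i ω) (X ω) :=
  (Finset.measurable_sum _ fun i _ => measurable_rgrad_sample hf hM hX hXM (hS i)).fun_const_smul _

theorem measurable_rgrad {F : Euc n → ℝ} (hM : IsSubmanifold d M)
    (hF : ContinuousOn (gradient F) M) {X : Ω → Euc n} (hX : Measurable X)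
    (hXM : ∀ ω, X ω ∈ M) : Measurable fun ω => rgrad M F (X ω) :=
  measurable_tangentProj_apply hM hX hXM (measurable_comp_of_continuousOn hF hX hXM)

theorem IsRetraction.measurable (hR : IsRetraction M R) {X W : Ω → Euc n} (hX : Measurable X)
    (hW : Measurable W) (hXM : ∀ ω, X ω ∈ M) (hWT : ∀ ω, W ω ∈ tangentSpace M (X ω)) :
    Measurable fun ω => R (X ω) (W ω) :=
  measurable_comp_of_continuousOn hR.smooth.continuousOn (hX.prodMk hW)
    fun ω => ⟨hXM ω, hWT ω⟩

theorem IsIsometricTransport.measurable (hT : IsIsometricTransport M R T) {X W U : Ω → Euc n}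
    (hX : Measurable X) (hW : Measurable W) (hU : Measurable U) (hXM : ∀ ω, X ω ∈ M)
    (hWT : ∀ ω, W ω ∈ tangentSpace M (X ω)) (hUT : ∀ ω, U ω ∈ tangentSpace M (X ω)) :
    Measurable fun ω => T (X ω) (W ω) (U ω) :=
  measurable_comp_of_continuousOn hT.smooth.continuousOn (hX.prodMk (hW.prodMk hU))
    fun ω => ⟨hXM ω, hWT ω, hUT ω⟩

theorem Params.measurable_betaSucc (c : Params) (k : ℕ) (r₁ : ℝ) :
    Measurable (c.betaSucc k r₁) := by
  unfold Params.betaSucc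
  refine Measurable.ite (measurableSet_singleton _) measurable_const ?_
  exact (measurable_const.div ((measurable_id.mul_const _).mul_const _)).min measurable_const

theorem Assumption1.continuousOn_gradient {F : Euc n → ℝ} {g : Euc m → ℝ} {LF Lg : ℝ}
    (h : Assumption1 d M F g LF Lg) : ContinuousOn (gradient F) M := by
  refine (LipschitzOnWith.of_dist_le_mul (K := ⟨LF, h.LF_nonneg⟩) fun x hx z hz => ?_).continuousOn
  rw [dist_eq_norm, dist_eq_norm]
  exact h.gradient_lipschitz x (subset_convexHull ℝ M hx) z (subset_convexHull ℝ M hz)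

end Measurability

/-! ### Feasibility and adaptedness of the iterates. -/

section Algorithm

variable {n m d : ℕ} {M : Set (Euc n)} {R : Euc n → Euc n → Euc n}
  {T : Euc n → Euc n → Euc n → Euc n} {Ξ : Type*} [MeasurableSpace Ξ] {P : Measure Ξ}
  {f : Euc n → Ξ → ℝ} {g : Euc m → ℝ} {A : Euc n →L[ℝ] Euc m} {c : Params}
  {x₁ : Euc n} {y₁ l₁ : Euc m} {Ω : Type*} {b : ℕ → ℕ} {ξ : (k : ℕ) → Fin (b k) → Ω → Ξ}
  {x v : ℕ → Ω → Euc n} {y l : ℕ → Ω → Euc m} {LF Lg : ℝ}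

theorem IsMARSADMM.mem (h : IsMARSADMM P f M R T g A c x₁ y₁ l₁ ξ x v y l)
    (hR : IsRetraction M R) (hT : IsIsometricTransport M R T) (hx₁ : x₁ ∈ M) {k : ℕ}
    (hk : 1 ≤ k) (ω : Ω) : x k ω ∈ M ∧ v k ω ∈ tangentSpace M (x k ω) ∧
      direction M A c x v y l k ω ∈ tangentSpace M (x k ω) := by
  suffices hs : x k ω ∈ M ∧ v k ω ∈ tangentSpace M (x k ω) from
    ⟨hs.1, hs.2, Submodule.add_mem _ hs.2 (tangentProj_mem _ _)⟩
  induction k, hk using Nat.le_induction with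
  | base =>
    rw [h.x_init, h.v_init]
    exact ⟨hx₁, batchGrad_mem _ _⟩
  | succ k hk ih =>
    have hw : -(c.η k • direction M A c x v y l k ω) ∈ tangentSpace M (x k ω) :=
      Submodule.neg_mem _ (Submodule.smul_mem _ _ (Submodule.add_mem _ ih.2 (tangentProj_mem _ _)))
    have hv := hT.mem _ ih.1 _ hw _ (Submodule.sub_mem _ ih.2
      (batchGrad_mem (f := f) (fun i => ξ (k + 1) i ω) (x k ω)))
    refine ⟨?_, ?_⟩
    · rw [h.x_step k hk]
      exact hR.mem _ ih.1 _ hw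
    · rw [h.v_step k hk]
      refine Submodule.add_mem _ (batchGrad_mem _ _) (Submodule.smul_mem _ _ ?_)
      rw [h.x_step k hk]
      exact hv

theorem IsMARSADMM.step_mem (h : IsMARSADMM P f M R T g A c x₁ y₁ l₁ ξ x v y l)
    (hR : IsRetraction M R) (hT : IsIsometricTransport M R T) (hx₁ : x₁ ∈ M) {k : ℕ}
    (hk : 1 ≤ k) (ω : Ω) : -(c.η k • direction M A c x v y l k ω) ∈ tangentSpace M (x k ω) :=
  Submodule.neg_mem _ (Submodule.smul_mem _ _ (h.mem hR hT hx₁ hk ω).2.2)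

theorem Params.rho_pos (hc : 0 < c.cρ) {k : ℕ} (hk : 1 ≤ k) : 0 < c.ρ k := by
  have : (0 : ℝ) < k := by exact_mod_cast hk
  unfold Params.ρ
  positivity

theorem IsMARSADMM.measurable_argmin [MeasurableSpace Ω]
    (h : IsMARSADMM P f M R T g A c x₁ y₁ l₁ ξ x v y l)
    (hg : ConvexOn ℝ Set.univ g) (hc : 0 < c.cρ) {k : ℕ} (hk : 1 ≤ k)
    (hx : Measurable (x k)) (hl : Measurable (l k)) : Measurable (y (k + 1)) :=
  measurable_of_dist_le ((A.continuous.measurable.comp hx).sub (hl.const_smul (1 / c.ρ k)))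
    fun ω ω' => dist_argmin_le hg (Params.rho_pos hc hk) (h.y_step k hk ω) (h.y_step k hk ω')

theorem IsMARSADMM.measurable_direction [MeasurableSpace Ω]
    (h : IsMARSADMM P f M R T g A c x₁ y₁ l₁ ξ x v y l)
    (hR : IsRetraction M R) (hT : IsIsometricTransport M R T) (hM : IsSubmanifold d M)
    (hg : ConvexOn ℝ Set.univ g) (hc : 0 < c.cρ) (hx₁ : x₁ ∈ M) {k : ℕ} (hk : 1 ≤ k)
    (hx : Measurable (x k)) (hl : Measurable (l k)) (hv : Measurable (v k)) :
    Measurable (direction M A c x v y l k) := by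
  refine hv.add (measurable_tangentProj_apply hM hx (fun ω => (h.mem hR hT hx₁ hk ω).1) ?_)
  have hA := A.continuous.measurable.comp hx
  have hy := h.measurable_argmin hg hc hk hx hl
  exact (A.adjoint.continuous.measurable.comp
    ((hA.sub hy).sub (hl.const_smul (1 / c.ρ k)))).const_smul (c.ρ k)

/-- The information available after the first `k` mini-batches. -/
@[reducible]
def sampleSigma (ξ : (k : ℕ) → Fin (b k) → Ω → Ξ) (k : ℕ) : MeasurableSpace Ω :=
  ⨆ j ∈ {j : (k : ℕ) × Fin (b k) | j.1 ≤ k},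
    MeasurableSpace.comap (ξ j.1 j.2) inferInstance

theorem measurable_sampleSigma {k i : ℕ} (hi : i ≤ k) (j : Fin (b i)) :
    Measurable[sampleSigma ξ k] (ξ i j) := by
  rw [measurable_iff_comap_le]
  exact le_iSup₂_of_le (f := fun (j : (k : ℕ) × Fin (b k)) (_ : j ∈ {j : (k : ℕ) × Fin (b k) |
    j.1 ≤ k}) => MeasurableSpace.comap (ξ j.1 j.2) inferInstance) ⟨i, j⟩ hi le_rfl

theorem sampleSigma_mono {k k' : ℕ} (h : k ≤ k') : sampleSigma ξ k ≤ sampleSigma ξ k' :=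
  biSup_mono fun _ hj => le_trans hj h

theorem IsSampling.sampleSigma_le [mΩ : MeasurableSpace Ω] {μ : Measure Ω}
    (h : IsSampling μ P b ξ) (k : ℕ) : sampleSigma ξ k ≤ mΩ :=
  iSup₂_le fun j _ => (h.measurable j.1 j.2).comap_le

/-- Disjoint blocks of an independent family generate independent σ-algebras. -/
theorem IsSampling.indep_sampleSigma [mΩ : MeasurableSpace Ω] {μ : Measure Ω}
    (h : IsSampling μ P b ξ) (k : ℕ) (i : Fin (b (k + 1))) :
    Indep (sampleSigma ξ k) (MeasurableSpace.comap (ξ (k + 1) i) inferInstance) μ := by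
  have := indep_iSup_of_disjoint
    (m := fun j : (k : ℕ) × Fin (b k) => MeasurableSpace.comap (ξ j.1 j.2) inferInstance) (fun j => (h.measurable j.1 j.2).comap_le) h.indep
    (S := {j : (k : ℕ) × Fin (b k) | j.1 ≤ k}) (T := {⟨k + 1, i⟩}) (by
      rw [Set.disjoint_singleton_right]
      simp)
  rw [iSup_singleton] at this
  exact this

/-- Adaptedness is what makes iteration k independent of batch k + 1 and hence removes the cross
term in the error recursion. -/
theorem IsMARSADMM.measurable (h : IsMARSADMM P f M R T g A c x₁ y₁ l₁ ξ x v y l)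
    (hf : IsLoss P f) (hR : IsRetraction M R) (hT : IsIsometricTransport M R T)
    (hM : IsSubmanifold d M) (hg : ConvexOn ℝ Set.univ g) (hc : 0 < c.cρ) (hx₁ : x₁ ∈ M)
    {k : ℕ} (hk : 1 ≤ k) :
    Measurable[sampleSigma ξ k] (x k) ∧ Measurable[sampleSigma ξ k] (l k) ∧
      Measurable[sampleSigma ξ k] (v k) := by
  induction k, hk using Nat.le_induction with
  | base =>
    let _ := sampleSigma ξ 1
    have e1 : x 1 = fun _ => x₁ := funext h.x_init
    have e2 : l 1 = fun _ => l₁ := funext h.l_init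
    have e3 : v 1 = fun ω => batchGrad M f (fun i => ξ 1 i ω) x₁ := funext h.v_init
    rw [e1, e2, e3]
    exact ⟨measurable_const, measurable_const, measurable_batchGrad hf hM measurable_const
      (fun _ => hx₁) fun i => measurable_sampleSigma le_rfl i⟩
  | succ k hk ih =>
    let _ := sampleSigma ξ (k + 1)
    have hle := sampleSigma_mono (ξ := ξ) k.le_succ
    have hx : Measurable (x k) := ih.1.mono hle le_rfl
    have hl : Measurable (l k) := ih.2.1.mono hle le_rfl
    have hv : Measurable (v k) := ih.2.2.mono hle le_rfl
    have hy := h.measurable_argmin hg hc hk hx hl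
    have hG := h.measurable_direction hR hT hM hg hc hx₁ hk hx hl hv
    have hmem := fun ω => h.mem hR hT hx₁ hk ω
    have hW : Measurable fun ω => -(c.η k • direction M A c x v y l k ω) :=
      (hG.const_smul (c.η k)).neg
    have hWT := h.step_mem hR hT hx₁ hk
    have hx' : Measurable (x (k + 1)) := by
      rw [show x (k + 1) = _ from funext (h.x_step k hk)]
      exact hR.measurable hx hW (fun ω => (hmem ω).1) hWT
    have hr : Measurable fun ω => A (x (k + 1) ω) - y (k + 1) ω :=
      (A.continuous.measurable.comp hx').sub hy
    refine ⟨hx', ?_, ?_⟩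
    · rw [show l (k + 1) = _ from funext (h.l_step k hk)]
      exact hl.sub (((c.measurable_betaSucc k _).comp hr.norm).smul hr)
    · rw [show v (k + 1) = _ from funext (h.v_step k hk)]
      have hS := fun i => measurable_sampleSigma (ξ := ξ) (le_refl (k + 1)) i
      refine (measurable_batchGrad hf hM hx'
        (fun ω => (h.mem hR hT hx₁ (Nat.le_add_left 1 k) ω).1) hS).add (Measurable.fun_const_smul ?_ _)
      exact hT.measurable hx hW
        (hv.sub (measurable_batchGrad hf hM hx (fun ω => (hmem ω).1) hS))
        (fun ω => (hmem ω).1) hWT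
        fun ω => Submodule.sub_mem _ (hmem ω).2.1 (batchGrad_mem _ _)

end Algorithm

/-! ### Cube roots of integers. -/

section Scalars

/-- The cube root of a natural number. -/
noncomputable def croot (k : ℕ) : ℝ := (k : ℝ) ^ (1 / 3 : ℝ)

theorem croot_pow_three (k : ℕ) : croot k ^ 3 = k := by
  rw [croot, ← Real.rpow_natCast, ← Real.rpow_mul (Nat.cast_nonneg k)]
  norm_num

theorem one_le_croot {k : ℕ} (hk : 1 ≤ k) : 1 ≤ croot k :=
  Real.one_le_rpow (by exact_mod_cast hk) (by norm_num)

theorem croot_pos {k : ℕ} (hk : 1 ≤ k) : 0 < croot k := zero_lt_one.trans_le (one_le_croot hk)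

theorem rpow_neg_third (k : ℕ) : (k : ℝ) ^ (-(1 / 3) : ℝ) = (croot k)⁻¹ :=
  Real.rpow_neg (Nat.cast_nonneg k) _

theorem rpow_neg_two_thirds (k : ℕ) : (k : ℝ) ^ (-(2 / 3) : ℝ) = (croot k ^ 2)⁻¹ := by
  rw [Real.rpow_neg (Nat.cast_nonneg k), croot, ← Real.rpow_natCast,
    ← Real.rpow_mul (Nat.cast_nonneg k)]
  norm_num

theorem rpow_neg_four_thirds (k : ℕ) : (k : ℝ) ^ (-(4 / 3) : ℝ) = (croot k ^ 4)⁻¹ := by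
  rw [Real.rpow_neg (Nat.cast_nonneg k), croot, ← Real.rpow_natCast,
    ← Real.rpow_mul (Nat.cast_nonneg k)]
  norm_num

theorem croot_le_croot_succ (k : ℕ) : croot k ≤ croot (k + 1) :=
  Real.rpow_le_rpow (Nat.cast_nonneg k) (by push_cast; linarith) (by norm_num)

theorem croot_succ_sub_mul (k : ℕ) :
    (croot (k + 1) - croot k) * (croot (k + 1) ^ 2 + croot (k + 1) * croot k + croot k ^ 2) = 1 := by
  have h1 := croot_pow_three (k + 1)
  have h2 := croot_pow_three k
  push_cast at h1
  linear_combination h1 - h2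

/-- The factorisation a³ - b³ = 1 with all three terms of a² + ab + b² at least b². It controls the
penalty increase ρ_{k+1} - ρ_k. -/
theorem croot_succ_sub_le {k : ℕ} (hk : 1 ≤ k) :
    croot (k + 1) - croot k ≤ 1 / (3 * croot k ^ 2) := by
  have h0 := croot_pos hk
  have h1 := croot_le_croot_succ k
  rw [le_div_iff₀ (by positivity), ← croot_succ_sub_mul k]
  refine mul_le_mul_of_nonneg_left ?_ (sub_nonneg.2 h1)
  nlinarith

theorem one_le_log_add_two {k : ℕ} (hk : 1 ≤ k) : 1 ≤ Real.log ((k : ℝ) + 2) := by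
  have hk' : (1 : ℝ) ≤ k := by exact_mod_cast hk
  rw [Real.le_log_iff_exp_le (by linarith)]
  linarith [Real.exp_one_lt_d9]

end Scalars

/-! ### The parameter sequences and the two bounds on the dual step. -/

section StepSizes

variable {c : Params}

theorem Params.rho_eq (k : ℕ) : c.ρ k = c.cρ * croot k := rfl

theorem Params.eta_eq (k : ℕ) : c.η k = c.cη / croot k := by
  rw [Params.η, rpow_neg_third, div_eq_mul_inv]

theorem Params.alphaSucc_eq (k : ℕ) : c.alphaSucc k = c.cα / croot k ^ 2 := by
  rw [Params.alphaSucc, rpow_neg_two_thirds, div_eq_mul_inv]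

theorem Params.betaSucc_nonneg (hβ : 0 ≤ c.β₁) (hcβ : 0 ≤ c.cβ) (k : ℕ) {r₁ r : ℝ} (hr₁ : 0 ≤ r₁)
    (hr : 0 ≤ r) : 0 ≤ c.betaSucc k r₁ r := by
  have : 0 ≤ Real.log ((k : ℝ) + 3) := Real.log_nonneg (by linarith [Nat.cast_nonneg (α := ℝ) k])
  unfold Params.betaSucc
  split_ifs
  · positivity
  · exact le_min (by positivity) (by positivity)

theorem Params.betaSucc_le (k : ℕ) (r₁ r : ℝ) :
    c.betaSucc k r₁ r ≤ c.cβ / (croot k * Real.log (k + 2) ^ 2) := by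
  unfold Params.betaSucc croot
  split_ifs
  · exact le_rfl
  · exact min_le_right _ _

theorem Params.betaSucc_mul_le (hβ : 0 ≤ c.β₁) {k : ℕ} (hk : 1 ≤ k) {r₁ r : ℝ} (hr₁ : 0 ≤ r₁)
    (hr : 0 ≤ r) : c.betaSucc k r₁ r * r ≤ c.β₁ * r₁ * (1 / ((k + 2 : ℕ) : ℝ) ^ 2) := by
  rcases hr.eq_or_lt with h0 | h0
  · rw [← h0, mul_zero]; positivity
  · have hlog : 1 ≤ Real.log ((k : ℝ) + 3) := by
      refine (one_le_log_add_two hk).trans (Real.log_le_log (by positivity) (by linarith))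
    have h1 : c.betaSucc k r₁ r ≤ c.β₁ * r₁ / (r * ((k : ℝ) + 2) ^ 2 * Real.log (k + 3)) := by
      unfold Params.betaSucc
      rw [if_neg h0.ne']
      exact min_le_left _ _
    have h2 : c.β₁ * r₁ / (r * ((k : ℝ) + 2) ^ 2 * Real.log (k + 3)) ≤
        c.β₁ * r₁ / (r * ((k : ℝ) + 2) ^ 2) := by
      refine div_le_div_of_nonneg_left (by positivity) (by positivity) ?_
      exact le_mul_of_one_le_right (by positivity) hlog
    calc c.betaSucc k r₁ r * r ≤ c.β₁ * r₁ / (r * ((k : ℝ) + 2) ^ 2) * r := by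
          gcongr; exact h1.trans h2
      _ = c.β₁ * r₁ * (1 / ((k + 2 : ℕ) : ℝ) ^ 2) := by
          push_cast
          field_simp

end StepSizes

/-! ### Descent of the augmented Lagrangian in the x-step. -/

section Descent

/-- Descent inequality for a function whose gradient is Lipschitz on a convex set. -/
theorem le_of_gradient_lipschitz {E : Type*} [NormedAddCommGroup E] [InnerProductSpace ℝ E]
    [CompleteSpace E] {F : E → ℝ} (hF : Differentiable ℝ F) {s : Set E}
    (hs : Convex ℝ s) {L : ℝ} (hL : ∀ x ∈ s, ∀ z ∈ s, ‖gradient F x - gradient F z‖ ≤ L * ‖x - z‖)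
    {x z : E} (hx : x ∈ s) (hz : z ∈ s) :
    F z ≤ F x + ⟪gradient F x, z - x⟫_ℝ + L / 2 * ‖z - x‖ ^ 2 := by
  set h := z - x with hh
  -- Subtracting the first order model and the quadratic L/2 ‖h‖² t² leaves a function with
  -- nonpositive derivative on (0, 1).
  have hd : ∀ t : ℝ, HasDerivAt
      (fun t : ℝ => F (x + t • h) - t * ⟪gradient F x, h⟫_ℝ - L / 2 * ‖h‖ ^ 2 * t ^ 2)
      (⟪gradient F (x + t • h) - gradient F x, h⟫_ℝ - L * ‖h‖ ^ 2 * t) t := by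
    intro t
    have hline : HasDerivAt (fun t : ℝ => x + t • h) h t := by
      simpa using ((hasDerivAt_id t).smul_const h).const_add x
    have h1 := (hF (x + t • h)).hasFDerivAt.comp_hasDerivAt t hline
    rw [← inner_gradient_left] at h1
    have h2 := (hasDerivAt_id t).mul_const ⟪gradient F x, h⟫_ℝ
    have h3 := ((hasDerivAt_id t).pow 2).const_mul (L / 2 * ‖h‖ ^ 2)
    refine ((h1.sub h2).sub h3).congr_deriv ?_
    simp [inner_sub_left]
    ring
  have hmem : ∀ t ∈ Set.Icc (0 : ℝ) 1, x + t • h ∈ s := fun t ht => by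
    have := hs.add_smul_sub_mem hx hz ht
    rwa [← hh] at this
  have hanti := antitoneOn_of_deriv_nonpos (convex_Icc (0 : ℝ) 1)
    (fun t _ => (hd t).continuousAt.continuousWithinAt)
    (fun t _ => (hd t).differentiableAt.differentiableWithinAt)
    (fun t ht => by
      rw [interior_Icc] at ht
      rw [(hd t).deriv]
      have h1 := hL _ (hmem t ⟨ht.1.le, ht.2.le⟩) _ hx
      rw [add_sub_cancel_left, norm_smul, Real.norm_of_nonneg ht.1.le] at h1
      have h2 := real_inner_le_norm (gradient F (x + t • h) - gradient F x) h
      nlinarith [norm_nonneg h])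
  have := hanti (Set.left_mem_Icc.2 zero_le_one) (Set.right_mem_Icc.2 zero_le_one) zero_le_one
  simp only [one_smul, zero_smul, add_zero, hh, add_sub_cancel] at this
  simp only [hh]
  linarith

variable {n m d : ℕ} {M : Set (Euc n)} {R : Euc n → Euc n → Euc n} {F : Euc n → ℝ}
  {g : Euc m → ℝ} {A : Euc n →L[ℝ] Euc m}

/-- Decrease of the augmented Lagrangian in the `x`-step. -/
theorem augLagrangian_retraction_le {LF Lg p q B : ℝ} (hF : Assumption1 d M F g LF Lg)
    (hR : IsRetraction M R) (hpq : RetractionBounds M R p q) {ρ η : ℝ} (hρ : 0 ≤ ρ) (hη : 0 ≤ η)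
    {x G e : Euc n} {y l : Euc m} (hx : x ∈ M) (hG : G ∈ tangentSpace M x)
    (hB : ‖gradient F x‖ ≤ B) (hs : ‖ρ • (A x - y) - l‖ ≤ Lg)
    (hGe : G = e + tangentProj M x (gradient F x + A.adjoint (ρ • (A x - y) - l))) :
    augLagrangian F g A ρ (R x (-(η • G))) y l ≤ augLagrangian F g A ρ x y l
      - η * ⟪G - e, G⟫_ℝ
      + η ^ 2 * ‖G‖ ^ 2 * (q * (B + ‖A‖ * Lg) + (LF + ρ * ‖A‖ ^ 2) * p ^ 2 / 2) := by
  obtain ⟨hp, hq, hb⟩ := hpq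
  have hw : -(η • G) ∈ tangentSpace M x := Submodule.neg_mem _ (Submodule.smul_mem _ _ hG)
  obtain ⟨h1, h2⟩ := hb x hx _ hw
  have hx' := hR.mem x hx _ hw
  rw [norm_neg, norm_smul, Real.norm_of_nonneg hη] at h1 h2
  set x' := R x (-(η • G)) with hx'd
  set h := x' - x with hh
  set s := ρ • (A x - y) - l with hsd
  set D := gradient F x + A.adjoint s with hD
  have hFd := le_of_gradient_lipschitz hF.differentiable (convex_convexHull ℝ M)
    hF.gradient_lipschitz (subset_convexHull ℝ M hx) (subset_convexHull ℝ M hx')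
  rw [← hh] at hFd
  have hAx : A x' - y = (A x - y) + A h := by rw [hh, map_sub]; abel
  have hexp : augLagrangian F g A ρ x' y l = F x' - F x + augLagrangian F g A ρ x y l
      + ⟪A.adjoint s, h⟫_ℝ + ρ / 2 * ‖A h‖ ^ 2 := by
    unfold augLagrangian
    rw [hAx, norm_add_sq_real, inner_add_right, ContinuousLinearMap.adjoint_inner_left, hsd,
      inner_sub_left (ρ • (A x - y)), real_inner_smul_left]
    ring
  have hDn : ‖D‖ ≤ B + ‖A‖ * Lg := by
    refine (norm_add_le _ _).trans (add_le_add hB ?_)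
    refine (A.adjoint.le_opNorm s).trans ?_
    rw [LinearIsometryEquiv.norm_map]
    gcongr
  -- The displacement h is -ηG plus a retraction error of order q‖ηG‖². Since G is tangent, ⟪D, G⟫
  -- only sees the tangential part of D, which is G - e.
  have hDh : ⟪D, h⟫_ℝ ≤ - (η * ⟪G - e, G⟫_ℝ) + (B + ‖A‖ * Lg) * (q * (η * ‖G‖) ^ 2) := by
    have e1 : h = (h - -(η • G)) + -(η • G) := by abel
    have e2 : ⟪G - e, G⟫_ℝ = ⟪D, G⟫_ℝ := by
      rw [← inner_tangentProj (u := D) hG, hGe]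
      simp
    rw [e1, inner_add_right, inner_neg_right, real_inner_smul_right, e2]
    have := real_inner_le_norm D (h - -(η • G))
    have h3 : ‖D‖ * ‖h - -(η • G)‖ ≤ (B + ‖A‖ * Lg) * (q * (η * ‖G‖) ^ 2) := by
      gcongr
      exact (norm_nonneg _).trans hDn
    linarith
  have hAh : ‖A h‖ ^ 2 ≤ ‖A‖ ^ 2 * ‖h‖ ^ 2 := by
    rw [← mul_pow]
    gcongr
    exact A.le_opNorm h
  have hh2 : ‖h‖ ^ 2 ≤ p ^ 2 * (η * ‖G‖) ^ 2 := by
    rw [← mul_pow]; gcongr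
  have hDe : ⟪D, h⟫_ℝ = ⟪gradient F x, h⟫_ℝ + ⟪A.adjoint s, h⟫_ℝ := inner_add_left _ _ _
  have h4 : (LF + ρ * ‖A‖ ^ 2) / 2 * ‖h‖ ^ 2 ≤
      (LF + ρ * ‖A‖ ^ 2) / 2 * (p ^ 2 * (η * ‖G‖) ^ 2) := by
    have := hF.LF_nonneg
    gcongr
  have h5 : ρ / 2 * ‖A h‖ ^ 2 ≤ ρ / 2 * (‖A‖ ^ 2 * ‖h‖ ^ 2) := by gcongr
  rw [hexp]
  nlinarith

/-- The scalar estimate behind the decrease of the augmented Lagrangian in one iteration. -/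
theorem descent_scalar {κ cρ cη cβ ℓ a p Λ N E I r W Q : ℝ} (hκ : 1 ≤ κ) (hcρ : 1 ≤ cρ)
    (hcη : 0 < cη) (hcβ : cβ ≤ cρ / 3) (hcβ0 : 0 < cβ) (hℓ : 1 ≤ ℓ) (hN : 0 ≤ N)
    (hI : I ≤ 2 * E + N / 8) (hQ : cη / κ * Q ≤ 1 / 2)
    (hap : cη * cρ * (8 * p ^ 2 * a ^ 2) ≤ 1)
    (hr : r ^ 2 ≤ 2 * (Λ / (cρ * κ)) ^ 2 + 2 * (a ^ 2 * p ^ 2 * ((cη / κ) ^ 2 * N)))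
    (hW : W ≤ cβ / (κ * ℓ ^ 2) + cρ / (6 * κ ^ 2)) (hW0 : 0 ≤ W) :
    -(cη / κ * (N - I)) + (cη / κ) ^ 2 * N * Q + W * r ^ 2 ≤
      -((3 / 8 - 1 / (8 * κ ^ 2)) * (cη / κ) * N) + 2 * (cη / κ) * E
      + (1 / (3 * cρ) * (κ ^ 4)⁻¹ + 2 * cβ / cρ ^ 2 * (1 / (κ ^ 3 * ℓ ^ 2))) * Λ ^ 2 := by
  have hκ0 : 0 < κ := by linarith
  have hη : 0 < cη / κ := by positivity
  have h1 : (cη / κ) ^ 2 * N * Q ≤ cη / κ * N * (1 / 2) := by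
    have := mul_le_mul_of_nonneg_left hQ (mul_nonneg hη.le hN)
    nlinarith
  have h2 : W * (2 * (Λ / (cρ * κ)) ^ 2) ≤
      (1 / (3 * cρ) * (κ ^ 4)⁻¹ + 2 * cβ / cρ ^ 2 * (1 / (κ ^ 3 * ℓ ^ 2))) * Λ ^ 2 := by
    have := mul_le_mul_of_nonneg_right hW (show 0 ≤ 2 * (Λ / (cρ * κ)) ^ 2 by positivity)
    refine this.trans (le_of_eq ?_)
    field_simp
    ring
  -- 1/3 + 1/6 = 1/2. This cruder bound serves only the N-part of r², where the penalty condition on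
  -- c_η turns it into the loss 1/(8κ²); the Λ²-part keeps the decay of W.
  have hW' : W ≤ cρ / (2 * κ) := by
    have e1 : cβ / (κ * ℓ ^ 2) ≤ cρ / 3 / κ := by
      rw [div_le_div_iff₀ (by positivity) hκ0]
      have : (1 : ℝ) ≤ ℓ ^ 2 := one_le_pow₀ hℓ
      nlinarith [mul_le_mul_of_nonneg_right hcβ hκ0.le,
        mul_le_mul_of_nonneg_left this (show 0 ≤ cρ / 3 * κ by positivity)]
    have e2 : cρ / (6 * κ ^ 2) ≤ cρ / (6 * κ) := by
      apply div_le_div_of_nonneg_left (by linarith) (by positivity)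
      nlinarith
    have e3 : cρ / 3 / κ + cρ / (6 * κ) = cρ / (2 * κ) := by field_simp; ring
    linarith
  have h3 : W * (2 * (a ^ 2 * p ^ 2 * ((cη / κ) ^ 2 * N))) ≤ 1 / (8 * κ ^ 2) * (cη / κ) * N := by
    have := mul_le_mul_of_nonneg_right hW'
      (show 0 ≤ 2 * (a ^ 2 * p ^ 2 * ((cη / κ) ^ 2 * N)) by positivity)
    refine this.trans ?_
    have e1 : cρ / (2 * κ) * (2 * (a ^ 2 * p ^ 2 * ((cη / κ) ^ 2 * N))) =
        (cη * cρ * (8 * p ^ 2 * a ^ 2)) * (1 / (8 * κ ^ 2) * (cη / κ) * N) := by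
      field_simp
    rw [e1]
    exact mul_le_of_le_one_left (by positivity) hap
  have h4 := mul_le_mul_of_nonneg_left hI hη.le
  have h5 := mul_le_mul_of_nonneg_left hr hW0
  linarith

end Descent

/-! ### Bounded multipliers and one-step decrease along a sample path. -/

section PathwiseDescent

/-- The admissible parameters; `a = ‖A‖` and `S` is the smoothness constant. -/
structure Admissible (c : Params) (cγ a p S Lt : ℝ) : Prop where
  β₁_nonneg : 0 ≤ c.β₁
  one_le_cρ : 1 ≤ c.cρ
  cα_lower : 0.8 ≤ c.cα
  cα_le : c.cα ≤ 1
  cβ_pos : 0 < c.cβ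
  cβ_le : c.cβ ≤ c.cρ / 3
  cγ_pos : 0 < cγ
  cγ_le : cγ ≤ c.cρ
  le_cρ_mul_cγ : 8 ≤ c.cρ * cγ
  cη_pos : 0 < c.cη
  penalty : c.cη * c.cρ * (8 * p ^ 2 * a ^ 2) ≤ 1
  smooth : c.cη * c.cρ * (1 + S) ≤ 1
  transport : c.cη * c.cρ * (8 * Lt ^ 2) ≤ 1

variable {n m d : ℕ} {M : Set (Euc n)} {R : Euc n → Euc n → Euc n}
  {T : Euc n → Euc n → Euc n → Euc n} {Ξ : Type*} [MeasurableSpace Ξ] {P : Measure Ξ}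
  {f : Euc n → Ξ → ℝ} {g : Euc m → ℝ} {A : Euc n →L[ℝ] Euc m} {c : Params}
  {x₁ : Euc n} {y₁ l₁ : Euc m} {Ω : Type*} {b : ℕ → ℕ} {ξ : (k : ℕ) → Fin (b k) → Ω → Ξ}
  {x v : ℕ → Ω → Euc n} {y l : ℕ → Ω → Euc m} {LF Lg p q B cγ Lt : ℝ}

theorem lambdaMax_nonneg (hβ : 0 ≤ c.β₁) : 0 ≤ lambdaMax A c.β₁ x₁ y₁ l₁ := by
  unfold lambdaMax
  positivity

theorem IsMARSADMM.norm_l_le (h : IsMARSADMM P f M R T g A c x₁ y₁ l₁ ξ x v y l)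
    (hβ : 0 ≤ c.β₁) (hcβ : 0 ≤ c.cβ) {k : ℕ} (hk : 1 ≤ k) (ω : Ω) :
    ‖l k ω‖ ≤ lambdaMax A c.β₁ x₁ y₁ l₁ := by
  have hr₁ : 0 ≤ ‖A x₁ - y₁‖ := norm_nonneg _
  -- The step from k to k + 1 costs 1/(k+2)², the next term of this sum; the term j = 0 is 1/0 = 0.
  -- The full series is π²/6.
  have key : ‖l k ω‖ ≤
      ‖l₁‖ + c.β₁ * ‖A x₁ - y₁‖ * ∑ j ∈ Finset.range (k + 2), 1 / (j : ℝ) ^ 2 := by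
    induction k, hk using Nat.le_induction with
    | base =>
      rw [h.l_init]
      exact le_add_of_nonneg_right (mul_nonneg (by positivity)
        (Finset.sum_nonneg fun _ _ => by positivity))
    | succ k hk ih =>
      rw [h.l_step k hk, Finset.sum_range_succ, mul_add, ← add_assoc]
      refine (norm_sub_le _ _).trans (add_le_add ih ?_)
      rw [norm_smul, Real.norm_of_nonneg (Params.betaSucc_nonneg hβ hcβ k hr₁ (norm_nonneg _))]
      exact Params.betaSucc_mul_le hβ hk hr₁ (norm_nonneg _)
  refine key.trans ?_
  have hz := sum_le_hasSum (Finset.range (k + 2)) (fun j _ => by positivity) hasSum_zeta_two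
  have := mul_le_mul_of_nonneg_left hz (mul_nonneg hβ hr₁)
  unfold lambdaMax
  linarith

theorem IsMARSADMM.rho_mul_norm_le (h : IsMARSADMM P f M R T g A c x₁ y₁ l₁ ξ x v y l)
    (hA1 : Assumption1 d M (objective P f) g LF Lg) (hβ : 0 ≤ c.β₁) (hcβ : 0 ≤ c.cβ)
    (hc : 0 < c.cρ) {k : ℕ} (hk : 1 ≤ k) (ω : Ω) :
    c.ρ k * ‖A (x k ω) - y (k + 1) ω‖ ≤ Lg + lambdaMax A c.β₁ x₁ y₁ l₁ := by
  have hρ := Params.rho_pos hc hk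
  have h1 := norm_multiplier_le hA1.convex hA1.g_lipschitz hρ.le hA1.Lg_nonneg (h.y_step k hk ω)
  have h2 := h.norm_l_le hβ hcβ hk ω
  calc c.ρ k * ‖A (x k ω) - y (k + 1) ω‖ = ‖c.ρ k • (A (x k ω) - y (k + 1) ω)‖ := by
        rw [norm_smul, Real.norm_of_nonneg hρ.le]
    _ = ‖(c.ρ k • (A (x k ω) - y (k + 1) ω) - l k ω) + l k ω‖ := by rw [sub_add_cancel]
    _ ≤ _ := (norm_add_le _ _).trans (add_le_add h1 h2)

/-- The direction is ε_k plus the Riemannian gradient in x of the augmented Lagrangian at (x_k,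
y_{k+1}, λ_k). -/
theorem direction_eq (hc : 0 < c.cρ) {k : ℕ} (hk : 1 ≤ k) (F : Euc n → ℝ) (ω : Ω) :
    direction M A c x v y l k ω = estError M F x v k ω + tangentProj M (x k ω)
      (gradient F (x k ω) + A.adjoint (c.ρ k • (A (x k ω) - y (k + 1) ω) - l k ω)) := by
  have hρ := (Params.rho_pos hc hk).ne'
  unfold direction estError rgrad
  rw [map_add (tangentProj M (x k ω)), ← map_smul A.adjoint,
    smul_sub (c.ρ k) (A (x k ω) - y (k + 1) ω), smul_smul, mul_one_div_cancel hρ, one_smul]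
  abel

/-- Since c_ρ κ ≥ 1, this factor can be pulled out of the whole curvature term; its κ cancels the
1/κ of the step size, leaving the smoothness condition on c_η. -/
theorem Admissible.eta_mul_le {Θ' D lm : ℝ}
    (had : Admissible c cγ ‖A‖ p (smoothConst ‖A‖ D B LF Lg lm p q) Lt)
    (hΘ : Θ' ≤ Theta ‖A‖ D B Lg lm) (hΘ0 : 0 ≤ Θ') (hLF : 0 ≤ LF) (hq : 0 ≤ q) {κ : ℝ}
    (hκ : 1 ≤ κ) :
    c.cη / κ * (q * Θ' + (LF + c.cρ * κ * ‖A‖ ^ 2) * p ^ 2 / 2) ≤ 1 / 2 := by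
  have hs := had.smooth
  have hη := had.cη_pos
  have hρ := had.one_le_cρ
  have hκ0 : 0 < κ := by linarith
  unfold smoothConst at hs
  have h1 : q * Θ' + (LF + c.cρ * κ * ‖A‖ ^ 2) * p ^ 2 / 2 ≤
      c.cρ * κ * (q * Theta ‖A‖ D B Lg lm + (LF + ‖A‖ ^ 2) * p ^ 2 / 2) := by
    have h2 : 1 ≤ c.cρ * κ := one_le_mul_of_one_le_of_one_le hρ hκ
    have h3 : q * Θ' ≤ q * Theta ‖A‖ D B Lg lm := by gcongr
    have h4 : 0 ≤ q * Θ' := by positivity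
    have h5 : 0 ≤ LF * p ^ 2 / 2 := by positivity
    nlinarith [mul_nonneg (sub_nonneg.2 h2) (h4.trans h3), mul_nonneg (sub_nonneg.2 h2) h5]
  calc c.cη / κ * (q * Θ' + (LF + c.cρ * κ * ‖A‖ ^ 2) * p ^ 2 / 2)
      ≤ c.cη / κ * (c.cρ * κ * (q * Theta ‖A‖ D B Lg lm + (LF + ‖A‖ ^ 2) * p ^ 2 / 2)) := by
        gcongr
    _ = c.cη * c.cρ * (q * Theta ‖A‖ D B Lg lm + (LF + ‖A‖ ^ 2) * p ^ 2 / 2) := by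
        field_simp
    _ ≤ 1 / 2 := by nlinarith [mul_pos hη (zero_lt_one.trans_le hρ)]

/-- Decrease of the augmented Lagrangian along a sample path in one iteration. -/
theorem IsMARSADMM.lagrangian_step_le (h : IsMARSADMM P f M R T g A c x₁ y₁ l₁ ξ x v y l)
    (hA1 : Assumption1 d M (objective P f) g LF Lg) (hR : IsRetraction M R)
    (hT : IsIsometricTransport M R T) (hpq : RetractionBounds M R p q)
    (hB : ∀ x ∈ M, ‖gradient (objective P f) x‖ ≤ B) (hx₁ : x₁ ∈ M)
    (had : Admissible c cγ ‖A‖ p (smoothConst ‖A‖ (Metric.diam M) B LF Lg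
      (lambdaMax A c.β₁ x₁ y₁ l₁) p q) Lt) {k : ℕ} (hk : 1 ≤ k) (ω : Ω) :
    augLagrangian (objective P f) g A (c.ρ (k + 1)) (x (k + 1) ω) (y (k + 1) ω) (l (k + 1) ω) ≤
      augLagrangian (objective P f) g A (c.ρ k) (x k ω) (y k ω) (l k ω)
      - (3 / 8 - 1 / (8 * croot k ^ 2)) * (c.cη / croot k) * ‖direction M A c x v y l k ω‖ ^ 2
      + 2 * (c.cη / croot k) * ‖estError M (objective P f) x v k ω‖ ^ 2
      + (1 / (3 * c.cρ) * (croot k ^ 4)⁻¹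
          + 2 * c.cβ / c.cρ ^ 2 * (1 / (croot k ^ 3 * Real.log (k + 2) ^ 2)))
        * (Lg + lambdaMax A c.β₁ x₁ y₁ l₁) ^ 2 := by
  set lm := lambdaMax A c.β₁ x₁ y₁ l₁ with hlm
  set F := objective P f with hFdef
  set G := direction M A c x v y l k ω with hG
  set e := estError M F x v k ω with he
  have hκ := one_le_croot hk
  have hκ0 := croot_pos hk
  have hcρ0 : 0 < c.cρ := zero_lt_one.trans_le had.one_le_cρ
  have hη0 : 0 ≤ c.η k := by rw [Params.eta_eq]; have := had.cη_pos; positivity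
  have hρ := Params.rho_pos hcρ0 hk
  have hlm0 : 0 ≤ lm := lambdaMax_nonneg had.β₁_nonneg
  obtain ⟨hxM, -, hGT⟩ := h.mem hR hT hx₁ hk ω
  have hB0 : 0 ≤ B := (norm_nonneg _).trans (hB _ hxM)
  have hy := h.y_step k hk ω (Set.mem_univ (y k ω))
  change augLagrangian F g A (c.ρ k) (x k ω) (y (k + 1) ω) (l k ω) ≤
    augLagrangian F g A (c.ρ k) (x k ω) (y k ω) (l k ω) at hy
  have hs := norm_multiplier_le hA1.convex hA1.g_lipschitz hρ.le hA1.Lg_nonneg (h.y_step k hk ω)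
  have hxs := augLagrangian_retraction_le (e := e) hA1 hR hpq hρ.le hη0 hxM hGT (hB _ hxM) hs
    (direction_eq hcρ0 hk F ω)
  rw [← h.x_step k hk ω, ← hG] at hxs
  set r := A (x (k + 1) ω) - y (k + 1) ω with hr
  set β := c.betaSucc k ‖A x₁ - y₁‖ ‖r‖ with hβd
  have hβ0 : 0 ≤ β :=
    Params.betaSucc_nonneg had.β₁_nonneg had.cβ_pos.le k (norm_nonneg _) (norm_nonneg _)
  -- The dual update adds β‖r‖², and the larger penalty adds (ρ_{k+1} - ρ_k)/2 ‖r‖².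
  have hdual : augLagrangian F g A (c.ρ (k + 1)) (x (k + 1) ω) (y (k + 1) ω) (l (k + 1) ω) =
      augLagrangian F g A (c.ρ k) (x (k + 1) ω) (y (k + 1) ω) (l k ω)
        + (β + (c.ρ (k + 1) - c.ρ k) / 2) * ‖r‖ ^ 2 := by
    rw [h.l_step k hk ω]
    unfold augLagrangian
    rw [← hr, ← hβd, inner_sub_left, real_inner_smul_left, real_inner_self_eq_norm_sq]
    ring
  have hrn : ‖r‖ ^ 2 ≤ 2 * ((Lg + lm) / (c.cρ * croot k)) ^ 2
      + 2 * (‖A‖ ^ 2 * p ^ 2 * ((c.cη / croot k) ^ 2 * ‖G‖ ^ 2)) := by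
    have h1 : ‖A (x k ω) - y (k + 1) ω‖ ≤ (Lg + lm) / (c.cρ * croot k) := by
      rw [le_div_iff₀ (by positivity), mul_comm]
      exact h.rho_mul_norm_le hA1 had.β₁_nonneg had.cβ_pos.le hcρ0 hk ω
    have h2 : ‖A (x (k + 1) ω - x k ω)‖ ≤ ‖A‖ * (p * (c.cη / croot k * ‖G‖)) := by
      refine (A.le_opNorm _).trans ?_
      have := (hpq.2.2 _ hxM _ (h.step_mem hR hT hx₁ hk ω)).1
      rw [← h.x_step k hk ω, norm_neg, norm_smul, Real.norm_of_nonneg hη0, Params.eta_eq] at this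
      gcongr
    have h3 : ‖r‖ ≤ (Lg + lm) / (c.cρ * croot k) + ‖A‖ * (p * (c.cη / croot k * ‖G‖)) := by
      have e1 : r = (A (x k ω) - y (k + 1) ω) + A (x (k + 1) ω - x k ω) := by
        rw [hr, map_sub]; abel
      rw [e1]
      exact (norm_add_le _ _).trans (add_le_add h1 h2)
    calc ‖r‖ ^ 2 ≤ ((Lg + lm) / (c.cρ * croot k) + ‖A‖ * (p * (c.cη / croot k * ‖G‖))) ^ 2 := by
          gcongr
      _ ≤ 2 * (((Lg + lm) / (c.cρ * croot k)) ^ 2 + (‖A‖ * (p * (c.cη / croot k * ‖G‖))) ^ 2) :=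
          add_sq_le
      _ = _ := by ring
  have hW : β + (c.ρ (k + 1) - c.ρ k) / 2 ≤
      c.cβ / (croot k * Real.log (k + 2) ^ 2) + c.cρ / (6 * croot k ^ 2) := by
    refine add_le_add (Params.betaSucc_le k _ _) ?_
    have := mul_le_mul_of_nonneg_left (croot_succ_sub_le hk) hcρ0.le
    rw [Params.rho_eq, Params.rho_eq, ← mul_sub]
    calc c.cρ * (croot (k + 1) - croot k) / 2 ≤ c.cρ * (1 / (3 * croot k ^ 2)) / 2 := by gcongr
      _ = _ := by field_simp; norm_num
  have hW0 : 0 ≤ β + (c.ρ (k + 1) - c.ρ k) / 2 := by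
    have := mul_nonneg hcρ0.le (sub_nonneg.2 (croot_le_croot_succ k))
    rw [Params.rho_eq, Params.rho_eq, ← mul_sub]
    positivity
  -- Young's inequality in the form (4‖e‖ - ‖G‖)² ≥ 0; the weight 1/8 leaves 1 - 1/8 - 1/2 = 3/8 of
  -- η‖G‖².
  have hI : ⟪e, G⟫_ℝ ≤ 2 * ‖e‖ ^ 2 + ‖G‖ ^ 2 / 8 := by
    have := real_inner_le_norm e G
    nlinarith [sq_nonneg (4 * ‖e‖ - ‖G‖)]
  have hΘ : B + ‖A‖ * Lg ≤ Theta ‖A‖ (Metric.diam M) B Lg lm := by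
    have : 0 ≤ Metric.diam M := Metric.diam_nonneg
    have h1 : 0 ≤ ‖A‖ ^ 2 * Metric.diam M + ‖A‖ * (lm + 2 * ‖A‖ * Metric.diam M) + ‖A‖ * lm := by
      positivity
    unfold Theta
    linarith
  have hQ := had.eta_mul_le hΘ (by have := hA1.Lg_nonneg; positivity) hA1.LF_nonneg hpq.2.1.le hκ
  have hfin := descent_scalar hκ had.one_le_cρ had.cη_pos had.cβ_le had.cβ_pos
    (one_le_log_add_two hk) (sq_nonneg ‖G‖) hI hQ had.penalty hrn hW hW0
  rw [inner_sub_left, real_inner_self_eq_norm_sq, Params.eta_eq] at hxs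
  simp only [Params.rho_eq] at hdual hy hxs hfin ⊢
  rw [hdual]
  linarith

/-- The augmented Lagrangian is bounded below along a sample path. -/
theorem IsMARSADMM.meritLower_le (h : IsMARSADMM P f M R T g A c x₁ y₁ l₁ ξ x v y l)
    (hA1 : Assumption1 d M (objective P f) g LF Lg) (hR : IsRetraction M R)
    (hT : IsIsometricTransport M R T) (hx₁ : x₁ ∈ M) (hβ : 0 ≤ c.β₁) (hcβ : 0 ≤ c.cβ)
    (hc : 1 ≤ c.cρ) {k : ℕ} (hk : 1 ≤ k) (ω : Ω) :
    meritLower M (objective P f) g A Lg (lambdaMax A c.β₁ x₁ y₁ l₁) ≤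
      augLagrangian (objective P f) g A (c.ρ (k + 1)) (x (k + 1) ω) (y (k + 1) ω)
        (l (k + 1) ω) := by
  set lm := lambdaMax A c.β₁ x₁ y₁ l₁ with hlm
  have hk' : 1 ≤ k + 1 := Nat.le_add_left 1 k
  have hc0 : 0 < c.cρ := zero_lt_one.trans_le hc
  have hx := (h.mem hR hT hx₁ hk ω).1
  have hx' := (h.mem hR hT hx₁ hk' ω).1
  have hlm0 : 0 ≤ lm := lambdaMax_nonneg hβ
  have h1 : ‖A (x k ω) - y (k + 1) ω‖ ≤ Lg + lm := by
    refine le_trans ?_ (h.rho_mul_norm_le hA1 hβ hcβ hc0 hk ω)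
    exact le_mul_of_one_le_left (norm_nonneg _)
      (one_le_mul_of_one_le_of_one_le hc (one_le_croot hk))
  have h2 : ‖A (x (k + 1) ω - x k ω)‖ ≤ ‖A‖ * Metric.diam M := by
    refine (A.le_opNorm _).trans ?_
    gcongr
    rw [← dist_eq_norm]
    exact Metric.dist_le_diam_of_mem hA1.compact.isBounded hx' hx
  have h3 : ‖A (x (k + 1) ω) - y (k + 1) ω‖ ≤ Lg + lm + ‖A‖ * Metric.diam M := by
    have e1 : A (x (k + 1) ω) - y (k + 1) ω =
        (A (x k ω) - y (k + 1) ω) + A (x (k + 1) ω - x k ω) := by rw [map_sub]; abel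
    rw [e1]
    exact (norm_add_le _ _).trans (add_le_add h1 h2)
  have h4 := (real_inner_le_norm (l (k + 1) ω) (A (x (k + 1) ω) - y (k + 1) ω)).trans
    (mul_le_mul (h.norm_l_le hβ hcβ hk' ω) h3 (norm_nonneg _) hlm0)
  have h5 : sInf (objective P f '' M) ≤ objective P f (x (k + 1) ω) :=
    csInf_le hA1.F_bddBelow ⟨_, hx', rfl⟩
  have h6 : sInf (Set.range g) ≤ g (y (k + 1) ω) := csInf_le hA1.g_bddBelow ⟨_, rfl⟩
  have h7 : 0 ≤ c.ρ (k + 1) / 2 * ‖A (x (k + 1) ω) - y (k + 1) ω‖ ^ 2 := by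
    have := Params.rho_pos hc0 hk'
    positivity
  unfold meritLower augLagrangian
  linarith

end PathwiseDescent

/-! ### Integration over a sample independent of the past. -/

section FreshSample

variable {Ω E Ξ : Type*} [MeasurableSpace Ω] {μ : Measure Ω} [IsProbabilityMeasure μ]
  [MeasurableSpace E] [MeasurableSpace Ξ] {P : Measure Ξ} [IsProbabilityMeasure P]
  {Y : Ω → E} {S : Ω → Ξ}

theorem lintegral_of_indepFun (hY : Measurable Y) (hS : Measurable S) (hP : μ.map S = P)
    (hi : IndepFun Y S μ) {h : E × Ξ → ENNReal} (hh : Measurable h) :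
    ∫⁻ ω, h (Y ω, S ω) ∂μ = ∫⁻ ω, ∫⁻ s, h (Y ω, s) ∂P ∂μ := by
  have := (indepFun_iff_map_prod_eq_prod_map_map hY.aemeasurable hS.aemeasurable).1 hi
  have : IsFiniteMeasure (μ.map Y) := inferInstance
  rw [← lintegral_map hh (hY.prodMk hS), ‹μ.map _ = _›, hP, lintegral_prod _ hh.aemeasurable,
    lintegral_map hh.lintegral_prod_right' hY]

theorem integral_of_indepFun (hY : Measurable Y) (hS : Measurable S) (hP : μ.map S = P)
    (hi : IndepFun Y S μ) {h : E × Ξ → ℝ} (hh : Measurable h)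
    (hint : Integrable (fun ω => h (Y ω, S ω)) μ) :
    ∫ ω, h (Y ω, S ω) ∂μ = ∫ ω, ∫ s, h (Y ω, s) ∂P ∂μ := by
  have hlaw := (indepFun_iff_map_prod_eq_prod_map_map hY.aemeasurable hS.aemeasurable).1 hi
  rw [hP] at hlaw
  have hint' : Integrable h ((μ.map Y).prod P) := by
    rw [← hlaw, integrable_map_measure hh.aestronglyMeasurable (hY.prodMk hS).aemeasurable]
    exact hint
  rw [← integral_map (hY.prodMk hS).aemeasurable hh.aestronglyMeasurable, hlaw,
    integral_prod _ hint', integral_map hY.aemeasurable]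
  exact hh.stronglyMeasurable.integral_prod_right'.aestronglyMeasurable

/-- Second moment and orthogonality of a conditionally centred function of the past `Y` and a fresh
sample `S`. -/
theorem moments_of_indepFun {n : ℕ} (hY : Measurable Y) (hS : Measurable S) (hP : μ.map S = P)
    (hi : IndepFun Y S μ) {Φ : E × Ξ → Euc n} (hΦ : Measurable Φ) {W : E → Euc n}
    (hW : Measurable W) {C : Ω → ℝ} (hC : Integrable C μ)
    (hWi : Integrable (fun ω => ‖W (Y ω)‖ ^ 2) μ)
    (hsq : ∀ ω, Integrable (fun s => ‖Φ (Y ω, s)‖ ^ 2) P)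
    (hle : ∀ ω, ∫ s, ‖Φ (Y ω, s)‖ ^ 2 ∂P ≤ C ω)
    (hint : ∀ ω, Integrable (fun s => Φ (Y ω, s)) P)
    (hzero : ∀ ω, ∫ s, Φ (Y ω, s) ∂P = 0) :
    Integrable (fun ω => ‖Φ (Y ω, S ω)‖ ^ 2) μ ∧
    ∫ ω, ‖Φ (Y ω, S ω)‖ ^ 2 ∂μ ≤ ∫ ω, C ω ∂μ ∧
    Integrable (fun ω => ⟪W (Y ω), Φ (Y ω, S ω)⟫_ℝ) μ ∧
    ∫ ω, ⟪W (Y ω), Φ (Y ω, S ω)⟫_ℝ ∂μ = 0 := by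
  have hΦS : Measurable fun ω => Φ (Y ω, S ω) := hΦ.comp (hY.prodMk hS)
  have hC0 : ∀ ω, 0 ≤ C ω := fun ω => (integral_nonneg fun s => by positivity).trans (hle ω)
  have hn : Measurable fun p : E × Ξ => ENNReal.ofReal (‖Φ p‖ ^ 2) :=
    (hΦ.norm.pow_const 2).ennreal_ofReal
  -- Tonelli comes first: integrability of the square is a conclusion and cannot be assumed here.
  have hlin : ∫⁻ ω, ENNReal.ofReal (‖Φ (Y ω, S ω)‖ ^ 2) ∂μ ≤ ENNReal.ofReal (∫ ω, C ω ∂μ) := by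
    rw [lintegral_of_indepFun hY hS hP hi hn,
      ofReal_integral_eq_lintegral_ofReal hC (Filter.Eventually.of_forall hC0)]
    refine lintegral_mono fun ω => ?_
    rw [← ofReal_integral_eq_lintegral_ofReal (hsq ω)
      (Filter.Eventually.of_forall fun s => by positivity)]
    exact ENNReal.ofReal_le_ofReal (hle ω)
  have hI : Integrable (fun ω => ‖Φ (Y ω, S ω)‖ ^ 2) μ := by
    refine ⟨(hΦS.norm.pow_const 2).aestronglyMeasurable, ?_⟩
    rw [hasFiniteIntegral_iff_ofReal (Filter.Eventually.of_forall fun s => by positivity)]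
    exact hlin.trans_lt ENNReal.ofReal_lt_top
  have hinner : Measurable fun p : E × Ξ => ⟪W p.1, Φ p⟫_ℝ := (hW.comp measurable_fst).inner hΦ
  have hJ : Integrable (fun ω => ⟪W (Y ω), Φ (Y ω, S ω)⟫_ℝ) μ := by
    refine (hWi.add hI).mono' (hinner.comp (hY.prodMk hS)).aestronglyMeasurable
      (Filter.Eventually.of_forall fun ω => ?_)
    have := abs_real_inner_le_norm (W (Y ω)) (Φ (Y ω, S ω))
    rw [Real.norm_eq_abs, Pi.add_apply]
    nlinarith [sq_nonneg (‖W (Y ω)‖ - ‖Φ (Y ω, S ω)‖), sq_nonneg (‖W (Y ω)‖),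
      sq_nonneg ‖Φ (Y ω, S ω)‖]
  refine ⟨hI, ?_, hJ, ?_⟩
  · rw [integral_eq_lintegral_of_nonneg_ae (Filter.Eventually.of_forall fun s => by positivity)
      hI.aestronglyMeasurable]
    exact ENNReal.toReal_le_of_le_ofReal (integral_nonneg hC0) hlin
  · rw [integral_of_indepFun hY hS hP hi hinner hJ]
    simp only [integral_inner (hint _), hzero, inner_zero_right, integral_zero]

/-- Cauchy–Schwarz; it lets a batch obey the single-sample bound, whatever its size. -/
theorem norm_average_sq_le {V : Type*} [NormedAddCommGroup V] [NormedSpace ℝ V] {b : ℕ}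
    (hb : 1 ≤ b) (z : Fin b → V) :
    ‖(b : ℝ)⁻¹ • ∑ i, z i‖ ^ 2 ≤ (b : ℝ)⁻¹ * ∑ i, ‖z i‖ ^ 2 := by
  have hb0 : (0 : ℝ) < b := by exact_mod_cast hb
  have h1 : ‖∑ i, z i‖ ^ 2 ≤ b * ∑ i, ‖z i‖ ^ 2 := by
    calc ‖∑ i, z i‖ ^ 2 ≤ (∑ i, ‖z i‖) ^ 2 := by gcongr; exact norm_sum_le _ _
      _ ≤ (Finset.univ : Finset (Fin b)).card * ∑ i, ‖z i‖ ^ 2 := sq_sum_le_card_mul_sum_sq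
      _ = _ := by simp
  rw [norm_smul, mul_pow, Real.norm_of_nonneg (by positivity)]
  calc (b : ℝ)⁻¹ ^ 2 * ‖∑ i, z i‖ ^ 2 ≤ (b : ℝ)⁻¹ ^ 2 * (b * ∑ i, ‖z i‖ ^ 2) := by gcongr
    _ = _ := by field_simp

end FreshSample

/-! ### Mean and second moment of the estimator noise. -/

section Noise

variable {n d : ℕ} {M : Set (Euc n)} {R : Euc n → Euc n → Euc n}
  {T : Euc n → Euc n → Euc n → Euc n} {Ξ : Type*} [MeasurableSpace Ξ] {P : Measure Ξ}
  {f : Euc n → Ξ → ℝ} {σ Lt : ℝ}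

/-- The noise that one fresh sample `s` contributes to the recursive gradient estimator. -/
noncomputable def noise (P : Measure Ξ) (f : Euc n → Ξ → ℝ) (M : Set (Euc n))
    (R : Euc n → Euc n → Euc n) (T : Euc n → Euc n → Euc n → Euc n) (α : ℝ) (x w : Euc n)
    (s : Ξ) : Euc n :=
  (rgrad M (fun z => f z s) (R x w) - rgrad M (objective P f) (R x w))
    - (1 - α) • T x w (rgrad M (fun z => f z s) x - rgrad M (objective P f) x)

/-- The noise is α times the sampling error at the new point plus 1 - α times a centred gradient
difference. The first has variance at most σ²; the second is controlled by the mean-square Lipschitz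
assumption, as centring does not increase a second moment. -/
theorem noise_moments [IsProbabilityMeasure P] (hR : IsRetraction M R)
    (hT : IsIsometricTransport M R T) (hM : IsSubmanifold d M) (hA2 : Assumption2 P f M σ)
    (hA3 : Assumption3 P f M R T Lt) (α : ℝ) {x w : Euc n} (hx : x ∈ M)
    (hw : w ∈ tangentSpace M x) :
    Integrable (noise P f M R T α x w) P ∧ ∫ s, noise P f M R T α x w s ∂P = 0 ∧
    Integrable (fun s => ‖noise P f M R T α x w s‖ ^ 2) P ∧
    ∫ s, ‖noise P f M R T α x w s‖ ^ 2 ∂P ≤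
      2 * α ^ 2 * σ ^ 2 + 2 * (1 - α) ^ 2 * (Lt ^ 2 * ‖w‖ ^ 2) := by
  have hx' := hR.mem x hx w hw
  set x' := R x w with hx'd
  set F := objective P f with hFd
  set L := hT.clm hx hw with hL
  have hLT : ∀ {u}, u ∈ tangentSpace M x → T x w u = L u := fun hu => (hT.clm_apply hx hw hu).symm
  set a : Ξ → Euc n := fun s => rgrad M (fun z => f z s) x' - rgrad M F x' with ha
  set X : Ξ → Euc n := fun s => rgrad M (fun z => f z s) x' - L (rgrad M (fun z => f z s) x) with hX
  set m : Euc n := rgrad M F x' - L (rgrad M F x) with hm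
  have hnoise : noise P f M R T α x w = fun s => α • a s + (1 - α) • (X s - m) := by
    funext s
    unfold noise
    rw [hLT (Submodule.sub_mem _ (rgrad_mem _ _) (rgrad_mem _ _)), map_sub]
    simp only [ha, hX, hm]
    module
  have hai : Integrable a P := (hA2.integrable x' hx').sub (integrable_const _)
  have hXi : Integrable X P :=
    (hA2.integrable x' hx').sub (L.integrable_comp (hA2.integrable x hx))
  have ha0 : ∫ s, a s ∂P = 0 := by
    rw [ha, integral_sub (hA2.integrable x' hx') (integrable_const _), hA2.unbiased x' hx']
    simp [hFd]
  have hXm : ∫ s, X s ∂P = m := by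
    rw [hX, integral_sub (hA2.integrable x' hx') (L.integrable_comp (hA2.integrable x hx)),
      L.integral_comp_comm (hA2.integrable x hx), hA2.unbiased x' hx', hA2.unbiased x hx]
  have hXn : ∀ s, ‖X s‖ ^ 2 = ‖rgrad M (fun z => f z s) x
      - transportBack M T x w (rgrad M (fun z => f z s) x')‖ ^ 2 := fun s => by
    rw [norm_sub_transportBack hT hR hM hx hw (rgrad_mem _ _) (rgrad_mem _ _), hLT (rgrad_mem _ _)]
  have hX2 : Integrable (fun s => ‖X s‖ ^ 2) P := by
    simp only [hXn]
    exact hA3.sq_integrable x hx w hw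
  have hX2le : ∫ s, ‖X s‖ ^ 2 ∂P ≤ Lt ^ 2 * ‖w‖ ^ 2 := by
    simp only [hXn]
    exact hA3.lipschitz x hx w hw
  have hexp : (fun s => ‖X s - m‖ ^ 2) = fun s => ‖X s‖ ^ 2 - 2 * ⟪m, X s⟫_ℝ + ‖m‖ ^ 2 := by
    funext s
    rw [norm_sub_sq_real, real_inner_comm]
  have hmX : Integrable (fun s => 2 * ⟪m, X s⟫_ℝ) P := (hXi.const_inner m).const_mul 2
  have hXm2 : Integrable (fun s => ‖X s - m‖ ^ 2) P := by
    rw [hexp]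
    exact (hX2.sub hmX).add (integrable_const _)
  have hXm2le : ∫ s, ‖X s - m‖ ^ 2 ∂P ≤ Lt ^ 2 * ‖w‖ ^ 2 := by
    have e1 : ∫ s, ‖X s - m‖ ^ 2 ∂P = ∫ s, ‖X s‖ ^ 2 ∂P - ‖m‖ ^ 2 := by
      have hs : Integrable (fun s => ‖X s‖ ^ 2 - 2 * ⟪m, X s⟫_ℝ) P := hX2.sub hmX
      rw [hexp, integral_add hs (integrable_const _), integral_sub hX2 hmX,
        integral_const_mul, integral_inner hXi, hXm, real_inner_self_eq_norm_sq]
      simp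
      ring
    nlinarith [sq_nonneg ‖m‖]
  have ha2 : Integrable (fun s => ‖a s‖ ^ 2) P := hA2.sq_integrable x' hx'
  have ha2le : ∫ s, ‖a s‖ ^ 2 ∂P ≤ σ ^ 2 := hA2.variance x' hx'
  have hNi : Integrable (noise P f M R T α x w) P := by
    rw [hnoise]
    exact (hai.smul α).add ((hXi.sub (integrable_const m)).smul (1 - α))
  have hbd : ∀ s, ‖noise P f M R T α x w s‖ ^ 2 ≤
      2 * α ^ 2 * ‖a s‖ ^ 2 + 2 * (1 - α) ^ 2 * ‖X s - m‖ ^ 2 := by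
    intro s
    rw [hnoise]
    calc ‖α • a s + (1 - α) • (X s - m)‖ ^ 2 ≤ (‖α • a s‖ + ‖(1 - α) • (X s - m)‖) ^ 2 := by
          gcongr; exact norm_add_le _ _
      _ ≤ 2 * (‖α • a s‖ ^ 2 + ‖(1 - α) • (X s - m)‖ ^ 2) := add_sq_le
      _ = _ := by
          rw [norm_smul, norm_smul, mul_pow, mul_pow, Real.norm_eq_abs, Real.norm_eq_abs, sq_abs,
            sq_abs]
          ring
  have hdom : Integrable
      (fun s => 2 * α ^ 2 * ‖a s‖ ^ 2 + 2 * (1 - α) ^ 2 * ‖X s - m‖ ^ 2) P :=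
    (ha2.const_mul _).add (hXm2.const_mul _)
  have hN2 : Integrable (fun s => ‖noise P f M R T α x w s‖ ^ 2) P :=
    hdom.mono' (hNi.aestronglyMeasurable.norm.pow 2) (Filter.Eventually.of_forall fun s => by
      rw [Real.norm_of_nonneg (by positivity)]
      exact hbd s)
  refine ⟨hNi, ?_, hN2, ?_⟩
  · have hs : Integrable (fun s => α • a s) P := hai.smul α
    have hs' : Integrable (fun s => (1 - α) • (X s - m)) P :=
      (hXi.sub (integrable_const m)).smul (1 - α)
    rw [hnoise, integral_add hs hs', integral_smul, integral_smul,
      integral_sub hXi (integrable_const _), ha0, hXm]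
    simp
  · refine (integral_mono hN2 hdom hbd).trans ?_
    rw [integral_add (ha2.const_mul _) (hXm2.const_mul _), integral_const_mul, integral_const_mul]
    gcongr

theorem measurable_noise {Ω : Type*} [MeasurableSpace Ω] (hf : IsLoss P f) (hR : IsRetraction M R)
    (hT : IsIsometricTransport M R T) (hM : IsSubmanifold d M)
    (hF : ContinuousOn (gradient (objective P f)) M) (α : ℝ) {X W : Ω → Euc n} {S : Ω → Ξ}
    (hX : Measurable X) (hW : Measurable W) (hS : Measurable S) (hXM : ∀ ω, X ω ∈ M)
    (hWT : ∀ ω, W ω ∈ tangentSpace M (X ω)) :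
    Measurable fun ω => noise P f M R T α (X ω) (W ω) (S ω) := by
  have hX' : Measurable fun ω => R (X ω) (W ω) := hR.measurable hX hW hXM hWT
  have hXM' : ∀ ω, R (X ω) (W ω) ∈ M := fun ω => hR.mem _ (hXM ω) _ (hWT ω)
  have h1 := (measurable_rgrad_sample hf hM hX' hXM' hS).sub (measurable_rgrad hM hF hX' hXM')
  have h2 := (measurable_rgrad_sample hf hM hX hXM hS).sub (measurable_rgrad hM hF hX hXM)
  have h3 := hT.measurable hX hW h2 hXM hWT fun ω =>
    Submodule.sub_mem _ (rgrad_mem _ _) (rgrad_mem _ _)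
  exact h1.sub (h3.fun_const_smul (1 - α))

end Noise

/-! ### Recursion for the mean-square error, and square integrability. -/

section ErrorRecursion

variable {n m d : ℕ} {M : Set (Euc n)} {R : Euc n → Euc n → Euc n}
  {T : Euc n → Euc n → Euc n → Euc n} {Ξ : Type*} [MeasurableSpace Ξ] {P : Measure Ξ}
  {f : Euc n → Ξ → ℝ} {g : Euc m → ℝ} {A : Euc n →L[ℝ] Euc m} {c : Params}
  {x₁ : Euc n} {y₁ l₁ : Euc m} {Ω : Type*} {b : ℕ → ℕ} {ξ : (k : ℕ) → Fin (b k) → Ω → Ξ}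
  {x v : ℕ → Ω → Euc n} {y l : ℕ → Ω → Euc m} {LF Lg B σ Lt : ℝ}

/-- The error splits into the transported error and the average noise of the mini-batch. -/
theorem IsMARSADMM.estError_succ (h : IsMARSADMM P f M R T g A c x₁ y₁ l₁ ξ x v y l)
    (hR : IsRetraction M R) (hT : IsIsometricTransport M R T) (hx₁ : x₁ ∈ M) {k : ℕ}
    (hk : 1 ≤ k) (hb : 1 ≤ b (k + 1)) (ω : Ω) :
    estError M (objective P f) x v (k + 1) ω =
      (1 - c.alphaSucc k) • T (x k ω) (-(c.η k • direction M A c x v y l k ω))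
          (estError M (objective P f) x v k ω)
      + (b (k + 1) : ℝ)⁻¹ • ∑ i, noise P f M R T (c.alphaSucc k) (x k ω)
          (-(c.η k • direction M A c x v y l k ω)) (ξ (k + 1) i ω) := by
  obtain ⟨hxM, hv, -⟩ := h.mem hR hT hx₁ hk ω
  have hw := h.step_mem hR hT hx₁ hk ω
  have hb0 : (b (k + 1) : ℝ) ≠ 0 := by exact_mod_cast (by omega)
  have hbs : (b (k + 1) : ℝ)⁻¹ • ∑ _i : Fin (b (k + 1)), rgrad M (objective P f) (x (k + 1) ω) =
      rgrad M (objective P f) (x (k + 1) ω) := by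
    rw [Finset.sum_const, Finset.card_univ, Fintype.card_fin, ← Nat.cast_smul_eq_nsmul ℝ,
      smul_smul, inv_mul_cancel₀ hb0, one_smul]
  have hbs' : (b (k + 1) : ℝ)⁻¹ • ∑ _i : Fin (b (k + 1)), rgrad M (objective P f) (x k ω) =
      rgrad M (objective P f) (x k ω) := by
    rw [Finset.sum_const, Finset.card_univ, Fintype.card_fin, ← Nat.cast_smul_eq_nsmul ℝ,
      smul_smul, inv_mul_cancel₀ hb0, one_smul]
  set w := -(c.η k • direction M A c x v y l k ω) with hwd
  set L := hT.clm hxM hw with hL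
  have hLT : ∀ {u}, u ∈ tangentSpace M (x k ω) → T (x k ω) w u = L u :=
    fun hu => (hT.clm_apply hxM hw hu).symm
  have hnoise : (b (k + 1) : ℝ)⁻¹ • ∑ i, noise P f M R T (c.alphaSucc k) (x k ω) w
      (ξ (k + 1) i ω) = (batchGrad M f (fun i => ξ (k + 1) i ω) (x (k + 1) ω)
        - rgrad M (objective P f) (x (k + 1) ω))
      - (1 - c.alphaSucc k) • L (batchGrad M f (fun i => ξ (k + 1) i ω) (x k ω)
        - rgrad M (objective P f) (x k ω)) := by
    have hstep : R (x k ω) w = x (k + 1) ω := (h.x_step k hk ω).symm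
    simp only [noise, hstep,
      hLT (Submodule.sub_mem _ (rgrad_mem _ _) (rgrad_mem _ _))]
    rw [Finset.sum_sub_distrib, Finset.sum_sub_distrib, smul_sub, smul_sub, hbs,
      ← Finset.smul_sum, ← map_sum, Finset.sum_sub_distrib, smul_comm, ← map_smul L, smul_sub,
      hbs']
    rfl
  rw [hnoise]
  unfold estError
  rw [hLT (Submodule.sub_mem _ hv (rgrad_mem _ _)), h.v_step k hk, ← hwd, hLT (Submodule.sub_mem _ hv (batchGrad_mem _ _))]
  simp only [map_sub]
  module

theorem IsMARSADMM.measurable_estError (h : IsMARSADMM P f M R T g A c x₁ y₁ l₁ ξ x v y l)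
    (hf : IsLoss P f) (hR : IsRetraction M R) (hT : IsIsometricTransport M R T)
    (hA1 : Assumption1 d M (objective P f) g LF Lg) (hc : 0 < c.cρ) (hx₁ : x₁ ∈ M)
    {k : ℕ} (hk : 1 ≤ k) :
    Measurable[sampleSigma ξ k] (estError M (objective P f) x v k) := by
  let _ := sampleSigma ξ k
  obtain ⟨hx, -, hv⟩ := h.measurable hf hR hT hA1.submanifold hA1.convex hc hx₁ hk
  exact hv.sub (measurable_rgrad hA1.submanifold hA1.continuousOn_gradient hx
    fun ω => (h.mem hR hT hx₁ hk ω).1)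

/-- Mean-square recursion of the estimation error. -/
theorem IsMARSADMM.estError_sq_succ_le [IsProbabilityMeasure P] [MeasurableSpace Ω]
    {μ : Measure Ω} [IsProbabilityMeasure μ] (h : IsMARSADMM P f M R T g A c x₁ y₁ l₁ ξ x v y l)
    (hS : IsSampling μ P b ξ) (hf : IsLoss P f) (hR : IsRetraction M R)
    (hT : IsIsometricTransport M R T) (hA1 : Assumption1 d M (objective P f) g LF Lg)
    (hA2 : Assumption2 P f M σ) (hA3 : Assumption3 P f M R T Lt) (hc : 0 < c.cρ)
    (hx₁ : x₁ ∈ M) {k : ℕ} (hk : 1 ≤ k)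
    (he : Integrable (fun ω => ‖estError M (objective P f) x v k ω‖ ^ 2) μ)
    (hG : Integrable (fun ω => ‖direction M A c x v y l k ω‖ ^ 2) μ) :
    Integrable (fun ω => ‖estError M (objective P f) x v (k + 1) ω‖ ^ 2) μ ∧
    ∫ ω, ‖estError M (objective P f) x v (k + 1) ω‖ ^ 2 ∂μ ≤
      (1 - c.alphaSucc k) ^ 2 * ∫ ω, ‖estError M (objective P f) x v k ω‖ ^ 2 ∂μ
      + (2 * c.alphaSucc k ^ 2 * σ ^ 2
        + 2 * (1 - c.alphaSucc k) ^ 2 * (Lt ^ 2 * (c.η k ^ 2 *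
          ∫ ω, ‖direction M A c x v y l k ω‖ ^ 2 ∂μ))) := by
  have hM := hA1.submanifold
  have hk' : 1 ≤ k + 1 := Nat.le_add_left 1 k
  have hb := hS.nonempty (k + 1) hk'
  have hb0 : (b (k + 1) : ℝ) ≠ 0 := by exact_mod_cast (by omega)
  have hmem := fun ω => h.mem hR hT hx₁ hk ω
  have hwT := fun ω => h.step_mem hR hT hx₁ hk ω
  set α := c.alphaSucc k with hα
  set F := objective P f with hF
  set w : Ω → Euc n := fun ω => -(c.η k • direction M A c x v y l k ω) with hw
  set W : Ω → Euc n := fun ω => (1 - α) • T (x k ω) (w ω) (estError M F x v k ω) with hWd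
  have heT : ∀ ω, estError M F x v k ω ∈ tangentSpace M (x k ω) := fun ω =>
    Submodule.sub_mem _ (hmem ω).2.1 (rgrad_mem _ _)
  obtain ⟨hwm, hWm, hxm⟩ : Measurable[sampleSigma ξ k] w ∧ Measurable[sampleSigma ξ k] W ∧
      Measurable[sampleSigma ξ k] (x k) := by
    have hem := h.measurable_estError hf hR hT hA1 hc hx₁ hk
    let _ := sampleSigma ξ k
    obtain ⟨hx, hl, hv⟩ := h.measurable hf hR hT hM hA1.convex hc hx₁ hk
    have hwm : Measurable w :=
      ((h.measurable_direction hR hT hM hA1.convex hc hx₁ hk hx hl hv).const_smul (c.η k)).neg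
    exact ⟨hwm, (hT.measurable hx hwm hem (fun ω => (hmem ω).1) hwT heT).fun_const_smul _, hx⟩
  -- The past is recorded as a point of the bundle, so that the noise is a measurable function on
  -- the whole product space rather than only where (x, w) is admissible.
  let Y : Ω → tangentBundle M × Euc n := fun ω => (⟨(x k ω, w ω), (hmem ω).1, hwT ω⟩, W ω)
  have hYF : Measurable[sampleSigma ξ k] Y := by
    let _ := sampleSigma ξ k
    exact ((hxm.prodMk hwm).subtype_mk).prodMk hWm
  have hY : Measurable Y := hYF.mono (hS.sampleSigma_le k) le_rfl
  let Φ : (tangentBundle M × Euc n) × Ξ → Euc n := fun z =>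
    noise P f M R T α z.1.1.1.1 z.1.1.1.2 z.2
  have hΦ : Measurable Φ := by
    have hz : Measurable fun z : (tangentBundle M × Euc n) × Ξ => (z.1.1 : Euc n × Euc n) :=
      measurable_subtype_coe.comp (measurable_fst.comp measurable_fst)
    exact measurable_noise hf hR hT hM hA1.continuousOn_gradient α (measurable_fst.comp hz)
      (measurable_snd.comp hz) measurable_snd (fun z => z.1.1.2.1) (fun z => z.1.1.2.2)
  -- The isometry makes the contraction factor exactly (1 - α)².
  have hWn : ∀ ω, ‖W ω‖ ^ 2 = (1 - α) ^ 2 * ‖estError M F x v k ω‖ ^ 2 := fun ω => by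
    simp only [hWd]
    rw [norm_smul, mul_pow, Real.norm_eq_abs, sq_abs, hT.norm_eq (hmem ω).1 (hwT ω) (heT ω)]
  have hWi : Integrable (fun ω => ‖W ω‖ ^ 2) μ := by
    simp only [hWn]
    exact he.const_mul _
  have hwn : ∀ ω, ‖w ω‖ ^ 2 = c.η k ^ 2 * ‖direction M A c x v y l k ω‖ ^ 2 := fun ω => by
    simp only [hw]
    rw [norm_neg, norm_smul, mul_pow, Real.norm_eq_abs, sq_abs]
  set C : Ω → ℝ := fun ω => 2 * α ^ 2 * σ ^ 2 + 2 * (1 - α) ^ 2 * (Lt ^ 2 * (c.η k ^ 2 *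
    ‖direction M A c x v y l k ω‖ ^ 2)) with hCd
  have hC' : Integrable (fun ω => 2 * (1 - α) ^ 2 * (Lt ^ 2 * (c.η k ^ 2 *
    ‖direction M A c x v y l k ω‖ ^ 2))) μ := ((hG.const_mul _).const_mul _).const_mul _
  have hC : Integrable C μ := (integrable_const _).add hC'
  have hCint : ∫ ω, C ω ∂μ = 2 * α ^ 2 * σ ^ 2 + 2 * (1 - α) ^ 2 * (Lt ^ 2 * (c.η k ^ 2 *
      ∫ ω, ‖direction M A c x v y l k ω‖ ^ 2 ∂μ)) := by
    simp only [hCd]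
    rw [integral_add (integrable_const _) hC']
    simp only [integral_const_mul, integral_const, probReal_univ, one_smul]
  set Z : Fin (b (k + 1)) → Ω → Euc n :=
    fun i ω => noise P f M R T α (x k ω) (w ω) (ξ (k + 1) i ω) with hZ
  have hmom : ∀ i, Integrable (fun ω => ‖Z i ω‖ ^ 2) μ ∧ ∫ ω, ‖Z i ω‖ ^ 2 ∂μ ≤ ∫ ω, C ω ∂μ ∧
      Integrable (fun ω => ⟪W ω, Z i ω⟫_ℝ) μ ∧ ∫ ω, ⟪W ω, Z i ω⟫_ℝ ∂μ = 0 := by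
    intro i
    have hind : IndepFun Y (ξ (k + 1) i) μ :=
      indep_of_indep_of_le_left (hS.indep_sampleSigma k i) hYF.comap_le
    have hN := fun ω => noise_moments hR hT hM hA2 hA3 α (hmem ω).1 (hwT ω)
    refine moments_of_indepFun (Φ := Φ) (W := Prod.snd) hY (hS.measurable _ _) (hS.law _ _) hind hΦ
      measurable_snd hC hWi (fun ω => (hN ω).2.2.1) (fun ω => ?_) (fun ω => (hN ω).1)
      (fun ω => (hN ω).2.1)
    simp only [hCd, ← hwn]
    exact (hN ω).2.2.2
  have hterm : ∀ i, Integrable (fun ω => 2 * ⟪W ω, Z i ω⟫_ℝ + ‖Z i ω‖ ^ 2) μ := fun i =>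
    ((hmom i).2.2.1.const_mul 2).add (hmom i).1
  have hsum : Integrable (fun ω => (b (k + 1) : ℝ)⁻¹ * ∑ i, (2 * ⟪W ω, Z i ω⟫_ℝ + ‖Z i ω‖ ^ 2)) μ :=
    (integrable_finsetSum _ fun i _ => hterm i).const_mul _
  have hbd : ∀ ω, ‖estError M F x v (k + 1) ω‖ ^ 2 ≤
      ‖W ω‖ ^ 2 + (b (k + 1) : ℝ)⁻¹ * ∑ i, (2 * ⟪W ω, Z i ω⟫_ℝ + ‖Z i ω‖ ^ 2) := by
    intro ω
    rw [h.estError_succ hR hT hx₁ hk hb ω]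
    change ‖W ω + (b (k + 1) : ℝ)⁻¹ • ∑ i, Z i ω‖ ^ 2 ≤ _
    rw [norm_add_sq_real, real_inner_smul_right, inner_sum, Finset.sum_add_distrib,
      ← Finset.mul_sum]
    have := norm_average_sq_le hb fun i => Z i ω
    linarith
  have hdom := hWi.add hsum
  have hint : Integrable (fun ω => ‖estError M F x v (k + 1) ω‖ ^ 2) μ := by
    have hm := (h.measurable_estError hf hR hT hA1 hc hx₁ hk').mono
      (hS.sampleSigma_le (k + 1)) le_rfl
    refine hdom.mono' (hm.norm.pow_const 2).aestronglyMeasurable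
      (Filter.Eventually.of_forall fun ω => ?_)
    rw [Real.norm_of_nonneg (by positivity)]
    exact hbd ω
  refine ⟨hint, (integral_mono hint hdom hbd).trans ?_⟩
  simp only [Pi.add_apply]
  rw [integral_add hWi hsum, integral_const_mul, integral_finsetSum _ fun i _ => hterm i,
    ← hCint]
  simp only [hWn]
  rw [integral_const_mul]
  have hs : ∑ i, ∫ ω, (2 * ⟪W ω, Z i ω⟫_ℝ + ‖Z i ω‖ ^ 2) ∂μ ≤
      ∑ _i : Fin (b (k + 1)), ∫ ω, C ω ∂μ := by
    refine Finset.sum_le_sum fun i _ => ?_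
    rw [integral_add ((hmom i).2.2.1.const_mul 2) (hmom i).1, integral_const_mul,
      (hmom i).2.2.2]
    simpa using (hmom i).2.1
  have hs' : (b (k + 1) : ℝ)⁻¹ * ∑ _i : Fin (b (k + 1)), ∫ ω, C ω ∂μ = ∫ ω, C ω ∂μ := by
    simp [hb0]
  have := mul_le_mul_of_nonneg_left hs (show 0 ≤ (b (k + 1) : ℝ)⁻¹ by positivity)
  linarith

theorem IsMARSADMM.estError_sq_one_le [MeasurableSpace Ω] {μ : Measure Ω}
    (h : IsMARSADMM P f M R T g A c x₁ y₁ l₁ ξ x v y l)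
    (hS : IsSampling μ P b ξ) (hf : IsLoss P f) (hM : IsSubmanifold d M)
    (hA2 : Assumption2 P f M σ) (hx₁ : x₁ ∈ M) :
    Integrable (fun ω => ‖estError M (objective P f) x v 1 ω‖ ^ 2) μ ∧
    ∫ ω, ‖estError M (objective P f) x v 1 ω‖ ^ 2 ∂μ ≤ σ ^ 2 := by
  have hb := hS.nonempty 1 le_rfl
  have hb0 : (b 1 : ℝ) ≠ 0 := by exact_mod_cast (by omega)
  set F := objective P f with hF
  let a : Ξ → Euc n := fun s => rgrad M (fun z => f z s) x₁ - rgrad M F x₁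
  have ham : Measurable a :=
    (measurable_rgrad_sample hf hM measurable_const (fun _ => hx₁) measurable_id).sub_const _
  have ham2 : Measurable fun s => ‖a s‖ ^ 2 := ham.norm.pow_const 2
  have hee : ∀ ω, estError M F x v 1 ω = (b 1 : ℝ)⁻¹ • ∑ i, a (ξ 1 i ω) := by
    intro ω
    unfold estError
    rw [h.v_init, h.x_init]
    simp only [a]
    rw [Finset.sum_sub_distrib, smul_sub, Finset.sum_const, Finset.card_univ, Fintype.card_fin,
      ← Nat.cast_smul_eq_nsmul ℝ, smul_smul, inv_mul_cancel₀ hb0, one_smul]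
    rfl
  have hi : ∀ i, Integrable (fun ω => ‖a (ξ 1 i ω)‖ ^ 2) μ ∧
      ∫ ω, ‖a (ξ 1 i ω)‖ ^ 2 ∂μ ≤ σ ^ 2 := by
    intro i
    have hξ := hS.measurable 1 i
    have hl := hS.law 1 i
    have h1 : Integrable (fun s => ‖a s‖ ^ 2) (μ.map (ξ 1 i)) := by
      rw [hl]; exact hA2.sq_integrable x₁ hx₁
    refine ⟨(integrable_map_measure ham2.aestronglyMeasurable hξ.aemeasurable).1 h1, ?_⟩
    rw [← integral_map (f := fun s => ‖a s‖ ^ 2) hξ.aemeasurable ham2.aestronglyMeasurable, hl]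
    exact hA2.variance x₁ hx₁
  have hdom : Integrable (fun ω => (b 1 : ℝ)⁻¹ * ∑ i, ‖a (ξ 1 i ω)‖ ^ 2) μ :=
    (integrable_finsetSum _ fun i _ => (hi i).1).const_mul _
  have hbd : ∀ ω, ‖estError M F x v 1 ω‖ ^ 2 ≤ (b 1 : ℝ)⁻¹ * ∑ i, ‖a (ξ 1 i ω)‖ ^ 2 := fun ω => by
    rw [hee]
    exact norm_average_sq_le hb _
  have hm : Measurable (estError M F x v 1) := by
    rw [show estError M F x v 1 = _ from funext hee]
    exact (Finset.measurable_sum _ fun i _ => ham.comp (hS.measurable 1 i)).fun_const_smul _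
  have hint : Integrable (fun ω => ‖estError M F x v 1 ω‖ ^ 2) μ :=
    hdom.mono' (hm.norm.pow_const 2).aestronglyMeasurable (Filter.Eventually.of_forall fun ω => by
      rw [Real.norm_of_nonneg (by positivity)]
      exact hbd ω)
  refine ⟨hint, (integral_mono hint hdom hbd).trans ?_⟩
  rw [integral_const_mul, integral_finsetSum _ fun i _ => (hi i).1]
  have hs : ∑ i, ∫ ω, ‖a (ξ 1 i ω)‖ ^ 2 ∂μ ≤ ∑ _i : Fin (b 1), σ ^ 2 :=
    Finset.sum_le_sum fun i _ => (hi i).2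
  have hs' : (b 1 : ℝ)⁻¹ * ∑ _i : Fin (b 1), σ ^ 2 = σ ^ 2 := by simp [hb0]
  rw [← hs']
  gcongr

/-- By `direction_eq` and the multiplier bound, G_k differs from ε_k by a vector of norm at most B +
‖A‖ L_g. -/
theorem IsMARSADMM.integrable_direction_sq [MeasurableSpace Ω] {μ : Measure Ω}
    [IsProbabilityMeasure μ] (h : IsMARSADMM P f M R T g A c x₁ y₁ l₁ ξ x v y l)
    (hS : IsSampling μ P b ξ) (hf : IsLoss P f) (hR : IsRetraction M R)
    (hT : IsIsometricTransport M R T) (hA1 : Assumption1 d M (objective P f) g LF Lg)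
    (hB : ∀ x ∈ M, ‖gradient (objective P f) x‖ ≤ B) (hc : 0 < c.cρ) (hx₁ : x₁ ∈ M) {k : ℕ}
    (hk : 1 ≤ k) (he : Integrable (fun ω => ‖estError M (objective P f) x v k ω‖ ^ 2) μ) :
    Integrable (fun ω => ‖direction M A c x v y l k ω‖ ^ 2) μ := by
  have hle := hS.sampleSigma_le (ξ := ξ) k
  have hm : Measurable (direction M A c x v y l k) := by
    obtain ⟨hx, hl, hv⟩ := h.measurable hf hR hT hA1.submanifold hA1.convex hc hx₁ hk
    exact h.measurable_direction hR hT hA1.submanifold hA1.convex hc hx₁ hk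
      (hx.mono hle le_rfl) (hl.mono hle le_rfl) (hv.mono hle le_rfl)
  have hdom : Integrable (fun ω => 2 * (‖estError M (objective P f) x v k ω‖ ^ 2
      + (B + ‖A‖ * Lg) ^ 2)) μ := (he.add (integrable_const _)).const_mul 2
  refine hdom.mono' (hm.norm.pow_const 2).aestronglyMeasurable
    (Filter.Eventually.of_forall fun ω => ?_)
  rw [Real.norm_of_nonneg (by positivity)]
  refine le_trans ?_ add_sq_le
  gcongr
  rw [direction_eq hc hk (objective P f)]
  refine (norm_add_le _ _).trans ?_
  gcongr
  refine (norm_tangentProj_le _ _).trans ((norm_add_le _ _).trans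
    (add_le_add (hB _ (h.mem hR hT hx₁ hk ω).1) ?_))
  refine (A.adjoint.le_opNorm _).trans ?_
  rw [LinearIsometryEquiv.norm_map]
  gcongr
  exact norm_multiplier_le hA1.convex hA1.g_lipschitz (Params.rho_pos hc hk).le hA1.Lg_nonneg
    (h.y_step k hk ω)

theorem IsMARSADMM.integrable_sq [IsProbabilityMeasure P] [MeasurableSpace Ω]
    {μ : Measure Ω} [IsProbabilityMeasure μ] (h : IsMARSADMM P f M R T g A c x₁ y₁ l₁ ξ x v y l)
    (hS : IsSampling μ P b ξ) (hf : IsLoss P f) (hR : IsRetraction M R)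
    (hT : IsIsometricTransport M R T) (hA1 : Assumption1 d M (objective P f) g LF Lg)
    (hA2 : Assumption2 P f M σ) (hA3 : Assumption3 P f M R T Lt)
    (hB : ∀ x ∈ M, ‖gradient (objective P f) x‖ ≤ B) (hc : 0 < c.cρ) (hx₁ : x₁ ∈ M) {k : ℕ}
    (hk : 1 ≤ k) :
    Integrable (fun ω => ‖estError M (objective P f) x v k ω‖ ^ 2) μ ∧
      Integrable (fun ω => ‖direction M A c x v y l k ω‖ ^ 2) μ := by
  suffices he : Integrable (fun ω => ‖estError M (objective P f) x v k ω‖ ^ 2) μ from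
    ⟨he, h.integrable_direction_sq hS hf hR hT hA1 hB hc hx₁ hk he⟩
  induction k, hk using Nat.le_induction with
  | base => exact (h.estError_sq_one_le hS hf hA1.submanifold hA2 hx₁).1
  | succ k hk ih =>
    exact (h.estError_sq_succ_le hS hf hR hT hA1 hA2 hA3 hc hx₁ hk ih
      (h.integrable_direction_sq hS hf hR hT hA1 hB hc hx₁ hk ih)).1

end ErrorRecursion

/-! ### Bounds for the three series in the final constant. -/

section Sums

/-- Comparison with the telescoping sequence 1/ln(k+1), from ln(k+2) - ln(k+1) ≥ 1/(k+2). The factor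
3 comes from k + 2 ≤ 3k. -/
theorem one_div_mul_log_sq_le {k : ℕ} (hk : 1 ≤ k) :
    1 / ((k : ℝ) * Real.log (k + 2) ^ 2) ≤
      3 * (1 / Real.log (k + 1) - 1 / Real.log (k + 2)) := by
  have hk' : (1 : ℝ) ≤ k := by exact_mod_cast hk
  have h1 : 0 < Real.log ((k : ℝ) + 1) := Real.log_pos (by linarith)
  have h2 : Real.log ((k : ℝ) + 1) ≤ Real.log (k + 2) := Real.log_le_log (by linarith) (by linarith)
  have h3 : 1 / ((k : ℝ) + 2) ≤ Real.log (k + 2) - Real.log (k + 1) := by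
    rw [← Real.log_div (by linarith) (by linarith)]
    refine le_trans (le_of_eq ?_)
      (Real.one_sub_inv_le_log_of_pos (show 0 < ((k : ℝ) + 2) / (k + 1) by positivity))
    field_simp
    ring
  have h4 : 0 < Real.log ((k : ℝ) + 2) := h1.trans_le h2
  have e1 : 1 / Real.log ((k : ℝ) + 1) - 1 / Real.log (k + 2) =
      (Real.log (k + 2) - Real.log (k + 1)) / (Real.log (k + 1) * Real.log (k + 2)) := by
    field_simp
  rw [e1]
  calc 1 / ((k : ℝ) * Real.log (k + 2) ^ 2)
      ≤ 3 * ((1 / ((k : ℝ) + 2)) / (Real.log (k + 2) ^ 2)) := by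
        rw [div_div, mul_one_div, div_le_div_iff₀ (by positivity) (by positivity), one_mul,
          ← mul_assoc]
        gcongr
        linarith
    _ ≤ 3 * ((Real.log (k + 2) - Real.log (k + 1)) /
          (Real.log (k + 1) * Real.log (k + 2))) := by
        rw [sq]
        gcongr

theorem sum_one_div_mul_log_sq_le (K : ℕ) :
    ∑ k ∈ Finset.Icc 1 K, 1 / ((k : ℝ) * Real.log (k + 2) ^ 2) ≤ 3 / Real.log 2 := by
  have key : ∑ k ∈ Finset.Icc 1 K, 1 / ((k : ℝ) * Real.log (k + 2) ^ 2) ≤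
      3 * (1 / Real.log 2 - 1 / Real.log (K + 2)) := by
    induction K with
    | zero => simp
    | succ K ih =>
      rw [Finset.sum_Icc_succ_top (Nat.le_add_left 1 K)]
      have := one_div_mul_log_sq_le (Nat.le_add_left 1 K)
      have e : (((K + 1 : ℕ) : ℝ) + 1) = (K : ℝ) + 2 := by push_cast; ring
      rw [e] at this
      linarith
  have : 0 ≤ 1 / Real.log ((K : ℝ) + 2) :=
    one_div_nonneg.2 (Real.log_nonneg (by linarith [Nat.cast_nonneg (α := ℝ) K]))
  have e : 3 / Real.log 2 = 3 * (1 / Real.log 2) := by ring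
  linarith

theorem sum_croot_pow_four_inv_le (K : ℕ) :
    ∑ k ∈ Finset.Icc 1 K, (croot k ^ 4)⁻¹ ≤ ∑' k : ℕ, (k : ℝ) ^ (-(4 / 3) : ℝ) := by
  simp only [← rpow_neg_four_thirds]
  exact Summable.sum_le_tsum _ (fun k _ => by positivity)
    (Real.summable_nat_rpow.2 (by norm_num))

theorem sum_one_div_le_one_add_log (K : ℕ) :
    ∑ k ∈ Finset.Icc 1 K, 1 / (k : ℝ) ≤ 1 + Real.log K := by
  have := harmonic_le_one_add_log K
  rw [harmonic_eq_sum_Icc] at this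
  push_cast at this
  simpa using this

end Sums

/-! ### Weighted summation of the error recursion. -/

section ErrorSum

/-- The scalar estimate behind the decrease of the weighted mean-square error after the first
iteration; `κ` and `w` are consecutive cube roots. -/
theorem error_coefficient_le {κ w cα : ℝ} (hw : 1 ≤ w) (hκw : w ≤ κ) (hκ2 : 2 ≤ κ ^ 3)
    (h1 : (κ - w) * (κ ^ 2 + κ * w + w ^ 2) = 1) (hα : 0.8 ≤ cα) (hα1 : cα ≤ 1) :
    κ * (1 - cα / κ ^ 2) ^ 2 - w + 1 / 4 / κ ≤ -(cα / 2 / κ) := by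
  have hκ0 : 0 < κ := by linarith
  -- A rational lower bound for the cube root of 2, giving 1/κ² ≤ 0.64.
  have hκ54 : 5 / 4 ≤ κ := by
    by_contra hcon
    push Not at hcon
    have : κ ^ 3 < (5 / 4) ^ 3 := pow_lt_pow_left₀ hcon hκ0.le (by norm_num)
    norm_num at this
    linarith
  have h2 : κ * (κ - w) ≤ 1 / 3 := by
    have h3 : 3 * κ ≤ κ ^ 2 + κ * w + w ^ 2 := by nlinarith [sq_nonneg (κ - 1)]
    have h4 := mul_le_mul_of_nonneg_left h3 (sub_nonneg.2 hκw)
    linarith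
  have h5 : cα ^ 2 / κ ^ 2 ≤ 0.64 * cα := by
    rw [div_le_iff₀ (by positivity)]
    have : (25 / 16 : ℝ) ≤ κ ^ 2 := by nlinarith
    nlinarith
  -- After multiplication by κ the claim follows from 1/3 + 1/4 ≤ (2 - 0.64 - 1/2) c_α, which holds
  -- for c_α ≥ 0.8.
  have h6 : κ * (κ * (1 - cα / κ ^ 2) ^ 2 - w + 1 / 4 / κ) =
      κ * (κ - w) - 2 * cα + cα ^ 2 / κ ^ 2 + 1 / 4 := by
    field_simp
    ring
  have h7 : κ * -(cα / 2 / κ) = -(cα / 2) := by field_simp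
  refine le_of_mul_le_mul_left ?_ hκ0
  rw [h6, h7]
  norm_num at hα h5
  linarith

variable {cρ cα cη cγ σ Lt : ℝ} {e G : ℕ → ℝ}

/-- One step of the weighted recursion for the mean-square error. -/
theorem weighted_error_step_le (hα : 0.8 ≤ cα) (hα1 : cα ≤ 1) (hγ : 0 < cγ) (hγρ : cγ ≤ cρ)
    (hη : 0 < cη) (hLt : cη * cρ * (8 * Lt ^ 2) ≤ 1) {κ e₀ e₁ G₀ : ℝ} (hκ : 1 ≤ κ)
    (hG : 0 ≤ G₀)
    (hrec : e₁ ≤ (1 - cα / κ ^ 2) ^ 2 * e₀ + (2 * (cα / κ ^ 2) ^ 2 * σ ^ 2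
      + 2 * (1 - cα / κ ^ 2) ^ 2 * (Lt ^ 2 * ((cη / κ) ^ 2 * G₀)))) :
    cγ * κ * e₁ ≤ cγ * κ * (1 - cα / κ ^ 2) ^ 2 * e₀ + 2 * cγ * cα ^ 2 * σ ^ 2 * (1 / κ ^ 3)
      + (1 / 4 - 1 / (8 * κ ^ 2)) * (cη / κ) * G₀ := by
  have hκ0 : 0 < κ := by linarith
  have hηκ : 0 < cη / κ := by positivity
  have h1 := mul_le_mul_of_nonneg_left hrec (show 0 ≤ cγ * κ by positivity)
  have e1 : cγ * κ * (2 * (cα / κ ^ 2) ^ 2 * σ ^ 2) = 2 * cγ * cα ^ 2 * σ ^ 2 * (1 / κ ^ 3) := by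
    field_simp
  have e2 : cγ * κ * (2 * (1 - cα / κ ^ 2) ^ 2 * (Lt ^ 2 * ((cη / κ) ^ 2 * G₀))) =
      (2 * cγ * cη * Lt ^ 2) * (1 - cα / κ ^ 2) ^ 2 * ((cη / κ) * G₀) := by
    field_simp
  have h2 : 2 * cγ * cη * Lt ^ 2 ≤ 1 / 4 := by
    have := mul_le_mul_of_nonneg_right hγρ (show 0 ≤ cη * Lt ^ 2 by positivity)
    linarith
  have hκ2 : 1 ≤ κ ^ 2 := one_le_pow₀ hκ
  set α := cα / κ ^ 2 with hαd
  have hκi : 0 < (κ ^ 2)⁻¹ := by positivity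
  have hα0 : 4 / 5 * (κ ^ 2)⁻¹ ≤ α := by
    rw [hαd, div_eq_mul_inv cα]
    norm_num at hα
    gcongr
  have hα1' : α ≤ 1 := by
    rw [hαd, div_le_one (by positivity)]; linarith
  -- With α ≥ (4/5)κ⁻² the momentum factor saves at least κ⁻²/5 of the quarter, more than the κ⁻²/8
  -- lost in the descent step.
  have h3 : (1 - α) ^ 2 ≤ 1 - α := by nlinarith
  have e3 : 1 / (8 * κ ^ 2) = 1 / 8 * (κ ^ 2)⁻¹ := by field_simp
  have h4 : 2 * cγ * cη * Lt ^ 2 * (1 - α) ^ 2 ≤ 1 / 4 - 1 / (8 * κ ^ 2) := by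
    have := mul_le_mul_of_nonneg_right h2 (sq_nonneg (1 - α))
    rw [e3]
    linarith
  have h5 := mul_le_mul_of_nonneg_right h4 (show 0 ≤ cη / κ * G₀ by positivity)
  linarith

/-- Summation of the weighted recursion for the mean-square error. -/
theorem weighted_error_sum_le (hα : 0.8 ≤ cα) (hα1 : cα ≤ 1) (hγ : 0 < cγ) (hγρ : cγ ≤ cρ)
    (hη : 0 < cη) (hηγ : 8 * cη ≤ cγ) (hLt : cη * cρ * (8 * Lt ^ 2) ≤ 1)
    (he : ∀ k, 0 ≤ e k) (hG : ∀ k, 0 ≤ G k) (he1 : e 1 ≤ σ ^ 2)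
    (hrec : ∀ k, 1 ≤ k → e (k + 1) ≤ (1 - cα / croot k ^ 2) ^ 2 * e k
      + (2 * (cα / croot k ^ 2) ^ 2 * σ ^ 2
        + 2 * (1 - cα / croot k ^ 2) ^ 2 * (Lt ^ 2 * ((cη / croot k) ^ 2 * G k))))
    {K : ℕ} (hK : 1 ≤ K) :
    ∑ k ∈ Finset.Icc 1 K, (cα * cγ / 2 * (croot k)⁻¹ * e k + cη / 8 * (croot k)⁻¹ * G k
        + 2 * (cη / croot k) * e k
        - (3 / 8 - 1 / (8 * croot k ^ 2)) * (cη / croot k) * G k)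
      + cγ * croot K * e (K + 1) ≤
      cγ * σ ^ 2 + 2 * cγ * cα ^ 2 * σ ^ 2 * ∑ k ∈ Finset.Icc 1 K, 1 / (k : ℝ) := by
  have hstep := fun k (hk : 1 ≤ k) => weighted_error_step_le hα hα1 hγ hγρ hη hLt
    (one_le_croot hk) (hG k) (hrec k hk)
  induction K, hK using Nat.le_induction with
  | base =>
    have h1 := hstep 1 le_rfl
    have hc1 : croot 1 = 1 := by simp [croot]
    simp only [hc1, Finset.Icc_self, Finset.sum_singleton, Nat.cast_one] at h1 ⊢
    -- As γ_1 = 0 there is no decrease to draw on at k = 1, so the initial variance pays: 1/2 + 1/4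
    -- + 1/25 ≤ 1 in units of c_γ.
    have h2 : cα * cγ / 2 + 2 * cη + cγ * (1 - cα) ^ 2 ≤ cγ := by
      norm_num at hα
      have h3 : (1 - cα) ^ 2 ≤ 1 / 25 := by nlinarith
      nlinarith [mul_le_mul_of_nonneg_left h3 hγ.le, mul_le_mul_of_nonneg_left hα1 hγ.le]
    have h3 := mul_le_mul_of_nonneg_right h2 (he 1)
    have h4 := mul_le_mul_of_nonneg_left he1 hγ.le
    norm_num at h1 ⊢
    linarith
  | succ k hk ih =>
    rw [Finset.sum_Icc_succ_top (Nat.le_add_left 1 k), Finset.sum_Icc_succ_top (Nat.le_add_left 1 k)]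
    have h1 := hstep (k + 1) (Nat.le_add_left 1 k)
    rw [croot_pow_three] at h1
    set κ := croot (k + 1) with hκ
    have hκ1 : 1 ≤ κ := one_le_croot (Nat.le_add_left 1 k)
    have hcoef := error_coefficient_le (one_le_croot hk) (croot_le_croot_succ k)
      (by rw [croot_pow_three]; push_cast; have : (1 : ℝ) ≤ k := by exact_mod_cast hk
          linarith) (croot_succ_sub_mul k) hα hα1
    rw [← hκ] at hcoef
    -- The error term of the descent step uses the reserve 1/4/κ built into `error_coefficient_le`.
    have hη' : 2 * (cη / κ) ≤ cγ * (1 / 4 / κ) := by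
      have hdiv : 8 * cη / κ ≤ cγ / κ := by gcongr
      have e1 : 2 * (cη / κ) = 8 * cη / κ / 4 := by ring
      have e2 : cγ * (1 / 4 / κ) = cγ / κ / 4 := by ring
      rw [e1, e2]
      linarith
    have h2 := mul_le_mul_of_nonneg_left hcoef hγ.le
    have h3 : cγ * κ * (1 - cα / κ ^ 2) ^ 2 - cγ * croot k + 2 * (cη / κ)
        + cα * cγ / 2 * κ⁻¹ ≤ 0 := by
      have e1 : cγ * -(cα / 2 / κ) = -(cα * cγ / 2 * κ⁻¹) := by ring
      rw [e1] at h2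
      linarith
    have h4 := mul_le_mul_of_nonneg_right h3 (he (k + 1))
    have e2 : cη / 8 * κ⁻¹ * G (k + 1) = 1 / 8 * (cη / κ) * G (k + 1) := by ring
    rw [e2]
    linarith

end ErrorSum

/-! ### Combination of descent and error bounds. -/

section Main

variable {n m d : ℕ} {M : Set (Euc n)} {R : Euc n → Euc n → Euc n}
  {T : Euc n → Euc n → Euc n → Euc n} {Ξ : Type*} [MeasurableSpace Ξ] {P : Measure Ξ}
  {f : Euc n → Ξ → ℝ} {g : Euc m → ℝ} {A : Euc n →L[ℝ] Euc m} {c : Params}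
  {x₁ : Euc n} {y₁ l₁ : Euc m} {Ω : Type*} {b : ℕ → ℕ} {ξ : (k : ℕ) → Fin (b k) → Ω → Ξ}
  {x v : ℕ → Ω → Euc n} {y l : ℕ → Ω → Euc m} {LF Lg p q B cγ Lt σ : ℝ}

theorem Assumption1.exists_gradient_bound {F : Euc n → ℝ} (h : Assumption1 d M F g LF Lg) :
    ∃ B : ℝ, ∀ x ∈ M, ‖gradient F x‖ ≤ B :=
  h.compact.exists_bound_of_continuousOn h.continuousOn_gradient

/-- 8c_η ≤ c_η c_ρ c_γ ≤ c_γ, by 8 ≤ c_ρ c_γ and c_η c_ρ ≤ 1. -/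
theorem Admissible.eight_mul_cη_le {a S : ℝ} (h : Admissible c cγ a p S Lt) (hS : 0 ≤ S) :
    8 * c.cη ≤ cγ := by
  have h1 := h.smooth
  have hη := h.cη_pos
  have hρ := zero_lt_one.trans_le h.one_le_cρ
  have h2 : c.cη * c.cρ ≤ 1 := by nlinarith [mul_nonneg (mul_pos hη hρ).le hS]
  nlinarith [mul_le_mul_of_nonneg_left h.le_cρ_mul_cγ hη.le,
    mul_le_mul_of_nonneg_right h2 h.cγ_pos.le]

/-- Telescoped decrease of the augmented Lagrangian along a sample path. -/
theorem IsMARSADMM.lagrangian_sum_le (h : IsMARSADMM P f M R T g A c x₁ y₁ l₁ ξ x v y l)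
    (hA1 : Assumption1 d M (objective P f) g LF Lg) (hR : IsRetraction M R)
    (hT : IsIsometricTransport M R T) (hpq : RetractionBounds M R p q)
    (hB : ∀ x ∈ M, ‖gradient (objective P f) x‖ ≤ B) (hx₁ : x₁ ∈ M)
    (had : Admissible c cγ ‖A‖ p (smoothConst ‖A‖ (Metric.diam M) B LF Lg
      (lambdaMax A c.β₁ x₁ y₁ l₁) p q) Lt) (K : ℕ) (ω : Ω) :
    augLagrangian (objective P f) g A (c.ρ (K + 1)) (x (K + 1) ω) (y (K + 1) ω) (l (K + 1) ω) ≤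
      augLagrangian (objective P f) g A (c.ρ 1) x₁ y₁ l₁
      + ∑ k ∈ Finset.Icc 1 K, (2 * (c.cη / croot k) * ‖estError M (objective P f) x v k ω‖ ^ 2
          - (3 / 8 - 1 / (8 * croot k ^ 2)) * (c.cη / croot k)
            * ‖direction M A c x v y l k ω‖ ^ 2)
      + (∑ k ∈ Finset.Icc 1 K, (1 / (3 * c.cρ) * (croot k ^ 4)⁻¹
          + 2 * c.cβ / c.cρ ^ 2 * (1 / (k * Real.log (k + 2) ^ 2))))
        * (Lg + lambdaMax A c.β₁ x₁ y₁ l₁) ^ 2 := by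
  induction K with
  | zero => simp [h.x_init, h.y_init, h.l_init]
  | succ K ih =>
    rw [Finset.sum_Icc_succ_top (Nat.le_add_left 1 K), Finset.sum_Icc_succ_top (Nat.le_add_left 1 K)]
    have := h.lagrangian_step_le hA1 hR hT hpq hB hx₁ had (Nat.le_add_left 1 K) ω
    rw [croot_pow_three] at this
    linarith

/-- Telescoped expected decrease of the augmented Lagrangian. -/
theorem IsMARSADMM.expected_descent [MeasurableSpace Ω] {μ : Measure Ω} [IsProbabilityMeasure μ]
    (h : IsMARSADMM P f M R T g A c x₁ y₁ l₁ ξ x v y l)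
    (hA1 : Assumption1 d M (objective P f) g LF Lg) (hR : IsRetraction M R)
    (hT : IsIsometricTransport M R T) (hpq : RetractionBounds M R p q)
    (hB : ∀ x ∈ M, ‖gradient (objective P f) x‖ ≤ B) (hx₁ : x₁ ∈ M)
    (had : Admissible c cγ ‖A‖ p (smoothConst ‖A‖ (Metric.diam M) B LF Lg
      (lambdaMax A c.β₁ x₁ y₁ l₁) p q) Lt)
    (hint : ∀ k, 1 ≤ k → Integrable (fun ω => ‖estError M (objective P f) x v k ω‖ ^ 2) μ ∧
      Integrable (fun ω => ‖direction M A c x v y l k ω‖ ^ 2) μ) {K : ℕ} (hK : 1 ≤ K) :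
    meritLower M (objective P f) g A Lg (lambdaMax A c.β₁ x₁ y₁ l₁) ≤
      augLagrangian (objective P f) g A (c.ρ 1) x₁ y₁ l₁
      + ∑ k ∈ Finset.Icc 1 K, (2 * (c.cη / croot k)
            * ∫ ω, ‖estError M (objective P f) x v k ω‖ ^ 2 ∂μ
          - (3 / 8 - 1 / (8 * croot k ^ 2)) * (c.cη / croot k)
            * ∫ ω, ‖direction M A c x v y l k ω‖ ^ 2 ∂μ)
      + (∑ k ∈ Finset.Icc 1 K, (1 / (3 * c.cρ) * (croot k ^ 4)⁻¹
          + 2 * c.cβ / c.cρ ^ 2 * (1 / (k * Real.log (k + 2) ^ 2))))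
        * (Lg + lambdaMax A c.β₁ x₁ y₁ l₁) ^ 2 := by
  have hterm : ∀ k ∈ Finset.Icc 1 K, Integrable (fun ω =>
      2 * (c.cη / croot k) * ‖estError M (objective P f) x v k ω‖ ^ 2
        - (3 / 8 - 1 / (8 * croot k ^ 2)) * (c.cη / croot k)
          * ‖direction M A c x v y l k ω‖ ^ 2) μ := fun k hk => by
    have := hint k (Finset.mem_Icc.1 hk).1
    exact (this.1.const_mul _).sub (this.2.const_mul _)
  have hsum : ∫ ω, ∑ k ∈ Finset.Icc 1 K,
      (2 * (c.cη / croot k) * ‖estError M (objective P f) x v k ω‖ ^ 2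
        - (3 / 8 - 1 / (8 * croot k ^ 2)) * (c.cη / croot k)
          * ‖direction M A c x v y l k ω‖ ^ 2) ∂μ =
      ∑ k ∈ Finset.Icc 1 K, (2 * (c.cη / croot k)
            * ∫ ω, ‖estError M (objective P f) x v k ω‖ ^ 2 ∂μ
          - (3 / 8 - 1 / (8 * croot k ^ 2)) * (c.cη / croot k)
            * ∫ ω, ‖direction M A c x v y l k ω‖ ^ 2 ∂μ) := by
    rw [integral_finsetSum _ hterm]
    refine Finset.sum_congr rfl fun k hk => ?_
    have := hint k (Finset.mem_Icc.1 hk).1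
    rw [integral_sub (this.1.const_mul _) (this.2.const_mul _), integral_const_mul,
      integral_const_mul]
  rw [← hsum]
  set E := (∑ k ∈ Finset.Icc 1 K, (1 / (3 * c.cρ) * (croot k ^ 4)⁻¹
          + 2 * c.cβ / c.cρ ^ 2 * (1 / (k * Real.log (k + 2) ^ 2))))
        * (Lg + lambdaMax A c.β₁ x₁ y₁ l₁) ^ 2 with hE
  set L₁ := augLagrangian (objective P f) g A (c.ρ 1) x₁ y₁ l₁ with hL₁
  set m₀ := meritLower M (objective P f) g A Lg (lambdaMax A c.β₁ x₁ y₁ l₁) with hm₀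
  -- The final Lagrangian value is replaced by its lower bound before integrating, so only ‖ε_k‖²
  -- and ‖G_k‖² need to be integrable.
  have hpt : ∀ ω, m₀ - L₁ - E ≤ ∑ k ∈ Finset.Icc 1 K,
      (2 * (c.cη / croot k) * ‖estError M (objective P f) x v k ω‖ ^ 2
        - (3 / 8 - 1 / (8 * croot k ^ 2)) * (c.cη / croot k)
          * ‖direction M A c x v y l k ω‖ ^ 2) := fun ω => by
    have h1 := h.lagrangian_sum_le hA1 hR hT hpq hB hx₁ had K ω
    have h2 := h.meritLower_le hA1 hR hT hx₁ had.β₁_nonneg had.cβ_pos.le had.one_le_cρ hK ω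
    linarith
  have := integral_mono (integrable_const (μ := μ) (m₀ - L₁ - E))
    (integrable_finsetSum _ hterm) hpt
  rw [integral_const, probReal_univ, one_smul] at this
  linarith

/-- The start is deterministic and γ_1 = 0, because 0^{1/3} = 0. -/
theorem IsMARSADMM.merit_one [MeasurableSpace Ω] {μ : Measure Ω} [IsProbabilityMeasure μ]
    (h : IsMARSADMM P f M R T g A c x₁ y₁ l₁ ξ x v y l) :
    merit μ M (objective P f) g A c cγ x v y l 1 =
      augLagrangian (objective P f) g A (c.ρ 1) x₁ y₁ l₁ := by
  unfold merit
  simp [h.x_init, h.y_init, h.l_init]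

/-- The bound on the weighted sums of the mean-square errors and directions. -/
theorem IsMARSADMM.sum_le [IsProbabilityMeasure P] [MeasurableSpace Ω] {μ : Measure Ω}
    [IsProbabilityMeasure μ]
    (h : IsMARSADMM P f M R T g A c x₁ y₁ l₁ ξ x v y l) (hS : IsSampling μ P b ξ)
    (hf : IsLoss P f) (hA1 : Assumption1 d M (objective P f) g LF Lg)
    (hA2 : Assumption2 P f M σ) (hA3 : Assumption3 P f M R T Lt) (hR : IsRetraction M R)
    (hT : IsIsometricTransport M R T) (hpq : RetractionBounds M R p q)
    (hB : ∀ x ∈ M, ‖gradient (objective P f) x‖ ≤ B) (hx₁ : x₁ ∈ M)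
    (had : Admissible c cγ ‖A‖ p (smoothConst ‖A‖ (Metric.diam M) B LF Lg
      (lambdaMax A c.β₁ x₁ y₁ l₁) p q) Lt) {K : ℕ} (hK : 1 ≤ K) :
    (∑ k ∈ Finset.Icc 1 K, c.cα * cγ / 2 * (k : ℝ) ^ (-(1 / 3) : ℝ)
        * (∫ ω, ‖estError M (objective P f) x v k ω‖ ^ 2 ∂μ))
      + (∑ k ∈ Finset.Icc 1 K, c.cη / 8 * (k : ℝ) ^ (-(1 / 3) : ℝ)
        * (∫ ω, ‖direction M A c x v y l k ω‖ ^ 2 ∂μ))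
    ≤ merit μ M (objective P f) g A c cγ x v y l 1
        - meritLower M (objective P f) g A Lg (lambdaMax A c.β₁ x₁ y₁ l₁)
      + 2 * cγ * c.cα ^ 2 * σ ^ 2 * Real.log K
      + ((∑' k : ℕ, (k : ℝ) ^ (-(4 / 3) : ℝ)) / (3 * c.cρ)
          + 2 * c.cβ * (3 / Real.log 2) / c.cρ ^ 2)
        * (Lg + lambdaMax A c.β₁ x₁ y₁ l₁) ^ 2
      + 3 * cγ * σ ^ 2 := by
  have hρ0 : 0 < c.cρ := zero_lt_one.trans_le had.one_le_cρ
  have hlm0 : 0 ≤ lambdaMax A c.β₁ x₁ y₁ l₁ := lambdaMax_nonneg had.β₁_nonneg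
  have hint := fun k (hk : 1 ≤ k) => h.integrable_sq hS hf hR hT hA1 hA2 hA3 hB hρ0 hx₁ hk
  have hB0 : 0 ≤ B := (norm_nonneg _).trans (hB x₁ hx₁)
  have hsm : 0 ≤ smoothConst ‖A‖ (Metric.diam M) B LF Lg (lambdaMax A c.β₁ x₁ y₁ l₁) p q := by
    have h1 := hA1.LF_nonneg
    have h2 := hA1.Lg_nonneg
    have h3 := hpq.2.1
    have h4 : 0 ≤ Metric.diam M := Metric.diam_nonneg
    unfold smoothConst Theta
    positivity
  have herr := weighted_error_sum_le
    (e := fun k => ∫ ω, ‖estError M (objective P f) x v k ω‖ ^ 2 ∂μ)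
    (G := fun k => ∫ ω, ‖direction M A c x v y l k ω‖ ^ 2 ∂μ)
    had.cα_lower had.cα_le had.cγ_pos had.cγ_le had.cη_pos (had.eight_mul_cη_le hsm) had.transport
    (fun k => integral_nonneg fun ω => by positivity)
    (fun k => integral_nonneg fun ω => by positivity)
    (h.estError_sq_one_le hS hf hA1.submanifold hA2 hx₁).2
    (fun k hk => by
      have := (h.estError_sq_succ_le hS hf hR hT hA1 hA2 hA3 hρ0 hx₁ hk (hint k hk).1
        (hint k hk).2).2
      rwa [Params.alphaSucc_eq, Params.eta_eq] at this) hK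
  have hlast : 0 ≤ cγ * croot K * ∫ ω, ‖estError M (objective P f) x v (K + 1) ω‖ ^ 2 ∂μ :=
    mul_nonneg (mul_nonneg had.cγ_pos.le (croot_pos hK).le)
      (integral_nonneg fun ω => by positivity)
  have hpen : (∑ k ∈ Finset.Icc 1 K, (1 / (3 * c.cρ) * (croot k ^ 4)⁻¹
        + 2 * c.cβ / c.cρ ^ 2 * (1 / (k * Real.log (k + 2) ^ 2))))
        * (Lg + lambdaMax A c.β₁ x₁ y₁ l₁) ^ 2 ≤
      ((∑' k : ℕ, (k : ℝ) ^ (-(4 / 3) : ℝ)) / (3 * c.cρ)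
          + 2 * c.cβ * (3 / Real.log 2) / c.cρ ^ 2)
        * (Lg + lambdaMax A c.β₁ x₁ y₁ l₁) ^ 2 := by
    refine mul_le_mul_of_nonneg_right ?_ (sq_nonneg _)
    rw [Finset.sum_add_distrib, ← Finset.mul_sum, ← Finset.mul_sum]
    have hβ := had.cβ_pos
    have h1 := mul_le_mul_of_nonneg_left (sum_croot_pow_four_inv_le K)
      (show 0 ≤ 1 / (3 * c.cρ) by positivity)
    have h2 := mul_le_mul_of_nonneg_left (sum_one_div_mul_log_sq_le K)
      (show 0 ≤ 2 * c.cβ / c.cρ ^ 2 by positivity)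
    refine (add_le_add h1 h2).trans (le_of_eq ?_)
    ring
  -- The 1 in the harmonic bound 1 + ln K costs 2c_γ c_α² σ² ≤ 2c_γ σ²; with c_γ σ² from ε_1 this
  -- makes the factor 3.
  have hα2 : c.cα ^ 2 ≤ 1 := by
    have := had.cα_lower
    norm_num at this
    exact pow_le_one₀ (by linarith) had.cα_le
  have hγσ : 0 ≤ cγ * σ ^ 2 := mul_nonneg had.cγ_pos.le (sq_nonneg σ)
  have hharm := mul_le_mul_of_nonneg_left (sum_one_div_le_one_add_log K)
    (show 0 ≤ 2 * cγ * c.cα ^ 2 * σ ^ 2 by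
      have := had.cγ_pos
      positivity)
  have hα3 := mul_le_mul_of_nonneg_left hα2 hγσ
  rw [h.merit_one]
  simp only [rpow_neg_third]
  have hdesc := (h.expected_descent hA1 hR hT hpq hB hx₁ had hint hK).trans (add_le_add le_rfl hpen)
  simp only [Finset.sum_sub_distrib, Finset.sum_add_distrib] at herr hdesc
  linarith

end Main

end MARS

theorem mainTheorem2 :
    ∃ C₁ C₂ C₃ : ℝ,
      ∀ (n m d : ℕ) (M : Set (MARS.Euc n)) (R : MARS.Euc n → MARS.Euc n → MARS.Euc n)
        (T : MARS.Euc n → MARS.Euc n → MARS.Euc n → MARS.Euc n)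
        (Ξ : Type*) [MeasurableSpace Ξ] (P : Measure Ξ) [IsProbabilityMeasure P]
        (f : MARS.Euc n → Ξ → ℝ) (g : MARS.Euc m → ℝ) (A : MARS.Euc n →L[ℝ] MARS.Euc m)
        (LF Lg σ Lt : ℝ),
      MARS.IsRetraction M R →
      MARS.IsIsometricTransport M R T →
      MARS.IsLoss P f →
      MARS.Assumption1 d M (MARS.objective P f) g LF Lg →
      MARS.Assumption2 P f M σ →
      MARS.Assumption3 P f M R T Lt →
      -- the constants `p`, `q`, `B` exist
      (∃ p q B : ℝ, MARS.RetractionBounds M R p q ∧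
        ∀ x ∈ M, ‖gradient (MARS.objective P f) x‖ ≤ B) ∧
      -- and for every choice of them the bound holds
      ∀ p q B : ℝ, MARS.RetractionBounds M R p q →
        (∀ x ∈ M, ‖gradient (MARS.objective P f) x‖ ≤ B) →
      ∀ (c : MARS.Params) (cν cγ : ℝ) (x₁ : MARS.Euc n) (y₁ l₁ : MARS.Euc m),
        x₁ ∈ M →
        0 < c.β₁ →
        2 * Real.sqrt 2 ≤ c.cρ →
        0.8 ≤ c.cα → c.cα ≤ 1 →
        0 < c.cβ → c.cβ ≤ c.cρ / 3 →
        0 < cν → cν ≤ c.cρ →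
        0 < cγ → cγ ≤ c.cρ →
        8 ≤ cν * cγ →
        0 < c.cη →
        c.cη * c.cρ * (8 * p ^ 2 * ‖A‖ ^ 2) ≤ 1 →
        c.cη * c.cρ * (1 + MARS.smoothConst ‖A‖ (Metric.diam M) B LF Lg
          (MARS.lambdaMax A c.β₁ x₁ y₁ l₁) p q) ≤ 1 →
        c.cη * c.cρ * (8 * Lt ^ 2) ≤ 1 →
      ∀ (Ω : Type*) [MeasurableSpace Ω] (μ : Measure Ω) [IsProbabilityMeasure μ]
        (b : ℕ → ℕ) (ξ : (k : ℕ) → Fin (b k) → Ω → Ξ)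
        (x v : ℕ → Ω → MARS.Euc n) (y l : ℕ → Ω → MARS.Euc m),
        MARS.IsSampling μ P b ξ →
        MARS.IsMARSADMM P f M R T g A c x₁ y₁ l₁ ξ x v y l →
      (∀ k : ℕ, 1 ≤ k →
        Integrable (fun ω => ‖MARS.estError M (MARS.objective P f) x v k ω‖ ^ 2) μ ∧
        Integrable (fun ω => ‖MARS.direction M A c x v y l k ω‖ ^ 2) μ) ∧
      ∀ K : ℕ, 1 ≤ K →
        (∑ k ∈ Finset.Icc 1 K, c.cα * cγ / 2 * (k : ℝ) ^ (-(1 / 3) : ℝ)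
            * (∫ ω, ‖MARS.estError M (MARS.objective P f) x v k ω‖ ^ 2 ∂μ))
          + (∑ k ∈ Finset.Icc 1 K, c.cη / 8 * (k : ℝ) ^ (-(1 / 3) : ℝ)
            * (∫ ω, ‖MARS.direction M A c x v y l k ω‖ ^ 2 ∂μ))
        ≤ MARS.merit μ M (MARS.objective P f) g A c cγ x v y l 1
            - MARS.meritLower M (MARS.objective P f) g A Lg (MARS.lambdaMax A c.β₁ x₁ y₁ l₁)
          + 2 * cγ * c.cα ^ 2 * σ ^ 2 * Real.log K
          + (C₁ / (3 * c.cρ) + 2 * c.cβ * C₂ / c.cρ ^ 2)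
              * (Lg + MARS.lambdaMax A c.β₁ x₁ y₁ l₁) ^ 2
          + C₃ * cγ * σ ^ 2 := by

  -- The constants are ζ(4/3) (the term k = 0 is zero), the bound for ∑ 1/(k ln²(k+2)), and 2 + 1
  -- from the harmonic sum and the initial variance.
  refine ⟨∑' k : ℕ, (k : ℝ) ^ (-(4 / 3) : ℝ), 3 / Real.log 2, 3, ?_⟩
  intro n m d M R T Ξ _ P _ f g A LF Lg σ Lt hR hT hf hA1 hA2 hA3
  refine ⟨?_, ?_⟩
  · obtain ⟨p, q, hpq⟩ := hR.exists_bounds hA1.compact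
    obtain ⟨B, hB⟩ := hA1.exists_gradient_bound
    exact ⟨p, q, B, hpq, hB⟩
  intro p q B hpq hB c cν cγ x₁ y₁ l₁ hx₁ hβ₁ hρ hα hα1 hβ hβ1 hν hν1 hγ hγ1 hνγ hη hη1 hη2 hη3
    Ω _ μ _ b ξ x v y l hS h
  have hρ1 : 1 ≤ c.cρ := by
    have : 1 ≤ Real.sqrt 2 := Real.one_le_sqrt.2 (by norm_num)
    linarith
  have had : MARS.Admissible c cγ ‖A‖ p (MARS.smoothConst ‖A‖ (Metric.diam M) B LF Lg
      (MARS.lambdaMax A c.β₁ x₁ y₁ l₁) p q) Lt :=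
    -- c_ν enters only through 8 ≤ c_ν c_γ ≤ c_ρ c_γ.
    ⟨hβ₁.le, hρ1, hα, hα1, hβ, hβ1, hγ, hγ1, hνγ.trans (by gcongr), hη, hη1, hη2, hη3⟩
  exact ⟨fun k hk => h.integrable_sq hS hf hR hT hA1 hA2 hA3 hB (by linarith) hx₁ hk,
    fun K hK => h.sum_le hS hf hA1 hA2 hA3 hR hT hpq hB hx₁ had hK⟩
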